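/- Let $K$ be a field and let $\mathrm{Gr}(k,n)$ be the Grassmannian of $k$-dimensional subspaces of affine $n$-space over $K$, regarded as row spans of $k\times n$ matrices, with the action of the torus $T$ of diagonal matrices. A subvariety is a reduced and irreducible closed subscheme. For a $k$-subset $S\subseteq[n]=\{1,\dots,n\}$ let $p_S$ be the Plücker coordinate (the $k\times k$ minor in the columns $S$) and let $\mathrm{coord}(S)$ be the $T$-fixed point consisting of the vectors that use only coordinates from $S$. For a $T$-invariant closed subscheme $X$ put $\mathrm{coord}^{-1}(X^T)=\{S : \mathrm{coord}(S)\in X^T\}$, and for a collection $\mathcal C\subseteq\binom{[n]}{k}$ let $\mathrm{coord}(\mathcal C)=\bigcap_{S\notin\mathcal C}\{p_S=0\}$, a closed subscheme of $\mathrm{Gr}(k,n)$. Fix $i\neq j$ in $[n]$. Combinatorial shift: for $a\in[n]$ put $\mathrm{sh}_{i\to j}\,a=j$ if $a=i$ and $\mathrm{sh}_{i\to j}\,a=a$ otherwise. For $S\subseteq[n]$, the set $\mathrm{sh}_{i\to j}S$ is obtained by replacing each $a\in S$ with $\mathrm{sh}_{i\to j}a$ unless $\mathrm{sh}_{i\to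 j}a\in S$, in which case $a$ is kept. For a collection $\mathcal C$, the collection $\mathrm{sh}_{i\to j}\mathcal C$ is obtained by replacing each $S\in\mathcal C$ with $\mathrm{sh}_{i\to j}S$ unless $\mathrm{sh}_{i\to j}S\in\mathcal C$, in which case $S$ is kept. Geometric shift: for a closed subscheme $X\subseteq\mathrm{Gr}(k,n)$, let $\mathrm{sh}_{i\to j}X=\lim_{t\to\infty}\exp(te_{ij})\cdot X$, that is, the scheme-theoretic fibre over $t=\infty$ of the closure of $\{(t,\exp(te_{ij})\cdot x): t\in\mathbb A^1,\ x\in X\}$ in $\mathbb P^1\times\mathrm{Gr}(k,n)$; here $\exp(te_{ij})=1+te_{ij}$ acts on row spans by adding $t$ times column $i$ to column $j$. Theorem. Let $X,X'_1,\dots,X'_m\subseteq\mathrm{Gr}(k,n)$ be $T$-invariant subvarieties, all of the same dimension. Assume that $$\mathrm{coord}\bigl(\mathrm{sh}_{i\to j}\,\mathrm{coord}^{-1}(X^T)\bigr)=\bigcup_{l=1}^m X'_l\quad\text{as schemes},$$ and that for every $l$ we have $(X'_l)^T\setminus\bigcup_{l'\neq l}(X'_{l'})^T\neq\emptyset$.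 Then $\mathrm{sh}_{i\to j}X=\bigcup_{l=1}^m X'_l$ as schemes. -/

import Mathlib

open CategoryTheory AlgebraicGeometry
open scoped Polynomial LaurentPolynomial

universe u

namespace GrShift

noncomputable section

/-! ### The Grassmannian as a scheme

`Gr(k, n)` over a commutative ring `R` is `Proj` of its homogeneous coordinate ring in the Plücker
embedding, the graded `R`-algebra generated by the maximal minors of a generic `k × n` matrix.
A matrix `M` of rank `k` stands for the subspace `rowspan M` of affine `n`-space. -/

/-- The maximal minor of the `k × n` matrix `M` in the columns `S`. -/
def minor {B : Type*} [CommRing B] {k n : ℕ} (M : Matrix (Fin k) (Fin n) B)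
    (S : Finset (Fin n)) (hS : S.card = k) : B :=
  (M.submatrix id (S.orderEmbOfFin hS)).det

/-- The `R`-span of the maximal minors of the generic `k × n` matrix. -/
def minorSpan (R : Type u) [CommRing R] (k n : ℕ) :
    Submodule R (MvPolynomial (Fin k × Fin n) R) :=
  Submodule.span R {p | ∃ (S : Finset (Fin n)) (hS : S.card = k),
    p = minor (Matrix.mvPolynomialX (Fin k) (Fin n) R) S hS}

/-- The subalgebra `⨁ d, V ^ d z ^ d` of `R[x_{ab}][z]`, where `V` is the span of the maximal
minors. It is generated by the elements `z • minor`, and `z` records the degree. -/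
def coordSubalgebra (R : Type u) [CommRing R] (k n : ℕ) :
    Subalgebra R (MvPolynomial (Fin k × Fin n) R)[X] where
  carrier := {F | ∀ d, F.coeff d ∈ minorSpan R k n ^ d}
  mul_mem' {F G} hF hG d := by
    rw [Polynomial.coeff_mul]
    refine Submodule.sum_mem _ fun p hp => ?_
    rw [← Finset.HasAntidiagonal.mem_antidiagonal.mp hp, pow_add]
    exact Submodule.mul_mem_mul (hF _) (hG _)
  add_mem' {F G} hF hG d := by
    rw [Polynomial.coeff_add]
    exact Submodule.add_mem _ (hF d) (hG d)
  algebraMap_mem' r d := by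
    rw [Polynomial.algebraMap_apply, Polynomial.coeff_C]
    split_ifs with h
    · subst h
      rw [pow_zero]
      exact Submodule.algebraMap_mem r
    · exact Submodule.zero_mem _

/-- The homogeneous coordinate ring of the Grassmannian in its Plücker embedding. -/
def CoordRing (R : Type u) [CommRing R] (k n : ℕ) : Type u := coordSubalgebra R k n

instance (R : Type u) [CommRing R] (k n : ℕ) : CommRing (CoordRing R k n) :=
  inferInstanceAs (CommRing (coordSubalgebra R k n))

instance (R : Type u) [CommRing R] (k n : ℕ) : Algebra R (CoordRing R k n) :=
  inferInstanceAs (Algebra R (coordSubalgebra R k n))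

/-- The inclusion of the homogeneous coordinate ring in `R[x_{ab}][z]`. -/
def incl (R : Type u) [CommRing R] (k n : ℕ) :
    CoordRing R k n →ₐ[R] (MvPolynomial (Fin k × Fin n) R)[X] :=
  (coordSubalgebra R k n).val

theorem incl_injective (R : Type u) [CommRing R] (k n : ℕ) :
    Function.Injective (incl R k n) :=
  Subtype.val_injective

theorem coeff_incl_mem {R : Type u} [CommRing R] {k n : ℕ} (F : CoordRing R k n) (d : ℕ) :
    (incl R k n F).coeff d ∈ minorSpan R k n ^ d :=
  Subtype.property (p := fun F => F ∈ coordSubalgebra R k n) F d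

/-- The element `p z ^ d` of the homogeneous coordinate ring, for `p ∈ V ^ d`. -/
def homog {R : Type u} [CommRing R] {k n : ℕ} (d : ℕ) (p : MvPolynomial (Fin k × Fin n) R)
    (hp : p ∈ minorSpan R k n ^ d) : CoordRing R k n :=
  ⟨Polynomial.monomial d p, fun e => by
    rw [Polynomial.coeff_monomial]
    split_ifs with h
    · exact h ▸ hp
    · exact Submodule.zero_mem _⟩

theorem incl_homog {R : Type u} [CommRing R] {k n : ℕ} (d : ℕ)
    (p : MvPolynomial (Fin k × Fin n) R) (hp : p ∈ minorSpan R k n ^ d) :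
    incl R k n (homog d p hp) = Polynomial.monomial d p :=
  rfl

/-- The grading of the homogeneous coordinate ring, by the degree in `z`. -/
def grading (R : Type u) [CommRing R] (k n : ℕ) (d : ℕ) : Submodule R (CoordRing R k n) where
  carrier := {F | ∀ e, e ≠ d → (incl R k n F).coeff e = 0}
  add_mem' {F G} hF hG e he := by
    simp [hF e he, hG e he]
  zero_mem' e _ := by simp
  smul_mem' r F hF e he := by
    simp [hF e he]

theorem homog_mem {R : Type u} [CommRing R] {k n : ℕ} (d : ℕ)
    (p : MvPolynomial (Fin k × Fin n) R) (hp : p ∈ minorSpan R k n ^ d) :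
    homog d p hp ∈ grading R k n d := fun e he => by
  rw [incl_homog, Polynomial.coeff_monomial, if_neg he.symm]

theorem coeff_coe {R : Type u} [CommRing R] {k n : ℕ}
    (y : DirectSum ℕ fun d => grading R k n d) (d : ℕ) :
    (incl R k n (DirectSum.coeAddMonoidHom (grading R k n) y)).coeff d =
      (incl R k n (y d)).coeff d := by
  classical
  induction y using DirectSum.induction_on with
  | zero => simp
  | of e z =>
    rw [DirectSum.coeAddMonoidHom_of]
    by_cases h : e = d
    · subst h
      rw [DirectSum.of_eq_same]
    · rw [DirectSum.of_eq_of_ne _ _ _ (Ne.symm h), z.2 d (Ne.symm h)]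
      simp
  | add y z hy hz =>
    rw [map_add, DirectSum.add_apply]
    simp [hy, hz]

theorem coe_injective (R : Type u) [CommRing R] (k n : ℕ) :
    Function.Injective (DirectSum.coeAddMonoidHom (grading R k n)) := by
  intro y z h
  ext d : 2
  apply incl_injective R k n
  ext1 e
  by_cases he : e = d
  · subst he
    rw [← coeff_coe, ← coeff_coe, h]
  · rw [(y d).2 e he, (z d).2 e he]

/-- The decomposition of an element into its homogeneous components. -/
def decomp {R : Type u} [CommRing R] {k n : ℕ} (F : CoordRing R k n) :
    DirectSum ℕ fun d => grading R k n d :=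
  ∑ d ∈ (incl R k n F).support, DirectSum.of (fun d => grading R k n d) d
    ⟨homog d ((incl R k n F).coeff d) (coeff_incl_mem F d), homog_mem _ _ _⟩

theorem coe_decomp {R : Type u} [CommRing R] {k n : ℕ} (F : CoordRing R k n) :
    DirectSum.coeAddMonoidHom (grading R k n) (decomp F) = F := by
  apply incl_injective R k n
  simp only [decomp, map_sum, DirectSum.coeAddMonoidHom_of, incl_homog]
  exact (incl R k n F).as_sum_support.symm

instance gradedAlgebra (R : Type u) [CommRing R] (k n : ℕ) : GradedAlgebra (grading R k n) where
  one_mem e he := by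
    simp [Polynomial.coeff_one, he]
  mul_mem i j F G hF hG e he := by
    rw [map_mul, Polynomial.coeff_mul]
    refine Finset.sum_eq_zero fun p hp => ?_
    by_cases h1 : p.1 = i
    · have : p.2 ≠ j := fun h2 =>
        he (by rw [← Finset.HasAntidiagonal.mem_antidiagonal.mp hp, h1, h2])
      rw [hG _ this, mul_zero]
    · rw [hF _ h1, zero_mul]
  decompose' := decomp
  left_inv F := coe_decomp F
  right_inv y := coe_injective R k n (coe_decomp _)

theorem incl_decompose {R : Type u} [CommRing R] {k n : ℕ} (F : CoordRing R k n) (d : ℕ) :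
    incl R k n (DirectSum.decompose (grading R k n) F d) =
      Polynomial.monomial d ((incl R k n F).coeff d) := by
  ext1 e
  rw [Polynomial.coeff_monomial]
  split_ifs with h
  · subst h
    rw [← coeff_coe]
    exact congrArg (fun G => (incl R k n G).coeff d) (coe_decomp F)
  · exact (DirectSum.decompose (grading R k n) F d).2 e (Ne.symm h)

/-- The Grassmannian `Gr(k, n)` over `R`. -/
abbrev Gr (R : Type u) [CommRing R] (k n : ℕ) : Scheme.{u} := Proj (grading R k n)

theorem minor_mem {R : Type u} [CommRing R] {k n : ℕ} (S : Finset (Fin n)) (hS : S.card = k) :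
    minor (Matrix.mvPolynomialX (Fin k) (Fin n) R) S hS ∈ minorSpan R k n ^ 1 := by
  rw [pow_one]
  exact Submodule.subset_span ⟨S, hS, rfl⟩

/-- The Plücker coordinate `p_S`. -/
def plucker (R : Type u) [CommRing R] {k n : ℕ} (S : Finset (Fin n)) (hS : S.card = k) :
    CoordRing R k n :=
  homog 1 (minor (Matrix.mvPolynomialX (Fin k) (Fin n) R) S hS) (minor_mem S hS)

theorem plucker_mem (R : Type u) [CommRing R] {k n : ℕ} (S : Finset (Fin n)) (hS : S.card = k) :
    plucker R S hS ∈ grading R k n 1 :=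
  homog_mem _ _ _

/-! ### Base change and the action of `GL_n` -/

/-- Every maximal minor of `M * g` is a linear combination of the maximal minors of `M`. -/
theorem minor_mul_mem {R B : Type*} [CommRing R] [CommRing B] [Algebra R B] {k n : ℕ}
    (M : Matrix (Fin k) (Fin n) B) (g : Matrix (Fin n) (Fin n) R)
    (S : Finset (Fin n)) (hS : S.card = k) :
    minor (M * g.map (algebraMap R B)) S hS ∈
      Submodule.span R {p | ∃ (S' : Finset (Fin n)) (hS' : S'.card = k), p = minor M S' hS'} := by
  have h1 : minor (M * g.map (algebraMap R B)) S hS =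
      ∑ f : Fin k → Fin n, (∏ a, g (f a) (S.orderEmbOfFin hS a)) • (M.submatrix id f).det := by
    have h2 : minor (M * g.map (algebraMap R B)) S hS = Matrix.detRowAlternating
        (fun a => ∑ c : Fin n, algebraMap R B (g c (S.orderEmbOfFin hS a)) •
          fun b => M b c) := by
      rw [minor, ← Matrix.det_transpose]
      congr 1
      ext a b
      simp [Matrix.mul_apply, Algebra.smul_def, mul_comm]
    rw [h2, ← AlternatingMap.coe_multilinearMap, MultilinearMap.map_sum]
    refine Finset.sum_congr rfl fun f _ => ?_
    rw [MultilinearMap.map_smul_univ, ← map_prod, algebraMap_smul,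
      ← Matrix.det_transpose (M.submatrix id f)]
    rfl
  rw [h1]
  refine Submodule.sum_mem _ fun f _ => Submodule.smul_mem _ _ ?_
  by_cases hf : Function.Injective f
  · let S' : Finset (Fin n) := Finset.univ.map ⟨f, hf⟩
    have hS' : S'.card = k := by simp [S']
    have hmem : ∀ a, ∃ b, S'.orderEmbOfFin hS' b = f a := by
      intro a
      have : f a ∈ Set.range (S'.orderEmbOfFin hS') := by
        rw [Finset.range_orderEmbOfFin]
        simp [S']
      exact this
    choose σ hσ using hmem
    have hσi : Function.Injective σ := fun a b hab => hf (by rw [← hσ a, ← hσ b, hab])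
    let τ : Equiv.Perm (Fin k) := Equiv.ofBijective σ (Finite.injective_iff_bijective.mp hσi)
    have h3 : M.submatrix id f = (M.submatrix id (S'.orderEmbOfFin hS')).submatrix id τ := by
      ext a b
      simp [τ, hσ]
    rw [h3, Matrix.det_permute']
    have h4 := Submodule.subset_span (R := R) (s := {p | ∃ (S' : Finset (Fin n))
      (hS' : S'.card = k), p = minor M S' hS'}) ⟨S', hS', rfl⟩
    rcases Int.units_eq_one_or (Equiv.Perm.sign τ) with h | h
    · simpa [h, minor] using h4
    · simpa [h, minor] using Submodule.neg_mem _ h4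
  · rw [Function.Injective] at hf
    push Not at hf
    obtain ⟨a, b, hab, hne⟩ := hf
    rw [Matrix.det_zero_of_column_eq hne (fun i => by simp [hab])]
    exact Submodule.zero_mem _

/-- The ring map that applies `φ` to the coefficients and substitutes the matrix `x * g` for the
matrix `x` of variables. -/
def substHom {R S : Type u} [CommRing R] [CommRing S] (k : ℕ) {n : ℕ} (φ : R →+* S)
    (g : Matrix (Fin n) (Fin n) S) :
    MvPolynomial (Fin k × Fin n) R →+* MvPolynomial (Fin k × Fin n) S :=
  MvPolynomial.eval₂Hom (MvPolynomial.C.comp φ) fun p =>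
    (Matrix.mvPolynomialX (Fin k) (Fin n) S *
      g.map (algebraMap S (MvPolynomial (Fin k × Fin n) S)) :
        Matrix (Fin k) (Fin n) (MvPolynomial (Fin k × Fin n) S)) p.1 p.2

theorem substHom_minor {R S : Type u} [CommRing R] [CommRing S] {k n : ℕ} (φ : R →+* S)
    (g : Matrix (Fin n) (Fin n) S) (Q : Finset (Fin n)) (hQ : Q.card = k) :
    substHom k φ g (minor (Matrix.mvPolynomialX (Fin k) (Fin n) R) Q hQ) =
      minor (Matrix.mvPolynomialX (Fin k) (Fin n) S *
        g.map (algebraMap S (MvPolynomial (Fin k × Fin n) S))) Q hQ := by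
  rw [minor, minor, RingHom.map_det]
  congr 1
  ext1 a b
  simp [substHom]

theorem substHom_mem {R S : Type u} [CommRing R] [CommRing S] {k n : ℕ} (φ : R →+* S)
    (g : Matrix (Fin n) (Fin n) S) (d : ℕ) {p : MvPolynomial (Fin k × Fin n) R}
    (hp : p ∈ minorSpan R k n ^ d) : substHom k φ g p ∈ minorSpan S k n ^ d := by
  have h1 : ∀ q ∈ minorSpan R k n, substHom k φ g q ∈ minorSpan S k n := by
    intro q hq
    induction hq using Submodule.span_induction with
    | mem x hx =>
      obtain ⟨Q, hQ, rfl⟩ := hx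
      rw [substHom_minor]
      exact minor_mul_mem _ _ _ _
    | zero => simp
    | add x y _ _ hx hy => rw [map_add]; exact Submodule.add_mem _ hx hy
    | smul r x _ hx =>
      have : substHom k φ g (r • x) = φ r • substHom k φ g x := by
        rw [Algebra.smul_def, Algebra.smul_def, map_mul]
        simp [substHom, MvPolynomial.algebraMap_eq]
      rw [this]
      exact Submodule.smul_mem _ _ hx
  induction hp using Submodule.pow_induction_on_left' with
  | algebraMap r =>
    have : substHom k φ g (algebraMap R _ r) = algebraMap S _ (φ r) := by
      simp [substHom, MvPolynomial.algebraMap_eq]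
    rw [this, pow_zero]
    exact Submodule.algebraMap_mem _
  | add x y i _ _ hx hy => rw [map_add]; exact Submodule.add_mem _ hx hy
  | mem_mul m hm i x _ hx =>
    rw [map_mul, pow_succ']
    exact Submodule.mul_mem_mul (h1 m hm) hx

/-- The map of homogeneous coordinate rings that applies `φ` to the coefficients and substitutes
`x * g` for `x`. -/
def coordMap {R S : Type u} [CommRing R] [CommRing S] (k : ℕ) {n : ℕ} (φ : R →+* S)
    (g : Matrix (Fin n) (Fin n) S) : grading R k n →+*ᵍ grading S k n where
  toRingHom := ((Polynomial.mapRingHom (substHom k φ g)).comp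
      (incl R k n).toRingHom).codRestrict (coordSubalgebra S k n) (fun F d => by
    simpa using substHom_mem φ g d (coeff_incl_mem F d))
  map_mem {d F} hF e he := by
    change ((incl R k n F).map (substHom k φ g)).coeff e = 0
    rw [Polynomial.coeff_map, hF e he, map_zero]

theorem incl_coordMap {R S : Type u} [CommRing R] [CommRing S] {k n : ℕ} (φ : R →+* S)
    (g : Matrix (Fin n) (Fin n) S) (F : CoordRing R k n) :
    incl S k n (coordMap k φ g F) = (incl R k n F).map (substHom k φ g) :=
  rfl

theorem irrelevant_le_map {R S : Type u} [CommRing R] [CommRing S] (k : ℕ) {n : ℕ} (φ : R →+* S)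
    (g : GL (Fin n) S) :
    HomogeneousIdeal.irrelevant (grading S k n) ≤
      (HomogeneousIdeal.irrelevant (grading R k n)).map (coordMap k φ g.1) := by
  rw [HomogeneousIdeal.irrelevant_le]
  intro d hd F hF
  change F ∈ (HomogeneousIdeal.irrelevant (grading R k n)).toIdeal.map (coordMap k φ g.1)
  set I := (HomogeneousIdeal.irrelevant (grading R k n)).toIdeal.map (coordMap k φ g.1) with hI
  have h0 : ∀ (Q : Finset (Fin n)) (hQ : Q.card = k), coordMap k φ g.1 (plucker R Q hQ) ∈ I := by
    intro Q hQ
    refine Ideal.mem_map_of_mem _ ?_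
    exact HomogeneousIdeal.mem_irrelevant_of_mem _ one_pos (plucker_mem R Q hQ)
  have h1 : ∀ v ∈ minorSpan S k n, ∃ G ∈ I, incl S k n G = Polynomial.monomial 1 v := by
    have h2 : minorSpan S k n ≤ Submodule.span S {p | ∃ (Q : Finset (Fin n)) (hQ : Q.card = k),
        p = minor (Matrix.mvPolynomialX (Fin k) (Fin n) S *
          g.1.map (algebraMap S (MvPolynomial (Fin k × Fin n) S))) Q hQ} := by
      refine Submodule.span_le.mpr ?_
      rintro _ ⟨Q, hQ, rfl⟩
      have h3 := minor_mul_mem (Matrix.mvPolynomialX (Fin k) (Fin n) S *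
        g.1.map (algebraMap S (MvPolynomial (Fin k × Fin n) S))) (g⁻¹).1 Q hQ
      rwa [Matrix.mul_assoc, ← Matrix.map_mul, ← Units.val_mul, mul_inv_cancel, Units.val_one,
        Matrix.map_one _ (map_zero _) (map_one _), Matrix.mul_one] at h3
    intro v hv
    replace hv := h2 hv
    clear h2
    induction hv using Submodule.span_induction with
    | mem x hx =>
      obtain ⟨Q, hQ, rfl⟩ := hx
      refine ⟨_, h0 Q hQ, ?_⟩
      rw [incl_coordMap, plucker, incl_homog, Polynomial.map_monomial, substHom_minor]
    | zero => exact ⟨0, I.zero_mem, by simp⟩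
    | add x y _ _ hx hy =>
      obtain ⟨G, hG, hG'⟩ := hx
      obtain ⟨H, hH, hH'⟩ := hy
      exact ⟨G + H, I.add_mem hG hH, by rw [map_add, hG', hH', map_add]⟩
    | smul r x _ hx =>
      obtain ⟨G, hG, hG'⟩ := hx
      refine ⟨algebraMap S _ r * G, I.mul_mem_left _ hG, ?_⟩
      rw [← Algebra.smul_def, map_smul, hG', Polynomial.smul_monomial]
  obtain ⟨e, rfl⟩ : ∃ e, d = e + 1 := ⟨d - 1, by omega⟩
  have h4 : ∀ p ∈ minorSpan S k n ^ (e + 1),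
      ∃ G ∈ I, incl S k n G = Polynomial.monomial (e + 1) p := by
    intro p hp
    rw [pow_succ'] at hp
    induction hp using Submodule.mul_induction_on' with
    | mem_mul_mem v hv q hq =>
      obtain ⟨G, hG, hG'⟩ := h1 v hv
      refine ⟨homog e q hq * G, I.mul_mem_left _ hG, ?_⟩
      rw [map_mul, hG', incl_homog, Polynomial.monomial_mul_monomial, mul_comm q]
    | add x _ y _ hx hy =>
      obtain ⟨G, hG, hG'⟩ := hx
      obtain ⟨H, hH, hH'⟩ := hy
      exact ⟨G + H, I.add_mem hG hH, by rw [map_add, hG', hH', map_add]⟩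
  obtain ⟨G, hG, hG'⟩ := h4 _ (coeff_incl_mem F (e + 1))
  convert hG
  apply incl_injective S k n
  rw [hG']
  ext1 m
  rw [Polynomial.coeff_monomial]
  split_ifs with h
  · rw [h]
  · exact hF m (Ne.symm h)

/-- The morphism `Gr(k, n)_S ⟶ Gr(k, n)_R` given by `rowspan M ↦ rowspan (M * g)` followed by the
base change projection along `φ : R →+* S`. -/
def Gr.map {R S : Type u} [CommRing R] [CommRing S] (k : ℕ) {n : ℕ} (φ : R →+* S)
    (g : GL (Fin n) S) : Gr S k n ⟶ Gr R k n :=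
  Proj.map (coordMap k φ g.1) (irrelevant_le_map k φ g)

/-- The projection `Gr(k, n)_S ⟶ Gr(k, n)_R` along `φ : R →+* S`. -/
def Gr.baseChange {R S : Type u} [CommRing R] [CommRing S] (k n : ℕ) (φ : R →+* S) :
    Gr S k n ⟶ Gr R k n :=
  Gr.map k φ 1

/-- The action `rowspan M ↦ rowspan (M * g)` of `g : GL_n(R)` on the Grassmannian over `R`. -/
def Gr.act {R : Type u} [CommRing R] (k : ℕ) {n : ℕ} (g : GL (Fin n) R) : Gr R k n ⟶ Gr R k n :=
  Gr.map k (RingHom.id R) g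

/-- The diagonal matrix with entries `t`, an `R`-point of the torus `T`. -/
def diagGL {R : Type u} [CommRing R] {n : ℕ} (t : Fin n → Rˣ) : GL (Fin n) R :=
  Units.map (Matrix.diagonalRingHom (Fin n) R).toMonoidHom (MulEquiv.piUnits.symm t)

/-- The matrix `exp (t e_ij) = 1 + t e_ij`, for `i ≠ j`. Acting on row vectors, it adds `t` times
column `i` to column `j`. -/
def expGL {R : Type u} [CommRing R] {n : ℕ} {i j : Fin n} (hij : i ≠ j) (t : R) :
    GL (Fin n) R where
  val := Matrix.transvection i j t
  inv := Matrix.transvection i j (-t)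
  val_inv := by rw [Matrix.transvection_mul_transvection_same _ _ hij, add_neg_cancel,
    Matrix.transvection_zero]
  inv_val := by rw [Matrix.transvection_mul_transvection_same _ _ hij, neg_add_cancel,
    Matrix.transvection_zero]

/-! ### Closed subschemes

A closed subscheme `X` of a scheme is given by its ideal sheaf. Thus `X.subscheme` is the scheme
itself, `X.support` its set of points, unions of subschemes are infima `⨅` and intersections are
suprema `⨆` of ideal sheaves, `X.comap f` is the scheme-theoretic preimage, and `X.map f` the
scheme-theoretic image, the smallest closed subscheme through which `X ⟶ _ ⟶ _` factors. -/

variable {K : Type u} [Field K] {k n : ℕ}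

/-- A subvariety is a reduced and irreducible closed subscheme. -/
def IsSubvariety (X : (Gr K k n).IdealSheafData) : Prop :=
  AlgebraicGeometry.IsIntegral X.subscheme

/-- `X` is invariant under the torus `T` of diagonal matrices: for every `K`-algebra `R`,
the base change of `X` to `R` is invariant under all `R`-points of `T`. -/
def TInvariant (X : (Gr K k n).IdealSheafData) : Prop :=
  ∀ (R : Type u) [CommRing R] [Algebra K R] (t : Fin n → Rˣ),
    (X.comap (Gr.baseChange k n (algebraMap K R))).comap (Gr.act k (diagGL t)) =
      X.comap (Gr.baseChange k n (algebraMap K R))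

/-- The set of `T`-fixed points `X ^ T`: the closed points of `X` that are `T`-invariant as reduced
closed subschemes. -/
def fixedPoints (X : (Gr K k n).IdealSheafData) : Set (Gr K k n) :=
  {x | x ∈ X.support ∧ IsClosed {x} ∧
    TInvariant (Scheme.IdealSheafData.vanishingIdeal (TopologicalSpace.Closeds.closure {x}))}

/-- Evaluation of the homogeneous coordinate ring at the matrix `M`. -/
def evalHom (M : Matrix (Fin k) (Fin n) K) : CoordRing K k n →+* K[X] :=
  (Polynomial.mapRingHom (MvPolynomial.eval fun p => M p.1 p.2)).comp (incl K k n).toRingHom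

theorem evalHom_plucker (M : Matrix (Fin k) (Fin n) K) (S : Finset (Fin n)) (hS : S.card = k) :
    evalHom M (plucker K S hS) = Polynomial.monomial 1 (minor M S hS) := by
  change Polynomial.map _ (incl K k n (plucker K S hS)) = _
  rw [plucker, incl_homog, Polynomial.map_monomial, minor, RingHom.map_det, minor]
  congr 2
  ext1 a b
  simp

/-- The `K`-point `rowspan M` of the Grassmannian, for a `k × n` matrix `M` of rank `k`: the
homogeneous forms that vanish at `M`. -/
def rowspan (M : Matrix (Fin k) (Fin n) K)
    (hM : ∃ (S : Finset (Fin n)) (hS : S.card = k), minor M S hS ≠ 0) : Gr K k n :=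
  show ProjectiveSpectrum (grading K k n) from
  { asHomogeneousIdeal :=
      { toSubmodule := RingHom.ker (evalHom M)
        is_homogeneous' := fun d F hF => by
          rw [RingHom.mem_ker] at hF ⊢
          have h := congrArg (fun G => Polynomial.coeff G d) hF
          change Polynomial.coeff (Polynomial.map _ (incl K k n F)) d = 0 at h
          rw [Polynomial.coeff_map] at h
          change Polynomial.map _ (incl K k n (DirectSum.decompose (grading K k n) F d)) = 0
          rw [incl_decompose, Polynomial.map_monomial, h, map_zero] }
    isPrime := RingHom.ker_isPrime (evalHom M)
    not_irrelevant_le := fun h => by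
      obtain ⟨S, hS, hne⟩ := hM
      have h1 := h (HomogeneousIdeal.mem_irrelevant_of_mem _ one_pos (plucker_mem K S hS))
      change evalHom M (plucker K S hS) = 0 at h1
      rw [evalHom_plucker, Polynomial.monomial_eq_zero_iff] at h1
      exact hne h1 }

/-- The coordinate subspace `coord S`, the row span of the matrix whose rows are the standard basis
vectors with indices in `S`. -/
def coordPt (K : Type u) [Field K] {k n : ℕ} (S : Finset (Fin n)) (hS : S.card = k) :
    Gr K k n :=
  rowspan ((1 : Matrix (Fin n) (Fin n) K).submatrix (S.orderEmbOfFin hS) id)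
    ⟨S, hS, by
      rw [minor, Matrix.submatrix_submatrix, Function.id_comp, Function.comp_id,
        Matrix.submatrix_one _ (S.orderEmbOfFin hS).injective, Matrix.det_one]
      exact one_ne_zero⟩

/-- The collection `coord⁻¹ X` of the `k`-subsets `S` of `[n]` with `coord S ∈ X`, or equivalently
`coord S ∈ X ^ T`, since coordinate subspaces are `T`-fixed. -/
def coordInv (X : (Gr K k n).IdealSheafData) : Set (Finset (Fin n)) :=
  {S | ∃ hS : S.card = k, coordPt K S hS ∈ X.support}

/-- The Plücker coordinate `p_S` vanishes on `X`: on each standard chart `p_Q ≠ 0`, the function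
`p_S / p_Q` lies in the ideal of `X`. -/
def PluckerVanishes (S : Finset (Fin n)) (hS : S.card = k) (X : (Gr K k n).IdealSheafData) :
    Prop :=
  ∀ (Q : Finset (Fin n)) (hQ : Q.card = k),
    Proj.awayToSection (grading K k n) (plucker K Q hQ)
        (HomogeneousLocalization.Away.mk (grading K k n) (plucker_mem K Q hQ) 1 (plucker K S hS)
          (by simpa using plucker_mem K S hS)) ∈
      X.ideal ⟨Proj.basicOpen (grading K k n) (plucker K Q hQ),
        Proj.isAffineOpen_basicOpen (grading K k n) _ (plucker_mem K Q hQ) one_pos⟩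

/-- The closed subscheme `{p_S = 0}`: the largest closed subscheme on which `p_S` vanishes. -/
def pluckerDivisor (K : Type u) [Field K] {k n : ℕ} (S : Finset (Fin n)) (hS : S.card = k) :
    (Gr K k n).IdealSheafData :=
  sInf {X | PluckerVanishes S hS X}

/-- The closed subscheme `coord C`, the intersection of the `{p_S = 0}` for the `k`-subsets `S` of
`[n]` outside `C`. -/
def coord (K : Type u) [Field K] (k : ℕ) {n : ℕ} (C : Set (Finset (Fin n))) :
    (Gr K k n).IdealSheafData :=
  ⨆ (S : Finset (Fin n)) (hS : S.card = k) (_ : S ∉ C), pluckerDivisor K S hS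

/-! ### The two shifts -/

/-- The shift of an element of `[n]`. -/
def shiftElt (i j m : Fin n) : Fin n := if m = i then j else m

/-- The shift of a subset of `[n]`. -/
def shiftSet (i j : Fin n) (S : Finset (Fin n)) : Finset (Fin n) :=
  S.image fun m => if shiftElt i j m ∈ S then m else shiftElt i j m

open scoped Classical in
/-- The combinatorial shift of a collection of subsets of `[n]`. -/
def shiftColl (i j : Fin n) (C : Set (Finset (Fin n))) : Set (Finset (Fin n)) :=
  (fun S => if shiftSet i j S ∈ C then S else shiftSet i j S) '' C

/-- The family `{(t, exp (t e_ij) x) : t ≠ 0, x ∈ X}` over the punctured neighbourhood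
`Spec K[u, u⁻¹]` of `∞` in the projective line, with local coordinate `u = t⁻¹`. -/
def shiftFamily {i j : Fin n} (hij : i ≠ j) (X : (Gr K k n).IdealSheafData) :
    (Gr K[T;T⁻¹] k n).IdealSheafData :=
  (X.comap (Gr.baseChange k n (algebraMap K K[T;T⁻¹]))).map
    (Gr.act k (expGL hij (LaurentPolynomial.T (-1))))

/-- The closure of the family over the neighbourhood `Spec K[u]` of `∞` in the projective line. -/
def shiftClosure {i j : Fin n} (hij : i ≠ j) (X : (Gr K k n).IdealSheafData) :
    (Gr K[X] k n).IdealSheafData :=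
  (shiftFamily hij X).map (Gr.baseChange k n Polynomial.toLaurent)

/-- The geometric shift of `X`: the limit of `exp (t e_ij) X` for `t ⟶ ∞`, which is the
scheme-theoretic fibre of the closure over `∞`, the point `u = 0`. -/
def geomShift {i j : Fin n} (hij : i ≠ j) (X : (Gr K k n).IdealSheafData) :
    (Gr K k n).IdealSheafData :=
  (shiftClosure hij X).comap (Gr.baseChange k n (Polynomial.evalRingHom (0 : K)))

end

end GrShift

/-!
Write `sh X` for the geometric shift of `X` and `Y = coord (sh (coord⁻¹ X^T))`; by assumption
`Y` is the union of the `X'_l`. The proof consists of two opposite inclusions: `sh X ⊆ Y`, which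
holds for every `T`-invariant subvariety `X`, and `X'_l ⊆ sh X` for every `l`, which is a count of
dimensions.

A subvariety `X` is described by its generic point, the row span of a matrix `M` over an extension
field `L` of `K`; its functions on the chart `p_S ≠ 0` form the `K`-algebra generated by the ratios
`p_T(M) / p_S(M)`. With `u = t⁻¹` an indeterminate over `L`, the closure of the family
`exp (t e_ij) X` over a neighbourhood of `u = 0` is again integral, with generic point
`N = M exp (u⁻¹ e_ij)` (`shiftClosure_closureIdeal`), and `sh X` is the divisor `u = 0` in it.
Forms over `K[u]` that vanish at `N` therefore restrict at `u = 0` to equations of `sh X`.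

* `sh X ⊆ Y` (`coord_shiftColl_le_geomShift`). By `T`-invariance `S` lies in `coord⁻¹ X^T` if and
  only if `p_S(M) ≠ 0` (`mem_coordInv_closureIdeal_iff`). If `S` is not in the shifted collection,
  then `p_S` vanishes on the family, or `i ∈ S`, `j ∉ S` and `p_S ± u p_T` does, where
  `T = S \ {i} ∪ {j}`.
* For `S` in the shifted collection, `sh X` meets the chart `p_S ≠ 0`
  (`chartIdeal_geomShift_ne_top`): the one-parameter subgroups of `T`, applied to `M` with suitable
  weights while `u` tends to `0`, give an arc in the family whose limit satisfies `p_S ≠ 0`.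
* Hence `u` is not a unit on the chart `p_S ≠ 0` of the family, whose ring is a finitely generated
  domain of transcendence degree `dim X + 1`. By Krull's principal ideal theorem
  `sh X ∩ {p_S ≠ 0}` has dimension at least `dim X` (`le_ringKrullDim_chart_geomShift`).
* A `T`-fixed point of `X'_l` that is on no other `X'_l'` is `coord S` for some `S`
  (`exists_eq_coordPt`), and `S` is in the shifted collection
  (`mem_of_coordPt_mem_support_coord`). A `T`-invariant subvariety that misses `coord S` misses the
  chart `p_S ≠ 0`, so on this chart `Y` is `X'_l`, and `sh X ⊆ X'_l` there. As `X'_l` is integral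
  of dimension `dim X`, equality holds on the chart, so `sh X` contains the generic point of `X'_l`
  (`geomShift_le_of_chartIdeal_le`).

Closed subschemes are represented by ideal sheaves, so that inclusions of subschemes appear below
with `≤` reversed.
-/

/-! ### Dimension of finitely generated algebras over a field -/

theorem Polynomial.exists_isMaximal_height_eq {R : Type*} [CommRing R] [IsNoetherianRing R]
    [IsJacobsonRing R] (P : Ideal R[X]) [P.IsMaximal] :
    ∃ p : Ideal R, p.IsMaximal ∧ P.height = p.height + 1 :=
  ⟨P.under R, Polynomial.isMaximal_comap_C_of_isJacobsonRing P,
    Polynomial.height_eq_height_add_one (P.under R) P⟩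

/-- Every maximal ideal of a polynomial ring in `s` variables over a field has height `s`. -/
theorem MvPolynomial.height_eq_of_isMaximal {K : Type*} [Field K] (s : ℕ)
    (m : Ideal (MvPolynomial (Fin s) K)) [hm : m.IsMaximal] : m.height = s := by
  induction s with
  | zero =>
    have h := MvPolynomial.isEmptyRingEquiv K (Fin 0)
    have h1 : IsField (MvPolynomial (Fin 0) K) := h.toMulEquiv.isField (Field.toIsField K)
    let := h1.toField
    have : m = ⊥ := Ideal.eq_bot_of_prime m
    subst this
    simp
  | succ s ih =>
    let e := (MvPolynomial.finSuccEquiv K s).toRingEquiv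
    let P : Ideal (MvPolynomial (Fin s) K)[X] := m.map e
    have hP : P.IsMaximal := Ideal.map_isMaximal_of_equiv e
    have h1 : P.height = m.height := e.height_map m
    obtain ⟨p, hp, h2⟩ := Polynomial.exists_isMaximal_height_eq P
    rw [← h1, h2, ih]
    rfl

/-- By incomparability, integral extensions do not raise the dimension. -/
theorem ringKrullDim_le_of_isIntegral (R S : Type*) [CommRing R] [CommRing S] [Algebra R S]
    [Algebra.IsIntegral R S] : ringKrullDim S ≤ ringKrullDim R := by
  refine Order.krullDim_le_of_strictMono (PrimeSpectrum.comap (algebraMap R S)) ?_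
  intro p q h
  exact Ideal.IsIntegral.comap_lt_comap h

/-- A finitely generated domain over a field: its transcendence degree bounds its dimension, and
every maximal ideal has at least that height. -/
theorem Algebra.FiniteType.exists_trdeg_eq (K : Type u) [Field K] (B : Type u) [CommRing B]
    [IsDomain B] [Algebra K B] [Algebra.FiniteType K B] :
    ∃ s : ℕ, Algebra.trdeg K B = s ∧ ringKrullDim B ≤ s ∧
      ∀ m : Ideal B, m.IsMaximal → (s : ℕ∞) ≤ m.height := by
  obtain ⟨s, g, hg, hfin⟩ := exists_finite_inj_algHom_of_fg K B
  refine ⟨s, ?_⟩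
  let := g.toRingHom.toAlgebra
  have hst : IsScalarTower K (MvPolynomial (Fin s) K) B :=
    .of_algebraMap_eq fun r => (g.commutes r).symm
  have : Module.Finite (MvPolynomial (Fin s) K) B := hfin
  have : Algebra.IsIntegral (MvPolynomial (Fin s) K) B := inferInstance
  have : FaithfulSMul (MvPolynomial (Fin s) K) B :=
    (faithfulSMul_iff_algebraMap_injective _ _).mpr hg
  have : IsNoetherianRing B := Algebra.FiniteType.isNoetherianRing K B
  refine ⟨?_, ?_, ?_⟩
  · rw [← trdeg_add_eq K (MvPolynomial (Fin s) K) (A := B), MvPolynomial.trdeg_of_isDomain,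
      _root_.trdeg_eq_zero]
    simp
  · refine (ringKrullDim_le_of_isIntegral (MvPolynomial (Fin s) K) B).trans ?_
    rw [MvPolynomial.ringKrullDim_of_isNoetherianRing, ringKrullDim_eq_zero_of_field]
    simp
  · intro m hm
    have : (m.under (MvPolynomial (Fin s) K)).IsMaximal :=
      Ideal.isMaximal_comap_of_isIntegral_of_isMaximal m
    rw [Ideal.height_eq_height_add_of_liesOver_of_hasGoingDown (m.under (MvPolynomial (Fin s) K)) m,
      MvPolynomial.height_eq_of_isMaximal]
    exact le_self_add

/-- The quotient of a finitely generated domain over a field by a single nonunit has dimension at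
least one less than the transcendence degree. -/
theorem Algebra.FiniteType.le_ringKrullDim_quotient_span_singleton (K : Type u) [Field K]
    (B : Type u) [CommRing B] [IsDomain B] [Algebra K B] [Algebra.FiniteType K B] {n : ℕ}
    (hn : Algebra.trdeg K B = n + 1) {x : B} (hx : ¬ IsUnit x) :
    (n : WithBot ℕ∞) ≤ ringKrullDim (B ⧸ Ideal.span {x}) := by
  obtain ⟨s, hs, -, hmax⟩ := Algebra.FiniteType.exists_trdeg_eq K B
  have hsn : s = n + 1 := by
    rw [hs] at hn
    exact_mod_cast hn
  subst hsn
  have : IsNoetherianRing B := Algebra.FiniteType.isNoetherianRing K B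
  obtain ⟨m, hm, hxm⟩ := exists_max_ideal_of_mem_nonunits hx
  have h1 : ((n + 1 : ℕ) : WithBot ℕ∞) ≤ ringKrullDim (B ⧸ Ideal.span {x}) + 1 :=
    le_trans (WithBot.coe_le_coe.mpr (hmax m hm))
      (Ideal.height_le_ringKrullDim_quotient_add_one hxm)
  generalize ringKrullDim (B ⧸ Ideal.span {x}) = d at h1
  induction d with
  | bot => simp at h1
  | coe d =>
    induction d with
    | top => exact le_top
    | coe d => exact_mod_cast Nat.le_of_succ_le_succ (by exact_mod_cast h1 : n + 1 ≤ d + 1)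

/-- A proper closed subset of an irreducible affine scheme of dimension at most `n` has dimension
less than `n`. -/
theorem Ideal.eq_bot_of_le_ringKrullDim_quotient {D : Type*} [CommRing D] [IsDomain D] {n : ℕ}
    (hD : ringKrullDim D ≤ n) {I : Ideal D} (hI : (n : WithBot ℕ∞) ≤ ringKrullDim (D ⧸ I)) :
    I = ⊥ := by
  by_contra hne
  obtain ⟨x, hx, hx0⟩ := Submodule.exists_mem_ne_zero_of_ne_bot hne
  have h1 := ringKrullDim_quotient_succ_le_of_nonZeroDivisor (mem_nonZeroDivisors_of_ne_zero hx0)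
  have h2 : ringKrullDim (D ⧸ I) ≤ ringKrullDim (D ⧸ Ideal.span {x}) :=
    ringKrullDim_le_of_surjective
      (Ideal.Quotient.factor ((Ideal.span_singleton_le_iff_mem I).mpr hx))
      (Ideal.Quotient.factor_surjective _)
  have h3 : (n : WithBot ℕ∞) + 1 ≤ n := (add_le_add_left (hI.trans h2) 1).trans (h1.trans hD)
  exact absurd h3 (by norm_cast; omega)

namespace GrShift

noncomputable section

/-! ### Evaluation of Plücker forms at matrices -/

section Eval

variable {R : Type u} [CommRing R] {E : Type*} [CommRing E] {k n : ℕ}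

/-- Evaluation of polynomials in the entries of a `k × n` matrix at the matrix `M` over an
`R`-algebra. -/
def evalPoly (φ : R →+* E) (M : Matrix (Fin k) (Fin n) E) :
    MvPolynomial (Fin k × Fin n) R →+* E :=
  MvPolynomial.eval₂Hom φ fun p => M p.1 p.2

/-- The graded evaluation homomorphism at `M`; the variable of `E[X]` records the degree. -/
def evalGraded (φ : R →+* E) (M : Matrix (Fin k) (Fin n) E) : CoordRing R k n →+* E[X] :=
  (Polynomial.mapRingHom (evalPoly φ M)).comp (incl R k n).toRingHom

/-- Evaluation at the point `(M, c)` of the affine cone, where the Plücker coordinates are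
`c` times the maximal minors of `M`. -/
def evalCone (φ : R →+* E) (M : Matrix (Fin k) (Fin n) E) (c : E) : CoordRing R k n →+* E :=
  (Polynomial.evalRingHom c).comp (evalGraded φ M)

/-- Evaluation of Plücker forms at the matrix `M`. -/
abbrev ev (φ : R →+* E) (M : Matrix (Fin k) (Fin n) E) : CoordRing R k n →+* E :=
  evalCone φ M 1

theorem evalPoly_minor (φ : R →+* E) (M : Matrix (Fin k) (Fin n) E) (S : Finset (Fin n))
    (hS : S.card = k) :
    evalPoly φ M (minor (Matrix.mvPolynomialX (Fin k) (Fin n) R) S hS) = minor M S hS := by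
  rw [minor, RingHom.map_det, minor]
  congr 1
  ext1 a b
  simp [evalPoly]

theorem evalGraded_apply (φ : R →+* E) (M : Matrix (Fin k) (Fin n) E) (F : CoordRing R k n) :
    evalGraded φ M F = (incl R k n F).map (evalPoly φ M) := rfl

theorem evalCone_apply (φ : R →+* E) (M : Matrix (Fin k) (Fin n) E) (c : E)
    (F : CoordRing R k n) : evalCone φ M c F = (evalGraded φ M F).eval c := rfl

theorem evalGraded_algebraMap (φ : R →+* E) (M : Matrix (Fin k) (Fin n) E) (r : R) :
    evalGraded φ M (algebraMap R _ r) = Polynomial.C (φ r) := by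
  rw [evalGraded_apply, AlgHom.commutes, Polynomial.algebraMap_apply, Polynomial.map_C]
  simp [evalPoly, MvPolynomial.algebraMap_eq]

theorem evalCone_algebraMap (φ : R →+* E) (M : Matrix (Fin k) (Fin n) E) (c : E) (r : R) :
    evalCone φ M c (algebraMap R _ r) = φ r := by
  rw [evalCone_apply, evalGraded_algebraMap, Polynomial.eval_C]

theorem evalGraded_plucker (φ : R →+* E) (M : Matrix (Fin k) (Fin n) E) (S : Finset (Fin n))
    (hS : S.card = k) :
    evalGraded φ M (plucker R S hS) = Polynomial.monomial 1 (minor M S hS) := by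
  rw [evalGraded_apply, plucker, incl_homog, Polynomial.map_monomial, evalPoly_minor]

theorem evalCone_plucker (φ : R →+* E) (M : Matrix (Fin k) (Fin n) E) (c : E)
    (S : Finset (Fin n)) (hS : S.card = k) :
    evalCone φ M c (plucker R S hS) = c * minor M S hS := by
  rw [evalCone_apply, evalGraded_plucker, Polynomial.eval_monomial, pow_one, mul_comm]

theorem ev_plucker (φ : R →+* E) (M : Matrix (Fin k) (Fin n) E)
    (S : Finset (Fin n)) (hS : S.card = k) :
    ev φ M (plucker R S hS) = minor M S hS := by
  rw [evalCone_plucker, one_mul]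

theorem incl_eq_monomial {d : ℕ} {F : CoordRing R k n} (hF : F ∈ grading R k n d) :
    incl R k n F = Polynomial.monomial d ((incl R k n F).coeff d) := by
  ext1 e
  rw [Polynomial.coeff_monomial]
  split_ifs with h
  · rw [h]
  · exact hF e (Ne.symm h)

theorem evalGraded_of_mem (φ : R →+* E) (M : Matrix (Fin k) (Fin n) E) {d : ℕ}
    {F : CoordRing R k n} (hF : F ∈ grading R k n d) :
    evalGraded φ M F = Polynomial.monomial d (ev φ M F) := by
  rw [evalCone_apply, evalGraded_apply, incl_eq_monomial hF, Polynomial.map_monomial,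
    Polynomial.eval_monomial, one_pow, mul_one]

theorem evalGraded_eq_zero_iff (φ : R →+* E) (M : Matrix (Fin k) (Fin n) E) {d : ℕ}
    {F : CoordRing R k n} (hF : F ∈ grading R k n d) :
    evalGraded φ M F = 0 ↔ ev φ M F = 0 := by
  rw [evalGraded_of_mem φ M hF, Polynomial.monomial_eq_zero_iff]

theorem evalCone_of_mem (φ : R →+* E) (M : Matrix (Fin k) (Fin n) E) (c : E) {d : ℕ}
    {F : CoordRing R k n} (hF : F ∈ grading R k n d) :
    evalCone φ M c F = c ^ d * ev φ M F := by
  rw [evalCone_apply, evalGraded_of_mem φ M hF, Polynomial.eval_monomial, mul_comm]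

/-- The homogeneous coordinate ring is generated by the Plücker coordinates. -/
theorem adjoin_plucker (R : Type u) [CommRing R] (k n : ℕ) :
    Algebra.adjoin R {F : CoordRing R k n | ∃ (S : Finset (Fin n)) (hS : S.card = k),
      F = plucker R S hS} = ⊤ := by
  set T := Algebra.adjoin R {F : CoordRing R k n | ∃ (S : Finset (Fin n)) (hS : S.card = k),
      F = plucker R S hS} with hT
  have h1 : ∀ v ∈ minorSpan R k n, ∃ G ∈ T, incl R k n G = Polynomial.monomial 1 v := by
    intro v hv
    induction hv using Submodule.span_induction with
    | mem x hx =>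
      obtain ⟨Q, hQ, rfl⟩ := hx
      exact ⟨plucker R Q hQ, Algebra.subset_adjoin ⟨Q, hQ, rfl⟩, incl_homog _ _ _⟩
    | zero => exact ⟨0, T.zero_mem, by simp⟩
    | add x y _ _ hx hy =>
      obtain ⟨G, hG, hG'⟩ := hx
      obtain ⟨H, hH, hH'⟩ := hy
      exact ⟨G + H, T.add_mem hG hH, by rw [map_add, hG', hH', map_add]⟩
    | smul r x _ hx =>
      obtain ⟨G, hG, hG'⟩ := hx
      exact ⟨r • G, T.smul_mem hG r, by rw [map_smul, hG', Polynomial.smul_monomial]⟩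
  have h2 : ∀ d, ∀ p ∈ minorSpan R k n ^ d,
      ∃ G ∈ T, incl R k n G = Polynomial.monomial d p := by
    intro d p hp
    induction hp using Submodule.pow_induction_on_left' with
    | algebraMap r =>
      refine ⟨algebraMap R _ r, T.algebraMap_mem r, ?_⟩
      rw [AlgHom.commutes, Polynomial.algebraMap_apply, Polynomial.monomial_zero_left]
    | add x y i _ _ hx hy =>
      obtain ⟨G, hG, hG'⟩ := hx
      obtain ⟨H, hH, hH'⟩ := hy
      exact ⟨G + H, T.add_mem hG hH, by rw [map_add, hG', hH', map_add]⟩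
    | mem_mul m hm i x _ hx =>
      obtain ⟨G, hG, hG'⟩ := hx
      obtain ⟨H, hH, hH'⟩ := h1 m hm
      refine ⟨H * G, T.mul_mem hH hG, ?_⟩
      rw [map_mul, hG', hH', Polynomial.monomial_mul_monomial, add_comm]
  refine eq_top_iff.mpr fun F _ => ?_
  choose G hG hG' using h2
  have h3 : F = ∑ d ∈ (incl R k n F).support, G d _ (coeff_incl_mem F d) := by
    apply incl_injective R k n
    simp only [map_sum, hG']
    exact (incl R k n F).as_sum_support
  rw [h3]
  exact T.sum_mem fun d _ => hG d _ _

/-- Ring homomorphisms out of the homogeneous coordinate ring that agree on scalars and on Plücker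
coordinates are equal. -/
theorem CoordRing.ringHom_ext {f g : CoordRing R k n →+* E}
    (h : ∀ r, f (algebraMap R _ r) = g (algebraMap R _ r))
    (hp : ∀ (S : Finset (Fin n)) (hS : S.card = k), f (plucker R S hS) = g (plucker R S hS)) :
    f = g := by
  ext F
  have hF : F ∈ Algebra.adjoin R {F : CoordRing R k n | ∃ (S : Finset (Fin n)) (hS : S.card = k),
      F = plucker R S hS} := by
    rw [adjoin_plucker]
    trivial
  induction hF using Algebra.adjoin_induction with
  | mem x hx =>
    obtain ⟨S, hS, rfl⟩ := hx
    exact hp S hS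
  | algebraMap r => exact h r
  | add x y _ _ hx hy => rw [map_add, map_add, hx, hy]
  | mul x y _ _ hx hy => rw [map_mul, map_mul, hx, hy]

theorem coordMap_algebraMap {R' : Type u} [CommRing R'] (φ : R →+* R')
    (g : Matrix (Fin n) (Fin n) R') (r : R) :
    coordMap k φ g (algebraMap R _ r) = algebraMap R' _ (φ r) := by
  apply incl_injective R' k n
  rw [incl_coordMap, AlgHom.commutes, AlgHom.commutes, Polynomial.algebraMap_apply,
    Polynomial.map_C, Polynomial.algebraMap_apply]
  simp [substHom, MvPolynomial.algebraMap_eq]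

theorem coordMap_one_plucker {R' : Type u} [CommRing R'] (φ : R →+* R')
    (S : Finset (Fin n)) (hS : S.card = k) :
    coordMap k φ (1 : Matrix (Fin n) (Fin n) R') (plucker R S hS) = plucker R' S hS := by
  apply incl_injective R' k n
  rw [incl_coordMap, plucker, incl_homog, Polynomial.map_monomial, substHom_minor,
    Matrix.map_one _ (map_zero _) (map_one _), Matrix.mul_one, plucker, incl_homog]

theorem evalGraded_coordMap {R' : Type u} [CommRing R'] (ψ : R →+* R') (φ : R' →+* E)
    (g : Matrix (Fin n) (Fin n) R') (M : Matrix (Fin k) (Fin n) E) (F : CoordRing R k n) :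
    evalGraded φ M (coordMap k ψ g F) = evalGraded (φ.comp ψ) (M * g.map φ) F := by
  rw [evalGraded_apply, incl_coordMap, Polynomial.map_map, evalGraded_apply]
  congr 1
  refine MvPolynomial.ringHom_ext (fun r => ?_) fun p => ?_
  · simp [evalPoly, substHom]
  · simp [evalPoly, substHom, Matrix.mul_apply]

theorem ev_coordMap {R' : Type u} [CommRing R'] (ψ : R →+* R') (φ : R' →+* E)
    (g : Matrix (Fin n) (Fin n) R') (M : Matrix (Fin k) (Fin n) E) (F : CoordRing R k n) :
    ev φ M (coordMap k ψ g F) = ev (φ.comp ψ) (M * g.map φ) F := by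
  rw [evalCone_apply, evalGraded_coordMap, evalCone_apply]

theorem map_ev {E' : Type*} [CommRing E'] (f : E →+* E') (φ : R →+* E)
    (M : Matrix (Fin k) (Fin n) E) (F : CoordRing R k n) :
    f (ev φ M F) = ev (f.comp φ) (M.map f) F := by
  have h : f.comp (ev φ M) = ev (f.comp φ) (M.map f) := by
    refine CoordRing.ringHom_ext (fun r => ?_) fun S hS => ?_
    · rw [RingHom.comp_apply, evalCone_algebraMap, evalCone_algebraMap, RingHom.comp_apply]
    · rw [RingHom.comp_apply, ev_plucker, ev_plucker, minor, RingHom.map_det, minor]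
      rfl
  exact congrArg (fun g => g F) h

theorem minor_mul_left (g : Matrix (Fin k) (Fin k) E) (M : Matrix (Fin k) (Fin n) E)
    (S : Finset (Fin n)) (hS : S.card = k) : minor (g * M) S hS = g.det * minor M S hS := by
  rw [minor, minor, ← Matrix.det_mul]
  rfl

/-- Row operations change a form of degree `d` by the `d`-th power of the determinant. -/
theorem ev_mul_left (φ : R →+* E) (g : Matrix (Fin k) (Fin k) E) (M : Matrix (Fin k) (Fin n) E)
    {d : ℕ} {F : CoordRing R k n} (hF : F ∈ grading R k n d) :
    ev φ (g * M) F = g.det ^ d * ev φ M F := by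
  rw [← evalCone_of_mem φ M _ hF]
  congr 1
  refine CoordRing.ringHom_ext (fun r => ?_) fun S hS => ?_
  · rw [evalCone_algebraMap, evalCone_algebraMap]
  · rw [ev_plucker, evalCone_plucker, minor_mul_left]

/-- If `c` times every maximal minor of `M` is integral, in the sense of lying in a subring `O`,
then so is `c ^ d` times the value at `M` of any form of degree `d`. -/
theorem ev_mem_subring (φ : R →+* E) (M : Matrix (Fin k) (Fin n) E) (c : E) (O : Subring E)
    (hφ : ∀ r, φ r ∈ O) (hM : ∀ (S : Finset (Fin n)) (hS : S.card = k), c * minor M S hS ∈ O)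
    {d : ℕ} {F : CoordRing R k n} (hF : F ∈ grading R k n d) : c ^ d * ev φ M F ∈ O := by
  rw [← evalCone_of_mem φ M _ hF]
  have h : F ∈ Algebra.adjoin R {F : CoordRing R k n | ∃ (S : Finset (Fin n)) (hS : S.card = k),
      F = plucker R S hS} := by
    rw [adjoin_plucker]
    trivial
  clear hF
  induction h using Algebra.adjoin_induction with
  | mem x hx =>
    obtain ⟨S, hS, rfl⟩ := hx
    rw [evalCone_plucker]
    exact hM S hS
  | algebraMap r =>
    rw [evalCone_algebraMap]
    exact hφ r
  | add x y _ _ hx hy =>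
    rw [map_add]
    exact O.add_mem hx hy
  | mul x y _ _ hx hy =>
    rw [map_mul]
    exact O.mul_mem hx hy

end Eval

/-! ### Minors after column operations -/

section Minors

variable {E : Type*} [CommRing E] {k n : ℕ}

theorem minor_mul_diagonal (M : Matrix (Fin k) (Fin n) E) (t : Fin n → E) (S : Finset (Fin n))
    (hS : S.card = k) :
    minor (M * Matrix.diagonal t) S hS = (∏ a ∈ S, t a) * minor M S hS := by
  have h : (M * Matrix.diagonal t).submatrix id (S.orderEmbOfFin hS) =
      M.submatrix id (S.orderEmbOfFin hS) * Matrix.diagonal (t ∘ S.orderEmbOfFin hS) := by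
    ext a b
    simp [Matrix.mul_diagonal]
  rw [minor, h, Matrix.det_mul, Matrix.det_diagonal, mul_comm, minor]
  congr 1
  rw [← Finset.prod_coe_sort S, ← (S.orderIsoOfFin hS).toEquiv.prod_comp]
  rfl

theorem card_exchange {i j : Fin n} {S : Finset (Fin n)} (hS : S.card = k) (hj : j ∈ S)
    (hi : i ∉ S) : (insert i (S.erase j)).card = k := by
  rw [Finset.card_insert_of_notMem (fun h => hi (Finset.mem_of_mem_erase h)),
    Finset.card_erase_of_mem hj]
  have := Finset.card_pos.mpr ⟨j, hj⟩
  omega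

theorem mul_transvection_apply (M : Matrix (Fin k) (Fin n) E) (i j : Fin n) (c : E)
    (a : Fin k) (b : Fin n) :
    (M * Matrix.transvection i j c) a b = if b = j then M a j + c * M a i else M a b := by
  split_ifs with h
  · subst h
    rw [Matrix.mul_transvection_apply_same]
  · rw [Matrix.mul_transvection_apply_of_ne _ _ _ _ h]

theorem minor_mul_transvection_of_notMem (M : Matrix (Fin k) (Fin n) E) (i j : Fin n) (c : E)
    (S : Finset (Fin n)) (hS : S.card = k) (hj : j ∉ S) :
    minor (M * Matrix.transvection i j c) S hS = minor M S hS := by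
  rw [minor, minor]
  congr 1
  ext a b
  have hb : S.orderEmbOfFin hS b ≠ j := fun h => hj (h ▸ S.orderEmbOfFin_mem hS b)
  rw [Matrix.submatrix_apply, mul_transvection_apply, if_neg hb]
  rfl

theorem submatrix_mul_transvection (M : Matrix (Fin k) (Fin n) E) (i j : Fin n) (c : E)
    (S : Finset (Fin n)) (hS : S.card = k) {b : Fin k} (hb : S.orderEmbOfFin hS b = j) :
    (M * Matrix.transvection i j c).submatrix id (S.orderEmbOfFin hS) =
      (M.submatrix id (S.orderEmbOfFin hS)).updateCol b
        ((fun a => M a j) + c • fun a => M a i) := by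
  ext a b'
  rw [Matrix.submatrix_apply, mul_transvection_apply, Matrix.updateCol_apply, ← hb]
  by_cases h : b' = b
  · subst h
    simp
  · rw [if_neg h, if_neg fun h' => h ((S.orderEmbOfFin hS).injective h')]
    rfl

theorem minor_mul_transvection_of_mem (M : Matrix (Fin k) (Fin n) E) {i j : Fin n} (hij : i ≠ j)
    (c : E) (S : Finset (Fin n)) (hS : S.card = k) (hi : i ∈ S) :
    minor (M * Matrix.transvection i j c) S hS = minor M S hS := by
  by_cases hj : j ∈ S
  · obtain ⟨a, ha⟩ : i ∈ Set.range (S.orderEmbOfFin hS) := by simpa using hi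
    obtain ⟨b, hb⟩ : j ∈ Set.range (S.orderEmbOfFin hS) := by simpa using hj
    have hab : b ≠ a := fun h => hij (by rw [← ha, ← hb, h])
    rw [minor, submatrix_mul_transvection M i j c S hS hb, Matrix.det_updateCol_add,
      Matrix.det_updateCol_smul]
    have h1 : (M.submatrix id (S.orderEmbOfFin hS)).updateCol b (fun a => M a j) =
        M.submatrix id (S.orderEmbOfFin hS) := by
      rw [← hb]
      exact Matrix.updateCol_eq_self _ b
    have h2 : ((M.submatrix id (S.orderEmbOfFin hS)).updateCol b fun a => M a i).det = 0 := by
      refine Matrix.det_zero_of_column_eq hab fun r => ?_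
      rw [Matrix.updateCol_self, Matrix.updateCol_ne hab.symm, Matrix.submatrix_apply, ha]
      rfl
    rw [h1, h2, mul_zero, add_zero, minor]
  · exact minor_mul_transvection_of_notMem M i j c S hS hj

/-- Adding `c` times column `i` to column `j` changes the minor in the columns `S`, where `j ∈ S`
and `i ∉ S`, by `± c` times the minor in the columns `S` with `j` replaced by `i`. The sign does
not depend on the matrix or on the ring. -/
theorem exists_exchange_sign {i j : Fin n} (S : Finset (Fin n)) (hS : S.card = k) (hj : j ∈ S)
    (hi : i ∉ S) : ∃ ε : ℤˣ, ∀ {E : Type u} [CommRing E] (M : Matrix (Fin k) (Fin n) E) (c : E),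
      minor (M * Matrix.transvection i j c) S hS = minor M S hS +
        c * ((ε : ℤ) * minor M (insert i (S.erase j)) (card_exchange hS hj hi)) := by
  obtain ⟨b, hb⟩ : j ∈ Set.range (S.orderEmbOfFin hS) := by simpa using hj
  let f : Fin k → Fin n := Function.update (S.orderEmbOfFin hS) b i
  have hf : Function.Injective f := by
    intro x y hxy
    by_cases hx : x = b <;> by_cases hy : y = b
    · rw [hx, hy]
    · refine absurd (S.orderEmbOfFin_mem hS y) ?_
      simp only [f, hx, Function.update_self, Function.update_of_ne hy] at hxy
      rwa [← hxy]
    · refine absurd (S.orderEmbOfFin_mem hS x) ?_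
      simp only [f, hy, Function.update_self, Function.update_of_ne hx] at hxy
      rwa [hxy]
    · simp only [f, Function.update_of_ne hx, Function.update_of_ne hy] at hxy
      exact (S.orderEmbOfFin hS).injective hxy
  set S' := insert i (S.erase j) with hS'def
  have hS' : S'.card = k := card_exchange hS hj hi
  have hmem : ∀ a, ∃ a', S'.orderEmbOfFin hS' a' = f a := by
    intro a
    have : f a ∈ Set.range (S'.orderEmbOfFin hS') := by
      rw [Finset.range_orderEmbOfFin, Finset.mem_coe, hS'def]
      by_cases ha : a = b
      · simp [f, ha]
      · simp only [f, Function.update_of_ne ha]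
        refine Finset.mem_insert_of_mem (Finset.mem_erase.mpr ⟨?_, S.orderEmbOfFin_mem hS a⟩)
        rw [← hb]
        exact fun h => ha ((S.orderEmbOfFin hS).injective h)
    exact this
  choose σ hσ using hmem
  have hσi : Function.Injective σ := fun a a' h => hf (by rw [← hσ a, ← hσ a', h])
  let τ : Equiv.Perm (Fin k) := Equiv.ofBijective σ (Finite.injective_iff_bijective.mp hσi)
  refine ⟨Equiv.Perm.sign τ, fun {E} _ M c => ?_⟩
  rw [minor, submatrix_mul_transvection M i j c S hS hb, Matrix.det_updateCol_add,
    Matrix.det_updateCol_smul]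
  have h1 : (M.submatrix id (S.orderEmbOfFin hS)).updateCol b (fun a => M a j) =
      M.submatrix id (S.orderEmbOfFin hS) := by
    rw [← hb]
    exact Matrix.updateCol_eq_self _ b
  have h2 : (M.submatrix id (S.orderEmbOfFin hS)).updateCol b (fun a => M a i) =
      (M.submatrix id (S'.orderEmbOfFin hS')).submatrix id τ := by
    ext a a'
    have : S'.orderEmbOfFin hS' (τ a') = f a' := hσ a'
    rw [Matrix.submatrix_apply, Matrix.submatrix_apply, this, Matrix.updateCol_apply]
    by_cases ha : a' = b
    · simp [f, ha]
    · simp [f, ha]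
  rw [h1, h2, Matrix.det_permute', minor, minor]

end Minors

/-! ### Forms over `K[u]` and `K[u, u⁻¹]` -/

section Decomposition

variable {R R' : Type u} [CommRing R] [CommRing R'] {k n : ℕ}

/-- The homogeneous component of degree `d`. -/
def component (d : ℕ) (F : CoordRing R k n) : CoordRing R k n :=
  homog d ((incl R k n F).coeff d) (coeff_incl_mem F d)

theorem component_mem (d : ℕ) (F : CoordRing R k n) : component d F ∈ grading R k n d :=
  homog_mem _ _ _

/-- An expression of a form of degree `d` in terms of elements of a smaller coordinate ring may be
taken to involve forms of degree `d` only. -/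
theorem eq_sum_component (φ : R →+* R') {d : ℕ} {F : CoordRing R' k n}
    (hF : F ∈ grading R' k n d) (s : Finset ℕ) (r : ℕ → R') (f : ℕ → CoordRing R k n)
    (h : F = ∑ i ∈ s, algebraMap R' _ (r i) * coordMap k φ 1 (f i)) :
    F = ∑ i ∈ s, algebraMap R' _ (r i) * coordMap k φ 1 (component d (f i)) := by
  apply incl_injective R' k n
  ext1 e
  have h1 : ∀ (g : CoordRing R k n) (e : ℕ) (r : R'),
      (incl R' k n (algebraMap R' _ r * coordMap k φ 1 g)).coeff e =
        MvPolynomial.C r * substHom k φ 1 ((incl R k n g).coeff e) := by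
    intro g e r
    rw [map_mul, AlgHom.commutes, incl_coordMap, Polynomial.algebraMap_apply,
      Polynomial.coeff_C_mul, Polynomial.coeff_map, MvPolynomial.algebraMap_eq]
  by_cases he : e = d
  · subst he
    conv_lhs => rw [h]
    simp only [map_sum, Polynomial.finsetSum_coeff, h1]
    refine Finset.sum_congr rfl fun i _ => ?_
    rw [component, incl_homog, Polynomial.coeff_monomial_same]
  · rw [hF e he, map_sum, Polynomial.finsetSum_coeff]
    refine (Finset.sum_eq_zero fun i _ => ?_).symm
    rw [h1, component_mem d (f i) e he, map_zero, mul_zero]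

variable {K : Type u} [Field K]

/-- A form over `K[u]` is a polynomial in `u` with coefficients forms over `K`. -/
theorem exists_eq_sum_X_pow (F : CoordRing K[X] k n) :
    ∃ (m : ℕ) (f : ℕ → CoordRing K k n), F = ∑ i ∈ Finset.range m,
      algebraMap K[X] _ (Polynomial.X ^ i) * coordMap k Polynomial.C 1 (f i) := by
  let b : CoordRing K k n →+* CoordRing K[X] k n := (coordMap k Polynomial.C 1).toRingHom
  let B : (CoordRing K k n)[X] →+* CoordRing K[X] k n :=
    Polynomial.eval₂RingHom b (algebraMap K[X] _ Polynomial.X)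
  have hB : ∀ F, F ∈ B.range := by
    intro F
    have hF : F ∈ Algebra.adjoin K[X] {F : CoordRing K[X] k n | ∃ (S : Finset (Fin n))
        (hS : S.card = k), F = plucker K[X] S hS} := by
      rw [adjoin_plucker]
      trivial
    induction hF using Algebra.adjoin_induction with
    | mem x hx =>
      obtain ⟨S, hS, rfl⟩ := hx
      exact ⟨Polynomial.C (plucker K S hS),
        (Polynomial.eval₂_C _ _).trans (coordMap_one_plucker Polynomial.C S hS)⟩
    | algebraMap r =>
      induction r using Polynomial.induction_on' with
      | add p q hp hq => rw [map_add]; exact B.range.add_mem hp hq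
      | monomial n a =>
        refine ⟨Polynomial.monomial n (algebraMap K _ a), ?_⟩
        refine (Polynomial.eval₂_monomial _ _).trans ?_
        change coordMap k Polynomial.C 1 (algebraMap K _ a) * _ = _
        rw [coordMap_algebraMap, ← map_pow, ← map_mul, Polynomial.C_mul_X_pow_eq_monomial]
    | add x y _ _ hx hy => exact B.range.add_mem hx hy
    | mul x y _ _ hx hy => exact B.range.mul_mem hx hy
  obtain ⟨P, rfl⟩ := hB F
  refine ⟨P.natDegree + 1, P.coeff, ?_⟩
  refine (Polynomial.eval₂_eq_sum_range _ _).trans (Finset.sum_congr rfl fun i _ => ?_)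
  rw [mul_comm, map_pow]
  rfl

/-- A form over `K[u]` differs from its value at `u = 0` by a multiple of `u`. -/
theorem exists_eq_add_X_mul {d : ℕ} {F : CoordRing K[X] k n} (hF : F ∈ grading K[X] k n d) :
    ∃ G ∈ grading K[X] k n d,
      F = coordMap k Polynomial.C 1 (coordMap k (Polynomial.evalRingHom (0 : K)) 1 F) +
        algebraMap K[X] _ Polynomial.X * G := by
  obtain ⟨m, f, h⟩ := exists_eq_sum_X_pow F
  replace h := eq_sum_component Polynomial.C hF _ _ _ h
  have hm : ∀ i, algebraMap K[X] (CoordRing K[X] k n) (Polynomial.X ^ i) *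
      coordMap k Polynomial.C 1 (component d (f (i + 1))) ∈ grading K[X] k n d := by
    intro i
    rw [← Algebra.smul_def]
    exact Submodule.smul_mem _ _ ((coordMap k Polynomial.C 1).map_mem (component_mem d _))
  have key : ∃ (f0 : CoordRing K k n), ∃ G ∈ grading K[X] k n d,
      F = coordMap k Polynomial.C 1 f0 + algebraMap K[X] _ Polynomial.X * G := by
    cases m with
    | zero => exact ⟨0, 0, Submodule.zero_mem _, by rw [h]; simp⟩
    | succ m =>
      refine ⟨component d (f 0), ∑ i ∈ Finset.range m, algebraMap K[X] _ (Polynomial.X ^ i) *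
        coordMap k Polynomial.C 1 (component d (f (i + 1))), ?_, ?_⟩
      · exact Submodule.sum_mem _ fun i _ => hm i
      refine h.trans ((Finset.sum_range_succ' _ m).trans ?_)
      rw [add_comm, Finset.mul_sum]
      refine congrArg₂ (· + ·) ?_ (Finset.sum_congr rfl fun i _ => ?_)
      · rw [pow_zero, map_one, one_mul]
      · rw [pow_succ', map_mul, mul_assoc]
  obtain ⟨f0, G, hG, h'⟩ := key
  refine ⟨G, hG, ?_⟩
  have h0 : coordMap k (Polynomial.evalRingHom (0 : K)) 1 F = f0 := by
    have h2 : (coordMap k (Polynomial.evalRingHom (0 : K)) 1).toRingHom.comp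
        (coordMap k (n := n) Polynomial.C 1).toRingHom = RingHom.id _ := by
      refine CoordRing.ringHom_ext (fun r => ?_) fun S hS => ?_
      · change coordMap k _ 1 (coordMap k _ 1 _) = _
        rw [coordMap_algebraMap, coordMap_algebraMap]
        simp
      · change coordMap k _ 1 (coordMap k _ 1 _) = _
        rw [coordMap_one_plucker, coordMap_one_plucker]
        rfl
    have h3 : ∀ f0, coordMap k (Polynomial.evalRingHom (0 : K)) 1
        (coordMap k (n := n) Polynomial.C 1 f0) = f0 := fun f0 => congrArg (fun g => g f0) h2
    rw [h', map_add, map_mul, coordMap_algebraMap, h3]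
    simp
  rw [h0]
  exact h'

/-- A form over `K[u, u⁻¹]`, multiplied by a power of `u`, is a polynomial in `u` with coefficients
forms over `K` of the same degree. -/
theorem exists_T_mul_eq_sum {d : ℕ} {F : CoordRing K[T;T⁻¹] k n}
    (hF : F ∈ grading K[T;T⁻¹] k n d) :
    ∃ (N m : ℕ) (f : ℕ → CoordRing K k n), (∀ i, f i ∈ grading K k n d) ∧
      algebraMap K[T;T⁻¹] _ (LaurentPolynomial.T N) * F = ∑ i ∈ Finset.range m,
        algebraMap K[T;T⁻¹] _ (LaurentPolynomial.T i) *
          coordMap k (algebraMap K K[T;T⁻¹]) 1 (f i) := by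
  have h1 : ∀ F : CoordRing K[T;T⁻¹] k n, ∃ (N : ℕ) (G : CoordRing K[X] k n),
      algebraMap K[T;T⁻¹] _ (LaurentPolynomial.T N) * F =
        coordMap k Polynomial.toLaurent 1 G := by
    intro F
    have hF : F ∈ Algebra.adjoin K[T;T⁻¹] {F : CoordRing K[T;T⁻¹] k n | ∃ (S : Finset (Fin n))
        (hS : S.card = k), F = plucker K[T;T⁻¹] S hS} := by
      rw [adjoin_plucker]
      trivial
    induction hF using Algebra.adjoin_induction with
    | mem x hx =>
      obtain ⟨S, hS, rfl⟩ := hx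
      exact ⟨0, plucker K[X] S hS, by simp [coordMap_one_plucker]⟩
    | algebraMap r =>
      obtain ⟨N, p, hp⟩ := LaurentPolynomial.exists_T_pow r
      refine ⟨N, algebraMap _ _ p, ?_⟩
      rw [coordMap_algebraMap, hp, ← map_mul, mul_comm]
    | add x y _ _ hx hy =>
      obtain ⟨N, G, h⟩ := hx
      obtain ⟨N', G', h'⟩ := hy
      refine ⟨N + N', algebraMap K[X] _ (Polynomial.X ^ N') * G +
        algebraMap K[X] _ (Polynomial.X ^ N) * G', ?_⟩
      rw [map_add, map_mul, map_mul, ← h, ← h', coordMap_algebraMap, coordMap_algebraMap,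
        Polynomial.toLaurent_X_pow, Polynomial.toLaurent_X_pow, Nat.cast_add,
        LaurentPolynomial.T_add, map_mul]
      ring
    | mul x y _ _ hx hy =>
      obtain ⟨N, G, h⟩ := hx
      obtain ⟨N', G', h'⟩ := hy
      refine ⟨N + N', G * G', ?_⟩
      rw [map_mul, ← h, ← h', Nat.cast_add, LaurentPolynomial.T_add, map_mul]
      ring
  obtain ⟨N, G, hG⟩ := h1 F
  obtain ⟨m, f, rfl⟩ := exists_eq_sum_X_pow G
  refine ⟨N, m, fun i => component d (f i), fun i => component_mem d _, ?_⟩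
  refine eq_sum_component (algebraMap K K[T;T⁻¹]) ?_ (Finset.range m)
    (fun i => LaurentPolynomial.T (i : ℤ)) f ?_
  · rw [← Algebra.smul_def]
    exact Submodule.smul_mem _ _ hF
  rw [hG, map_sum]
  refine Finset.sum_congr rfl fun i _ => ?_
  rw [map_mul, coordMap_algebraMap, Polynomial.toLaurent_X_pow]
  congr 1
  have h2 : (coordMap k (n := n) (Polynomial.toLaurent (R := K)) 1).toRingHom.comp
      (coordMap k (n := n) (Polynomial.C (R := K)) 1).toRingHom =
        (coordMap k (n := n) (algebraMap K K[T;T⁻¹]) 1).toRingHom := by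
    refine CoordRing.ringHom_ext (fun r => ?_) fun S hS => ?_
    · change coordMap k _ 1 (coordMap k _ 1 _) = coordMap k _ 1 _
      rw [coordMap_algebraMap, coordMap_algebraMap, coordMap_algebraMap, Polynomial.toLaurent_C]
      rfl
    · change coordMap k _ 1 (coordMap k _ 1 _) = coordMap k _ 1 _
      rw [coordMap_one_plucker, coordMap_one_plucker, coordMap_one_plucker]
  exact congrArg (fun g => g (f i)) h2

end Decomposition

end

end GrShift

/-! ### Closed subschemes of `Proj` on standard charts -/

namespace AlgebraicGeometry.Proj

noncomputable section

open HomogeneousLocalization TopologicalSpace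

section General

variable {σ : Type*} {A : Type u} [CommRing A] [SetLike σ A] [AddSubgroupClass σ A]
  (𝒜 : ℕ → σ) [GradedRing 𝒜]

/-- The section `a / s ^ m` over `D₊(s)` is invertible at a point exactly if `a` does not vanish
there. -/
theorem mem_basicOpen_awayToSection {s : A} {d : ℕ} (hs : s ∈ 𝒜 d) (m : ℕ) (a : A)
    (ha : a ∈ 𝒜 (m • d)) {x : Proj 𝒜} (hx : x ∈ basicOpen 𝒜 s) :
    x ∈ (Proj 𝒜).basicOpen ((awayToSection 𝒜 s).hom (Away.mk 𝒜 hs m a ha)) ↔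
      a ∉ x.asHomogeneousIdeal := by
  have h1 : (Proj 𝒜).presheaf.germ (basicOpen 𝒜 s) x hx
      ((awayToSection 𝒜 s).hom (Away.mk 𝒜 hs m a ha)) = (stalkIso 𝒜 x).inv.hom
        (mapId 𝒜 (Submonoid.powers_le.mpr hx) (Away.mk 𝒜 hs m a ha)) :=
    congrArg (fun f => f.hom (Away.mk 𝒜 hs m a ha))
      (ProjectiveSpectrum.Proj.awayToSection_germ 𝒜 s x hx)
  have : IsLocalHom (stalkIso 𝒜 x).inv.hom := isLocalHom_of_isIso _
  have hprime : x.asHomogeneousIdeal.toIdeal.IsPrime := x.isPrime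
  rw [Scheme.mem_basicOpen _ _ _ hx, h1, isUnit_map_iff]
  refine (isUnit_iff_isUnit_val (𝒜 := 𝒜) (𝔭 := x.asHomogeneousIdeal.toIdeal) _).symm.trans ?_
  have h2 : (mapId 𝒜 (Q := x.asHomogeneousIdeal.toIdeal.primeCompl)
      (Submonoid.powers_le.mpr hx) (Away.mk 𝒜 hs m a ha)).val =
      IsLocalization.mk' (Localization.AtPrime x.asHomogeneousIdeal.toIdeal) a
        (⟨s ^ m, fun h => hx (x.isPrime.mem_of_pow_mem m h)⟩ :
          x.asHomogeneousIdeal.toIdeal.primeCompl) := by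
    rw [← Localization.mk_eq_mk']
    rfl
  rw [h2, IsLocalization.AtPrime.isUnit_mk'_iff]
  rfl

variable {𝒜}

/-- The standard affine chart `D₊(s)`. -/
def chart {s : A} (hs : s ∈ 𝒜 1) : (Proj 𝒜).affineOpens :=
  ⟨basicOpen 𝒜 s, isAffineOpen_basicOpen 𝒜 s hs one_pos⟩

/-- The ideal of the closed subscheme `X` on the chart `D₊(s)`, in terms of fractions
`a / s ^ m`. -/
def chartIdeal (X : (Proj 𝒜).IdealSheafData) {s : A} (hs : s ∈ 𝒜 1) : Ideal (Away 𝒜 s) :=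
  (X.ideal (chart hs)).comap (awayToSection 𝒜 s).hom

theorem awayToSection_bijective {s : A} (hs : s ∈ 𝒜 1) :
    Function.Bijective (awayToSection 𝒜 s).hom := by
  have : IsIso (awayToSection 𝒜 s) := by
    rw [← basicOpenIsoAway_hom 𝒜 s hs one_pos]
    infer_instance
  exact ConcreteCategory.bijective_of_isIso (awayToSection 𝒜 s)

theorem chartIdeal_le_iff {X Y : (Proj 𝒜).IdealSheafData} {s : A} (hs : s ∈ 𝒜 1) :
    chartIdeal X hs ≤ chartIdeal Y hs ↔ X.ideal (chart hs) ≤ Y.ideal (chart hs) :=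
  Ideal.comap_le_comap_iff_of_surjective _ (awayToSection_bijective hs).2 _ _

theorem le_of_chartIdeal_le {X Y : (Proj 𝒜).IdealSheafData} {ι : Type*} {s : ι → A}
    (hs : ∀ i, s i ∈ 𝒜 1)
    (hspan : (HomogeneousIdeal.irrelevant 𝒜).toIdeal ≤ Ideal.span (Set.range s))
    (h : ∀ i, chartIdeal X (hs i) ≤ chartIdeal Y (hs i)) : X ≤ Y :=
  Scheme.IdealSheafData.le_of_iSup_eq_top (fun i => chart (hs i))
    (iSup_basicOpen_eq_top 𝒜 s hspan) fun i => (chartIdeal_le_iff (hs i)).mp (h i)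

/-- The reduced irreducible closed subscheme with generic point `x`. -/
def closureIdeal (x : Proj 𝒜) : (Proj 𝒜).IdealSheafData :=
  Scheme.IdealSheafData.vanishingIdeal (Closeds.closure {x})

theorem mem_closure_singleton_iff {x y : Proj 𝒜} :
    y ∈ closure {x} ↔ x.asHomogeneousIdeal ≤ y.asHomogeneousIdeal :=
  (ProjectiveSpectrum.le_iff_mem_closure 𝒜 x y).symm

theorem mem_support_closureIdeal {x y : Proj 𝒜} :
    y ∈ (closureIdeal x).support ↔ x.asHomogeneousIdeal ≤ y.asHomogeneousIdeal := by
  rw [← mem_closure_singleton_iff, ← SetLike.mem_coe, closureIdeal,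
    Scheme.IdealSheafData.coe_support_vanishingIdeal]
  rfl

theorem le_closureIdeal_iff {X : (Proj 𝒜).IdealSheafData} {x : Proj 𝒜} :
    X ≤ closureIdeal x ↔ x ∈ X.support := by
  rw [closureIdeal, ← Scheme.IdealSheafData.le_support_iff_le_vanishingIdeal,
    Closeds.closure_le, Set.singleton_subset_iff, SetLike.mem_coe]

theorem closureIdeal_le_iff {x y : Proj 𝒜} :
    closureIdeal x ≤ closureIdeal y ↔ x.asHomogeneousIdeal ≤ y.asHomogeneousIdeal := by
  rw [le_closureIdeal_iff, mem_support_closureIdeal]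

/-- Membership in the ideal sheaf of a closed subset, tested at points. -/
theorem _root_.AlgebraicGeometry.Scheme.IdealSheafData.mem_vanishingIdeal_iff {X : Scheme.{u}}
    (Z : Closeds X) (U : X.affineOpens) (f : Γ(X, U)) :
    f ∈ (Scheme.IdealSheafData.vanishingIdeal Z).ideal U ↔
      ∀ x ∈ Z, x ∈ U.1 → x ∉ X.basicOpen f := by
  rw [Scheme.IdealSheafData.vanishingIdeal_ideal, PrimeSpectrum.mem_vanishingIdeal]
  have h1 : ∀ p : Spec Γ(X, U), U.2.fromSpec p ∈ X.basicOpen f ↔ f ∉ p.asIdeal := by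
    intro p
    change p ∈ U.2.fromSpec ⁻¹ᵁ X.basicOpen f ↔ _
    rw [U.2.fromSpec_preimage_basicOpen f]
    rfl
  constructor
  · intro h x hxZ hxU
    obtain ⟨p, rfl⟩ : x ∈ Set.range U.2.fromSpec := by rwa [U.2.range_fromSpec]
    exact fun hn => (h1 p).mp hn (h p hxZ)
  · intro h p hp
    have h2 := h _ hp (by
      have : U.2.fromSpec p ∈ Set.range U.2.fromSpec := ⟨p, rfl⟩
      rwa [U.2.range_fromSpec] at this)
    exact not_not.mp fun hn => h2 ((h1 p).mpr hn)

theorem mk_mem_chartIdeal_vanishingIdeal (Z : Closeds (Proj 𝒜)) {s : A} (hs : s ∈ 𝒜 1) (m : ℕ)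
    (a : A) (ha : a ∈ 𝒜 (m • 1)) :
    Away.mk 𝒜 hs m a ha ∈ chartIdeal (Scheme.IdealSheafData.vanishingIdeal Z) hs ↔
      ∀ x ∈ Z, s ∈ x.asHomogeneousIdeal ∨ a ∈ x.asHomogeneousIdeal := by
  refine (Scheme.IdealSheafData.mem_vanishingIdeal_iff Z (chart hs) _).trans ?_
  refine forall₂_congr fun x _ => ?_
  rw [or_iff_not_imp_left]
  refine forall_congr' fun hx => ?_
  exact (mem_basicOpen_awayToSection 𝒜 hs m a ha hx).not_left

theorem mk_mem_chartIdeal_closureIdeal {x : Proj 𝒜} {s : A} (hs : s ∈ 𝒜 1) (m : ℕ) (a : A)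
    (ha : a ∈ 𝒜 (m • 1)) :
    Away.mk 𝒜 hs m a ha ∈ chartIdeal (closureIdeal x) hs ↔
      s ∈ x.asHomogeneousIdeal ∨ a ∈ x.asHomogeneousIdeal := by
  rw [closureIdeal, mk_mem_chartIdeal_vanishingIdeal]
  constructor
  · exact fun h => h x (subset_closure rfl)
  · intro h y hy
    have hxy : x.asHomogeneousIdeal ≤ y.asHomogeneousIdeal := mem_closure_singleton_iff.mp hy
    exact h.imp (fun h => hxy h) fun h => hxy h

theorem map_closureIdeal {τ : Type*} {B : Type u} [CommRing B] [SetLike τ B]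
    [AddSubgroupClass τ B] {ℬ : ℕ → τ} [GradedRing ℬ] (f : Proj ℬ ⟶ Proj 𝒜) (x : Proj ℬ) :
    (closureIdeal x).map f = closureIdeal (f x) := by
  rw [closureIdeal, Scheme.IdealSheafData.map_vanishingIdeal, closureIdeal]
  congr 1
  ext1
  change closure (f '' closure {x}) = closure {f x}
  rw [closure_image_closure f.continuous, Set.image_singleton]

/-- A reduced and irreducible closed subscheme is determined by its generic point. -/
theorem exists_eq_closureIdeal (X : (Proj 𝒜).IdealSheafData)
    [AlgebraicGeometry.IsIntegral X.subscheme] : ∃ x : Proj 𝒜, X = closureIdeal x := by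
  have hrad : X.radical = X := by
    ext U : 2
    have hred : _root_.IsReduced Γ(X.subscheme, X.subschemeι ⁻¹ᵁ U) := inferInstance
    refine le_antisymm (fun a ha => ?_) Ideal.le_radical
    obtain ⟨m, hm⟩ := ha
    rw [← X.ker_subschemeι_app U, RingHom.mem_ker] at hm ⊢
    rw [map_pow] at hm
    exact _root_.IsReduced.eq_zero _ ⟨m, hm⟩
  have hirr : IsIrreducible (X.support : Set (Proj 𝒜)) := by
    rw [← X.range_subschemeι, ← Set.image_univ]
    exact (IrreducibleSpace.isIrreducible_univ _).image _ X.subschemeι.continuous.continuousOn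
  obtain ⟨x, hx⟩ := QuasiSober.sober hirr X.support.isClosed
  refine ⟨x, ?_⟩
  rw [← hrad, ← Scheme.IdealSheafData.vanishingIdeal_support, closureIdeal]
  congr 1
  ext1
  exact hx.symm

end General

end

end AlgebraicGeometry.Proj

/-! ### Preimages of closed subschemes on affine charts -/

namespace AlgebraicGeometry.Scheme.IdealSheafData

variable {X Y : Scheme.{u}}

theorem ideal_comap_top_of_isAffine [IsAffine X] [IsAffine Y] (I : Y.IdealSheafData)
    (f : X ⟶ Y) : (I.comap f).ideal ⟨⊤, isAffineOpen_top X⟩ =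
      (I.ideal ⟨⊤, isAffineOpen_top Y⟩).map f.appTop.hom := by
  apply le_antisymm
  · have h1 : I.comap f ≤ ofIdealTop ((I.ideal ⟨⊤, isAffineOpen_top Y⟩).map f.appTop.hom) := by
      rw [← le_map_iff_comap_le]
      refine le_of_isAffine ?_
      rw [ideal_map_of_isAffineHom, ← Ideal.map_le_iff_le_comap]
      exact ((equivOfIsAffine (X := X)).right_inv
        ((I.ideal ⟨⊤, isAffineOpen_top Y⟩).map f.appTop.hom)).ge
    refine (h1 _).trans ?_
    exact ((equivOfIsAffine (X := X)).right_inv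
        ((I.ideal ⟨⊤, isAffineOpen_top Y⟩).map f.appTop.hom)).le
  · rw [Ideal.map_le_iff_le_comap]
    have h1 : I ≤ (I.comap f).map f := le_map_comap _ _
    have h2 := h1 ⟨⊤, isAffineOpen_top Y⟩
    rwa [ideal_map_of_isAffineHom] at h2

theorem ideal_comap_ι (I : X.IdealSheafData) (U : X.affineOpens) :
    (I.comap U.1.ι).ideal ⟨⊤, have : IsAffine U.1 := U.2; isAffineOpen_top _⟩ =
      (I.ideal U).map U.1.topIso.inv.hom := by
  rw [ideal_comap_of_isOpenImmersion]
  have h1 : (U.1.ι ''ᵁ ⊤) = U.1 := by simp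
  have h2 := I.map_ideal' (V := U) (U := ⟨U.1.ι ''ᵁ ⊤, by rw [h1]; exact U.2⟩)
    (eqToHom h1).op
  rw [← h2, show U.1.ι.appIso ⊤ = Iso.refl _ from U.1.ι_appIso ⊤]
  exact Ideal.comap_id _

/-- The ideal of the scheme-theoretic preimage of a closed subscheme on an affine open is the
extension of the ideal of the subscheme. -/
theorem ideal_comap_eq_map (I : Y.IdealSheafData) (f : X ⟶ Y) (U : Y.affineOpens)
    (V : X.affineOpens) (h : V.1 ≤ f ⁻¹ᵁ U.1) :
    (I.comap f).ideal V = (I.ideal U).map (f.appLE U.1 V.1 h).hom := by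
  have : IsAffine U.1 := U.2
  have : IsAffine V.1 := V.2
  have h1 : ((I.comap f).comap V.1.ι).ideal ⟨⊤, isAffineOpen_top _⟩ =
      ((I.comap U.1.ι).comap (f.resLE U.1 V.1 h)).ideal ⟨⊤, isAffineOpen_top _⟩ := by
    rw [← comap_comp, ← comap_comp, Scheme.Hom.resLE_comp_ι]
  rw [ideal_comap_ι (I.comap f) V, ideal_comap_top_of_isAffine _ (f.resLE U.1 V.1 h),
    ideal_comap_ι I U, Ideal.map_map, ← CommRingCat.hom_comp] at h1
  have h2 : U.1.topIso.inv ≫ (f.resLE U.1 V.1 h).appTop = f.appLE U.1 V.1 h ≫ V.1.topIso.inv := by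
    rw [Scheme.Hom.appTop, Scheme.Hom.resLE_app_top, Iso.inv_hom_id_assoc]
  rw [h2] at h1
  have h3 := congrArg (Ideal.map V.1.topIso.hom.hom) h1
  rw [Ideal.map_map, Ideal.map_map, ← CommRingCat.hom_comp, ← CommRingCat.hom_comp,
    Category.assoc, Iso.inv_hom_id, Category.comp_id] at h3
  exact (Ideal.map_id _).symm.trans h3

end AlgebraicGeometry.Scheme.IdealSheafData

namespace AlgebraicGeometry.Proj

open HomogeneousLocalization TopologicalSpace

variable {σ τ A B : Type u} [CommRing A] [SetLike σ A] [AddSubgroupClass σ A]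
  {𝒜 : ℕ → σ} [GradedRing 𝒜] [CommRing B] [SetLike τ B] [AddSubgroupClass τ B] {ℬ : ℕ → τ}
  [GradedRing ℬ]

theorem chartIdeal_comap (X : (Proj 𝒜).IdealSheafData) (f : 𝒜 →+*ᵍ ℬ)
    (hf : HomogeneousIdeal.irrelevant ℬ ≤ (HomogeneousIdeal.irrelevant 𝒜).map f)
    {s : A} (hs : s ∈ 𝒜 1) (hfs : f s ∈ ℬ 1) :
    chartIdeal (X.comap (Proj.map f hf)) hfs = (chartIdeal X hs).map (Away.map f s) := by
  have h0 := Scheme.IdealSheafData.ideal_comap_eq_map X (Proj.map f hf) (chart hs) (chart hfs)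
    (map_preimage_basicOpen f hf s).ge
  have h1 : X.ideal (chart hs) = (chartIdeal X hs).map (awayToSection 𝒜 s).hom :=
    (Ideal.map_comap_of_surjective _ (awayToSection_bijective hs).2 _).symm
  have h2 := congrArg CommRingCat.Hom.hom (awayToSection_comp_appLE f hf hs)
  rw [CommRingCat.hom_comp, CommRingCat.hom_comp] at h2
  have h3 := (h0.trans (congrArg (Ideal.map _) h1)).trans ((Ideal.map_map _ _).trans
    ((congrArg (fun g => (chartIdeal X hs).map g) h2).trans (Ideal.map_map _ _).symm))
  exact (congrArg (Ideal.comap (awayToSection ℬ (f s)).hom) h3).trans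
    (Ideal.comap_map_of_bijective _ (awayToSection_bijective hfs))

end AlgebraicGeometry.Proj

namespace GrShift

noncomputable section

/-! ### Points of the Grassmannian given by matrices -/

section Points

open HomogeneousLocalization

variable {R : Type u} [CommRing R] {k n : ℕ}

theorem irrelevant_le_span_plucker (R : Type u) [CommRing R] (k n : ℕ) :
    (HomogeneousIdeal.irrelevant (grading R k n)).toIdeal ≤
      Ideal.span (Set.range fun S : {S : Finset (Fin n) // S.card = k} =>
        plucker R S.1 S.2) := by
  set I := Ideal.span (Set.range fun S : {S : Finset (Fin n) // S.card = k} =>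
        plucker R S.1 S.2) with hI
  have h1 : ∀ F : CoordRing R k n, ∃ r : R, F - algebraMap R _ r ∈ I := by
    intro F
    have hF : F ∈ Algebra.adjoin R {F : CoordRing R k n | ∃ (S : Finset (Fin n))
      (hS : S.card = k), F = plucker R S hS} := adjoin_plucker R k n ▸ Algebra.mem_top
    induction hF using Algebra.adjoin_induction with
    | mem x hx =>
      obtain ⟨S, hS, rfl⟩ := hx
      refine ⟨0, ?_⟩
      rw [map_zero, sub_zero]
      exact Ideal.subset_span ⟨⟨S, hS⟩, rfl⟩
    | algebraMap r => exact ⟨r, by simp⟩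
    | add x y _ _ hx hy =>
      obtain ⟨a, ha⟩ := hx
      obtain ⟨b, hb⟩ := hy
      refine ⟨a + b, ?_⟩
      convert I.add_mem ha hb using 1
      rw [map_add]; ring
    | mul x y _ _ hx hy =>
      obtain ⟨a, ha⟩ := hx
      obtain ⟨b, hb⟩ := hy
      refine ⟨a * b, ?_⟩
      convert I.add_mem (I.mul_mem_right y ha) (I.mul_mem_left (algebraMap R _ a) hb) using 1
      rw [map_mul]; ring
  have h2 : I ≤ (HomogeneousIdeal.irrelevant (grading R k n)).toIdeal := by
    rw [hI, Ideal.span_le]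
    rintro _ ⟨S, rfl⟩
    exact HomogeneousIdeal.mem_irrelevant_of_mem _ one_pos (plucker_mem R S.1 S.2)
  intro F hF
  obtain ⟨r, hr⟩ := h1 F
  have h3 : algebraMap R (CoordRing R k n) r ∈
      (HomogeneousIdeal.irrelevant (grading R k n)).toIdeal := by
    have := Ideal.sub_mem _ hF (h2 hr)
    rwa [sub_sub_cancel] at this
  have h4 : algebraMap R (CoordRing R k n) r = 0 := by
    have h5 := (HomogeneousIdeal.mem_irrelevant_iff _ _).mp h3
    rw [GradedRing.proj_apply] at h5
    rwa [DirectSum.decompose_of_mem_same _ (SetLike.algebraMap_mem_graded _ r)] at h5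
  rwa [h4, sub_zero] at hr

/-- Closed subschemes are compared on the standard charts. -/
theorem le_of_chartIdeal_plucker_le {X Y : (Gr R k n).IdealSheafData}
    (h : ∀ (S : Finset (Fin n)) (hS : S.card = k),
      Proj.chartIdeal X (plucker_mem R S hS) ≤ Proj.chartIdeal Y (plucker_mem R S hS)) :
    X ≤ Y :=
  Proj.le_of_chartIdeal_le (fun S : {S : Finset (Fin n) // S.card = k} => plucker_mem R S.1 S.2)
    (irrelevant_le_span_plucker R k n) fun S => h S.1 S.2

/-- The point of `Gr(k, n)` over `R` below the `E`-point `rowspan M`, for a `k × n` matrix `M` of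
rank `k` over an `R`-algebra `E` that is a domain: its ideal consists of the forms over `R` that
vanish at `M`. -/
def pt {E : Type*} [CommRing E] [IsDomain E] (φ : R →+* E) (M : Matrix (Fin k) (Fin n) E)
    (hM : ∃ (S : Finset (Fin n)) (hS : S.card = k), minor M S hS ≠ 0) : Gr R k n :=
  show ProjectiveSpectrum (grading R k n) from
  { asHomogeneousIdeal :=
      { toSubmodule := RingHom.ker (evalGraded φ M)
        is_homogeneous' := fun d F hF => by
          rw [RingHom.mem_ker, evalGraded_apply] at hF ⊢
          have h := congrArg (fun G => Polynomial.coeff G d) hF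
          simp only [Polynomial.coeff_map, Polynomial.coeff_zero] at h
          rw [incl_decompose, Polynomial.map_monomial, h, map_zero] }
    isPrime := RingHom.ker_isPrime (evalGraded φ M)
    not_irrelevant_le := fun h => by
      obtain ⟨S, hS, hne⟩ := hM
      have h1 := h (HomogeneousIdeal.mem_irrelevant_of_mem _ one_pos (plucker_mem R S hS))
      change evalGraded φ M (plucker R S hS) = 0 at h1
      rw [evalGraded_plucker, Polynomial.monomial_eq_zero_iff] at h1
      exact hne h1 }

theorem exists_minor_mul_ne_zero {E : Type*} [CommRing E] {M : Matrix (Fin k) (Fin n) E}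
    (hM : ∃ (S : Finset (Fin n)) (hS : S.card = k), minor M S hS ≠ 0) (g : GL (Fin n) E) :
    ∃ (S : Finset (Fin n)) (hS : S.card = k), minor (M * g.1) S hS ≠ 0 := by
  by_contra! h
  obtain ⟨S, hS, hne⟩ := hM
  apply hne
  have h1 := minor_mul_mem (R := E) (M * g.1) (g⁻¹).1 S hS
  rw [Algebra.algebraMap_self, RingHom.coe_id, Matrix.map_id, Matrix.mul_assoc, ← Units.val_mul,
    mul_inv_cancel, Units.val_one, Matrix.mul_one] at h1
  refine (Submodule.mem_bot E).mp (Submodule.span_le.mpr ?_ h1)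
  rintro _ ⟨S', hS', rfl⟩
  exact h S' hS'

variable {E : Type*} [CommRing E] [IsDomain E] {E' : Type*} [CommRing E'] [IsDomain E']

theorem mem_pt_iff_evalGraded (φ : R →+* E) (M : Matrix (Fin k) (Fin n) E)
    (hM : ∃ (S : Finset (Fin n)) (hS : S.card = k), minor M S hS ≠ 0) (F : CoordRing R k n) :
    F ∈ (pt φ M hM).asHomogeneousIdeal ↔ evalGraded φ M F = 0 := Iff.rfl

theorem mem_pt_iff (φ : R →+* E) (M : Matrix (Fin k) (Fin n) E)
    (hM : ∃ (S : Finset (Fin n)) (hS : S.card = k), minor M S hS ≠ 0) {d : ℕ}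
    {F : CoordRing R k n} (hF : F ∈ grading R k n d) :
    F ∈ (pt φ M hM).asHomogeneousIdeal ↔ ev φ M F = 0 :=
  (mem_pt_iff_evalGraded φ M hM F).trans (evalGraded_eq_zero_iff φ M hF)

theorem plucker_mem_pt_iff (φ : R →+* E) (M : Matrix (Fin k) (Fin n) E)
    (hM : ∃ (S : Finset (Fin n)) (hS : S.card = k), minor M S hS ≠ 0)
    (S : Finset (Fin n)) (hS : S.card = k) :
    plucker R S hS ∈ (pt φ M hM).asHomogeneousIdeal ↔ minor M S hS = 0 := by
  rw [mem_pt_iff φ M hM (plucker_mem R S hS), ev_plucker]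

theorem asHomogeneousIdeal_le_iff {x : Gr R k n} {J : HomogeneousIdeal (grading R k n)} :
    x.asHomogeneousIdeal ≤ J ↔
      ∀ d, ∀ F ∈ grading R k n d, F ∈ x.asHomogeneousIdeal → F ∈ J := by
  refine ⟨fun h d F _ hF => h hF, fun h F hF => ?_⟩
  classical
  rw [← DirectSum.sum_support_decompose (grading R k n) F]
  exact J.toIdeal.sum_mem fun d _ =>
    h d _ (SetLike.coe_mem _) (x.asHomogeneousIdeal.is_homogeneous' d hF)

theorem pt_le_pt_iff {φ : R →+* E} {M : Matrix (Fin k) (Fin n) E}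
    {hM : ∃ (S : Finset (Fin n)) (hS : S.card = k), minor M S hS ≠ 0}
    {φ' : R →+* E'} {M' : Matrix (Fin k) (Fin n) E'}
    {hM' : ∃ (S : Finset (Fin n)) (hS : S.card = k), minor M' S hS ≠ 0} :
    (pt φ M hM).asHomogeneousIdeal ≤ (pt φ' M' hM').asHomogeneousIdeal ↔
      ∀ d, ∀ F ∈ grading R k n d, ev φ M F = 0 → ev φ' M' F = 0 := by
  rw [asHomogeneousIdeal_le_iff]
  refine forall₃_congr fun d F hF => ?_
  rw [mem_pt_iff φ M hM hF, mem_pt_iff φ' M' hM' hF]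

theorem pt_ext {x y : Gr R k n} (h1 : x.asHomogeneousIdeal ≤ y.asHomogeneousIdeal)
    (h2 : y.asHomogeneousIdeal ≤ x.asHomogeneousIdeal) : x = y :=
  ProjectiveSpectrum.ext (le_antisymm h1 h2)

theorem pt_congr {φ : R →+* E} {M : Matrix (Fin k) (Fin n) E}
    {hM : ∃ (S : Finset (Fin n)) (hS : S.card = k), minor M S hS ≠ 0}
    {φ' : R →+* E'} {M' : Matrix (Fin k) (Fin n) E'}
    {hM' : ∃ (S : Finset (Fin n)) (hS : S.card = k), minor M' S hS ≠ 0}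
    (h : ∀ d, ∀ F ∈ grading R k n d, ev φ M F = 0 ↔ ev φ' M' F = 0) :
    pt φ M hM = pt φ' M' hM' :=
  pt_ext (pt_le_pt_iff.mpr fun d F hF => (h d F hF).mp)
    (pt_le_pt_iff.mpr fun d F hF => (h d F hF).mpr)

theorem rowspan_eq_pt {K : Type u} [Field K] (M : Matrix (Fin k) (Fin n) K)
    (hM : ∃ (S : Finset (Fin n)) (hS : S.card = k), minor M S hS ≠ 0) :
    rowspan M hM = pt (RingHom.id K) M hM := by
  have h1 : evalHom M = evalGraded (RingHom.id K) M := by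
    rw [evalHom, evalGraded]
    congr 2
  apply ProjectiveSpectrum.ext
  ext F
  change evalHom M F = 0 ↔ evalGraded (RingHom.id K) M F = 0
  rw [h1]

theorem map_pt {R' : Type u} [CommRing R'] (φ : R →+* R') (g : GL (Fin n) R') (ψ : R' →+* E)
    (M : Matrix (Fin k) (Fin n) E)
    (hM : ∃ (S : Finset (Fin n)) (hS : S.card = k), minor M S hS ≠ 0)
    (hM' : ∃ (S : Finset (Fin n)) (hS : S.card = k), minor (M * g.1.map ψ) S hS ≠ 0) :
    Gr.map k φ g (pt ψ M hM) = pt (ψ.comp φ) (M * g.1.map ψ) hM' := by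
  apply ProjectiveSpectrum.ext
  ext F
  change evalGraded ψ M (coordMap k φ g.1 F) = 0 ↔ evalGraded (ψ.comp φ) (M * g.1.map ψ) F = 0
  rw [evalGraded_coordMap]

end Points

section Chart

open HomogeneousLocalization

variable {R : Type u} [CommRing R] {k n : ℕ} {E : Type*} [Field E]

/-- The homomorphism from the coordinate ring of the chart `p_S ≠ 0` to `E`, for a matrix `M` with
`p_S(M) ≠ 0`: the point `rowspan M` in coordinates. -/
def evAway (φ : R →+* E) (M : Matrix (Fin k) (Fin n) E) {S : Finset (Fin n)} {hS : S.card = k}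
    (h : minor M S hS ≠ 0) : Away (grading R k n) (plucker R S hS) →+* E :=
  (IsLocalization.Away.lift (S := Localization.Away (plucker R S hS)) (plucker R S hS)
    (g := ev φ M) (by rw [ev_plucker]; exact h.isUnit)).comp
    (algebraMap (Away (grading R k n) (plucker R S hS)) (Localization.Away (plucker R S hS)))

theorem evAway_mk (φ : R →+* E) (M : Matrix (Fin k) (Fin n) E) {S : Finset (Fin n)}
    {hS : S.card = k} (h : minor M S hS ≠ 0) (m : ℕ) (F : CoordRing R k n)
    (hF : F ∈ grading R k n (m • 1)) :
    evAway φ M h (Away.mk (grading R k n) (plucker_mem R S hS) m F hF) =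
      ev φ M F / minor M S hS ^ m := by
  rw [eq_div_iff (pow_ne_zero _ h)]
  rw [evAway, RingHom.comp_apply, HomogeneousLocalization.algebraMap_apply, Away.val_mk]
  have h1 : ∀ a : CoordRing R k n, IsLocalization.Away.lift
      (S := Localization.Away (plucker R S hS)) (plucker R S hS)
      (g := ev φ M) (by rw [ev_plucker]; exact h.isUnit) (algebraMap _ _ a) = ev φ M a :=
    fun a => IsLocalization.Away.lift_eq _ _ a
  rw [← ev_plucker φ M S hS, ← map_pow, ← h1, ← h1 F, ← map_mul, Localization.mk_eq_mk']
  exact congrArg _ (IsLocalization.mk'_spec _ F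
    (⟨plucker R S hS ^ m, ⟨m, rfl⟩⟩ : Submonoid.powers (plucker R S hS)))

theorem chartIdeal_closureIdeal_pt (φ : R →+* E) (M : Matrix (Fin k) (Fin n) E)
    (hM : ∃ (S : Finset (Fin n)) (hS : S.card = k), minor M S hS ≠ 0) {S : Finset (Fin n)}
    {hS : S.card = k} (h : minor M S hS ≠ 0) :
    Proj.chartIdeal (Proj.closureIdeal (pt φ M hM)) (plucker_mem R S hS) =
      RingHom.ker (evAway φ M h) := by
  ext a
  obtain ⟨m, F, hF, rfl⟩ := Away.mk_surjective (grading R k n) (plucker_mem R S hS) a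
  rw [Proj.mk_mem_chartIdeal_closureIdeal, plucker_mem_pt_iff, mem_pt_iff φ M hM hF,
    RingHom.mem_ker, evAway_mk, div_eq_zero_iff, or_iff_right h, or_iff_left (pow_ne_zero _ h)]

theorem chartIdeal_closureIdeal_of_mem {x : Gr R k n} {S : Finset (Fin n)}
    {hS : S.card = k} (h : plucker R S hS ∈ x.asHomogeneousIdeal) :
    Proj.chartIdeal (Proj.closureIdeal x) (plucker_mem R S hS) = ⊤ := by
  refine eq_top_iff.mpr fun a _ => ?_
  obtain ⟨m, F, hF, rfl⟩ := Away.mk_surjective (grading R k n) (plucker_mem R S hS) a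
  exact (Proj.mk_mem_chartIdeal_closureIdeal _ _ _ _).mpr (Or.inl h)

end Chart

/-! ### The generic matrix of a point -/

section Generic

variable {k n : ℕ}

/-- The matrix such that right multiplication by it replaces the column of index `c` by the column
of index `b`. -/
def replaceColumn (B : Type*) [CommRing B] (c b : Fin n) : Matrix (Fin n) (Fin n) B :=
  (1 : Matrix (Fin n) (Fin n) B).submatrix id (Function.update id c b)

theorem replaceColumn_map {B B' : Type*} [CommRing B] [CommRing B'] (φ : B →+* B') (c b : Fin n) :
    (replaceColumn B c b).map φ = replaceColumn B' c b := by
  ext a e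
  simp [replaceColumn, Matrix.one_apply, apply_ite φ]

/-- Cramer's rule: the entries of `adj(M_Q) M` are minors of `M` in `Q` with one column replaced. -/
theorem minor_mul_replaceColumn {B : Type*} [CommRing B] (M : Matrix (Fin k) (Fin n) B)
    (Q : Finset (Fin n)) (hQ : Q.card = k) (a : Fin k) (b : Fin n) :
    minor (M * replaceColumn B (Q.orderEmbOfFin hQ a) b) Q hQ =
      ((M.submatrix id (Q.orderEmbOfFin hQ)).adjugate * M) a b := by
  have h1 : M * replaceColumn B (Q.orderEmbOfFin hQ a) b =
      M.submatrix id (Function.update id (Q.orderEmbOfFin hQ a) b) := by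
    ext c e
    simp [replaceColumn, Matrix.mul_apply, Matrix.one_apply]
  have h2 : ((M.submatrix id (Q.orderEmbOfFin hQ)).adjugate * M) a b =
      Matrix.cramer (M.submatrix id (Q.orderEmbOfFin hQ)) (fun c => M c b) a := by
    rw [Matrix.cramer_eq_adjugate_mulVec]
    rfl
  rw [h1, h2, Matrix.cramer_apply, minor]
  congr 1
  ext c e
  rw [Matrix.updateCol_apply, Matrix.submatrix_apply, Matrix.submatrix_apply,
    Matrix.submatrix_apply, Function.update_apply]
  simp only [id, EmbeddingLike.apply_eq_iff_eq]
  split_ifs <;> rfl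

theorem minor_adjugate_mul {B : Type*} [CommRing B] (M : Matrix (Fin k) (Fin n) B)
    (Q : Finset (Fin n)) (hQ : Q.card = k) (S : Finset (Fin n)) (hS : S.card = k) :
    minor ((M.submatrix id (Q.orderEmbOfFin hQ)).adjugate * M) S hS * minor M Q hQ =
      minor M Q hQ ^ k * minor M S hS := by
  have h1 : ((M.submatrix id (Q.orderEmbOfFin hQ)).adjugate * M).submatrix id
      (S.orderEmbOfFin hS) = (M.submatrix id (Q.orderEmbOfFin hQ)).adjugate *
        M.submatrix id (S.orderEmbOfFin hS) := by
    ext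
    simp [Matrix.mul_apply]
  have h2 := congrArg Matrix.det (Matrix.adjugate_mul (M.submatrix id (Q.orderEmbOfFin hQ)))
  rw [Matrix.det_mul, Matrix.det_smul, Matrix.det_one, mul_one, Fintype.card_fin] at h2
  rw [minor, h1, Matrix.det_mul]
  change _ * minor M S hS * minor M Q hQ = _
  change _ * minor M Q hQ = minor M Q hQ ^ k at h2
  rw [← h2]
  ring

/-- The matrix `adj(x_Q) x` with entries Plücker forms, where `x` is the generic matrix. At a point
with `p_Q ≠ 0` it is `p_Q` times the representing matrix with an identity block in the columns
`Q`. -/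
def pluckerMatrix (R : Type u) [CommRing R] (Q : Finset (Fin n)) (hQ : Q.card = k) :
    Matrix (Fin k) (Fin n) (CoordRing R k n) :=
  Matrix.of fun a b => coordMap k (RingHom.id R) (replaceColumn R (Q.orderEmbOfFin hQ a) b)
    (plucker R Q hQ)

theorem pluckerMatrix_mem (R : Type u) [CommRing R] (Q : Finset (Fin n)) (hQ : Q.card = k)
    (a : Fin k) (b : Fin n) : pluckerMatrix R Q hQ a b ∈ grading R k n 1 :=
  (coordMap k (RingHom.id R) _).2 (plucker_mem R Q hQ)

theorem minor_pluckerMatrix (R : Type u) [CommRing R] (Q : Finset (Fin n)) (hQ : Q.card = k)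
    (S : Finset (Fin n)) (hS : S.card = k) :
    minor (pluckerMatrix R Q hQ) S hS * plucker R Q hQ = plucker R Q hQ ^ k * plucker R S hS := by
  apply incl_injective
  set x := Matrix.mvPolynomialX (Fin k) (Fin n) R with hx
  have h1 : (pluckerMatrix R Q hQ).map (incl R k n) =
      (Polynomial.X : (MvPolynomial (Fin k × Fin n) R)[X]) •
        ((x.submatrix id (Q.orderEmbOfFin hQ)).adjugate * x).map Polynomial.C := by
    ext1 a b
    rw [Matrix.map_apply, pluckerMatrix, Matrix.of_apply, incl_coordMap, plucker, incl_homog,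
      Polynomial.map_monomial, substHom_minor, replaceColumn_map, minor_mul_replaceColumn,
      Matrix.smul_apply, Matrix.map_apply, smul_eq_mul, Polynomial.X_mul_C,
      Polynomial.C_mul_X_eq_monomial]
  have h2 : incl R k n (minor (pluckerMatrix R Q hQ) S hS) =
      Polynomial.X ^ k * Polynomial.C
        (minor ((x.submatrix id (Q.orderEmbOfFin hQ)).adjugate * x) S hS) := by
    rw [minor, AlgHom.map_det]
    change (((pluckerMatrix R Q hQ).map (incl R k n)).submatrix id _).det = _
    rw [h1, minor, RingHom.map_det]
    change ((Polynomial.X : (MvPolynomial (Fin k × Fin n) R)[X]) •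
      (((x.submatrix id (Q.orderEmbOfFin hQ)).adjugate * x).map Polynomial.C).submatrix id
        (S.orderEmbOfFin hS)).det = _
    rw [Matrix.det_smul, Fintype.card_fin]
    rfl
  have h3 := congrArg Polynomial.C (minor_adjugate_mul x Q hQ S hS)
  rw [map_mul, map_mul, map_pow] at h3
  rw [map_mul, map_mul, map_pow, h2, plucker, plucker, incl_homog, incl_homog,
    ← Polynomial.C_mul_X_eq_monomial, ← Polynomial.C_mul_X_eq_monomial]
  linear_combination Polynomial.X ^ (k + 1) * h3

/-- Every point of the Grassmannian over a field `K` is the row span of a matrix over a field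
extension `L`, normalised to have a minor `1`, such that the minors generate `L`. -/
theorem exists_eq_pt {K : Type u} [Field K] (x : Gr K k n) :
    ∃ (L : Type u) (_ : Field L) (_ : Algebra K L) (M : Matrix (Fin k) (Fin n) L)
      (Q : Finset (Fin n)) (hQ : Q.card = k) (hM : minor M Q hQ = 1),
      x = pt (algebraMap K L) M ⟨Q, hQ, hM ▸ one_ne_zero⟩ ∧
      IntermediateField.adjoin K {a | ∃ (S : Finset (Fin n)) (hS : S.card = k),
        a = minor M S hS} = ⊤ := by
  obtain ⟨Q, hQ, hne⟩ : ∃ (Q : Finset (Fin n)) (hQ : Q.card = k),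
      plucker K Q hQ ∉ x.asHomogeneousIdeal := by
    by_contra! h
    refine x.not_irrelevant_le fun F hF => ?_
    refine (Ideal.span_le.mpr ?_ : _ ≤ x.asHomogeneousIdeal.toIdeal)
      (irrelevant_le_span_plucker K k n hF)
    rintro _ ⟨S, rfl⟩
    exact h S.1 S.2
  have hprime : x.asHomogeneousIdeal.toIdeal.IsPrime := x.isPrime
  let D := CoordRing K k n ⧸ x.asHomogeneousIdeal.toIdeal
  let L' := FractionRing D
  let mk : CoordRing K k n →+* L' := (algebraMap D L').comp (Ideal.Quotient.mk _)
  have hmk : ∀ F, mk F = 0 ↔ F ∈ x.asHomogeneousIdeal := by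
    intro F
    rw [RingHom.comp_apply, map_eq_zero_iff _ (IsFractionRing.injective D L'),
      Ideal.Quotient.eq_zero_iff_mem]
    rfl
  let ψ : K →+* L' := mk.comp (algebraMap K _)
  set p := mk (plucker K Q hQ) with hp
  have hp0 : p ≠ 0 := fun h => hne ((hmk _).mp h)
  let M : Matrix (Fin k) (Fin n) L' := p⁻¹ • (pluckerMatrix K Q hQ).map mk
  have hminor : ∀ (S : Finset (Fin n)) (hS : S.card = k), p * minor M S hS =
      mk (plucker K S hS) := by
    intro S hS
    have h1 := congrArg mk (minor_pluckerMatrix K Q hQ S hS)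
    rw [map_mul, map_mul, map_pow, ← hp] at h1
    have h2 : minor M S hS = (p⁻¹) ^ k * mk (minor (pluckerMatrix K Q hQ) S hS) := by
      rw [minor, minor, RingHom.map_det]
      change ((p⁻¹) • ((pluckerMatrix K Q hQ).map mk).submatrix id _).det = _
      rw [Matrix.det_smul, Fintype.card_fin]
      rfl
    rw [h2, inv_pow]
    have : p ^ k ≠ 0 := pow_ne_zero _ hp0
    rw [mul_left_comm, mul_comm p, h1, inv_mul_cancel_left₀ this]
  have hcone : mk = evalCone ψ M p := by
    refine CoordRing.ringHom_ext (fun r => ?_) fun S hS => ?_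
    · rw [evalCone_algebraMap]; rfl
    · rw [evalCone_plucker, hminor]
  let _ : Algebra K L' := ψ.toAlgebra
  set L := IntermediateField.adjoin K {a | ∃ (S : Finset (Fin n)) (hS : S.card = k),
    a = minor M S hS} with hL
  have hentry : ∀ a b, M a b ∈ L := by
    intro a b
    have h1 : M a b = ev ψ M (pluckerMatrix K Q hQ a b) := by
      have h2 : mk (pluckerMatrix K Q hQ a b) = p * ev ψ M (pluckerMatrix K Q hQ a b) := by
        rw [hcone, evalCone_of_mem ψ M p (pluckerMatrix_mem K Q hQ a b), pow_one]
      change p⁻¹ * mk (pluckerMatrix K Q hQ a b) = _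
      rw [h2, inv_mul_cancel_left₀ hp0]
    rw [h1]
    have h3 := ev_mem_subring ψ M 1 L.toSubring (fun r => L.algebraMap_mem r)
      (fun S hS => by
        rw [one_mul]
        exact IntermediateField.subset_adjoin K _ ⟨S, hS, rfl⟩) (pluckerMatrix_mem K Q hQ a b)
    rwa [one_pow, one_mul] at h3
  let M₁ : Matrix (Fin k) (Fin n) L := Matrix.of fun a b => ⟨M a b, hentry a b⟩
  have hM₁ : M₁.map L.val = M := by
    ext; rfl
  have hminor₁ : ∀ (S : Finset (Fin n)) (hS : S.card = k),
      L.val (minor M₁ S hS) = minor M S hS := by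
    intro S hS
    rw [minor, AlgHom.map_det]
    rfl
  have hQ1 : minor M₁ Q hQ = 1 := by
    refine L.val.injective ((hminor₁ Q hQ).trans ?_)
    exact (mul_left_cancel₀ hp0 (by rw [hminor, mul_one])).trans (map_one L.val).symm
  refine ⟨L, inferInstance, inferInstance, M₁, Q, hQ, hQ1, ?_, ?_⟩
  · have h1 : ∀ d, ∀ F ∈ grading K k n d, ev (algebraMap K L) M₁ F = 0 ↔
        F ∈ x.asHomogeneousIdeal := by
      intro d F hF
      rw [← hmk, hcone, evalCone_of_mem ψ M p hF, mul_eq_zero_iff_left (pow_ne_zero _ hp0)]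
      have h2 : L.val.toRingHom (ev (algebraMap K L) M₁ F) = ev ψ M F := by
        rw [map_ev]
        congr 2
      rw [← h2]
      exact (map_eq_zero_iff _ L.val.injective).symm
    refine pt_ext (asHomogeneousIdeal_le_iff.mpr fun d F hF hFx => ?_)
      (asHomogeneousIdeal_le_iff.mpr fun d F hF hFx => ?_)
    · exact (mem_pt_iff _ _ _ hF).mpr ((h1 d F hF).mpr hFx)
    · exact (h1 d F hF).mp ((mem_pt_iff _ _ _ hF).mp hFx)
  · have h1 : {a | ∃ (S : Finset (Fin n)) (hS : S.card = k), a = minor M S hS} =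
        L.val '' {a | ∃ (S : Finset (Fin n)) (hS : S.card = k), a = minor M₁ S hS} := by
      ext a
      constructor
      · rintro ⟨S, hS, rfl⟩
        exact ⟨_, ⟨S, hS, rfl⟩, hminor₁ S hS⟩
      · rintro ⟨_, ⟨S, hS, rfl⟩, rfl⟩
        exact ⟨S, hS, hminor₁ S hS⟩
    have h2 := IntermediateField.adjoin_map K {a | ∃ (S : Finset (Fin n)) (hS : S.card = k),
      a = minor M₁ S hS} L.val
    rw [← h1, ← hL] at h2
    rw [eq_top_iff]
    intro y _
    obtain ⟨z, hz, hzy⟩ := (SetLike.ext_iff.mp h2 _).mpr y.2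
    exact L.val.injective hzy ▸ hz

end Generic

/-! ### Torus-invariant closed subschemes -/

section Torus

variable {R : Type u} [CommRing R] {k n : ℕ}

theorem minor_map {E E' : Type*} [CommRing E] [CommRing E'] (f : E →+* E')
    (M : Matrix (Fin k) (Fin n) E) (S : Finset (Fin n)) (hS : S.card = k) :
    minor (M.map f) S hS = f (minor M S hS) := by
  rw [minor, minor, RingHom.map_det]
  rfl

theorem pt_map {E E' : Type*} [CommRing E] [IsDomain E] [CommRing E'] [IsDomain E'] (φ : R →+* E)
    (M : Matrix (Fin k) (Fin n) E) (f : E →+* E') (hf : Function.Injective f)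
    (hM : ∃ (S : Finset (Fin n)) (hS : S.card = k), minor M S hS ≠ 0)
    (hM' : ∃ (S : Finset (Fin n)) (hS : S.card = k), minor (M.map f) S hS ≠ 0) :
    pt (f.comp φ) (M.map f) hM' = pt φ M hM :=
  pt_congr fun d F _ => by rw [← map_ev, map_eq_zero_iff f hf]

theorem exists_minor_map_ne_zero {E E' : Type*} [CommRing E] [CommRing E'] {f : E →+* E'}
    (hf : Function.Injective f) {M : Matrix (Fin k) (Fin n) E}
    (hM : ∃ (S : Finset (Fin n)) (hS : S.card = k), minor M S hS ≠ 0) :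
    ∃ (S : Finset (Fin n)) (hS : S.card = k), minor (M.map f) S hS ≠ 0 := by
  obtain ⟨S, hS, h⟩ := hM
  exact ⟨S, hS, by rwa [minor_map, Ne, map_eq_zero_iff f hf]⟩

theorem exists_minor_mul_diagonal_ne_zero {E : Type*} [CommRing E] [IsDomain E]
    {M : Matrix (Fin k) (Fin n) E} {t : Fin n → E} (ht : ∀ a, t a ≠ 0)
    (hM : ∃ (S : Finset (Fin n)) (hS : S.card = k), minor M S hS ≠ 0) :
    ∃ (S : Finset (Fin n)) (hS : S.card = k), minor (M * Matrix.diagonal t) S hS ≠ 0 := by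
  obtain ⟨S, hS, h⟩ := hM
  refine ⟨S, hS, ?_⟩
  rw [minor_mul_diagonal]
  exact mul_ne_zero (Finset.prod_ne_zero_iff.mpr fun a _ => ht a) h

theorem mem_support_of_le {X : (Gr R k n).IdealSheafData} {x y : Gr R k n}
    (hxy : x.asHomogeneousIdeal ≤ y.asHomogeneousIdeal) (hx : x ∈ X.support) : y ∈ X.support := by
  rw [← Proj.le_closureIdeal_iff] at hx ⊢
  exact hx.trans (Proj.closureIdeal_le_iff.mpr hxy)

variable {K : Type u} [Field K]

/-- Points of a torus-invariant subscheme over a field extension are moved inside the subscheme by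
the points of the torus over that extension. -/
theorem TInvariant.pt_mul_diagonal_mem_support {X : (Gr K k n).IdealSheafData}
    (hX : TInvariant X) {E : Type u} [Field E] (φ : K →+* E) (M : Matrix (Fin k) (Fin n) E)
    (hM : ∃ (S : Finset (Fin n)) (hS : S.card = k), minor M S hS ≠ 0)
    {t : Fin n → E} (ht : ∀ a, t a ≠ 0) (h : pt φ M hM ∈ X.support) :
    pt φ (M * Matrix.diagonal t) (exists_minor_mul_diagonal_ne_zero ht hM) ∈ X.support := by
  let _ : Algebra K E := φ.toAlgebra
  have h1 : ∀ (M : Matrix (Fin k) (Fin n) E)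
      (hM : ∃ (S : Finset (Fin n)) (hS : S.card = k), minor M S hS ≠ 0),
      pt (RingHom.id E) M hM ∈ (X.comap (Gr.baseChange k n (algebraMap K E))).support ↔
        pt φ M hM ∈ X.support := by
    intro M hM
    rw [Scheme.IdealSheafData.support_comap]
    have h2 : Gr.baseChange k n (algebraMap K E) (pt (RingHom.id E) M hM) = pt φ M hM := by
      have h3 : M * (1 : GL (Fin n) E).1.map (RingHom.id E) = M := by simp
      rw [Gr.baseChange, map_pt (algebraMap K E) 1 (RingHom.id E) M hM (by rwa [h3])]
      refine pt_congr fun d F _ => ?_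
      rw [h3]
      rfl
    rw [← h2]
    rfl
  rw [← h1] at h ⊢
  have h4 := hX E fun a => Units.mk0 (t a) (ht a)
  rw [← h4, Scheme.IdealSheafData.support_comap] at h
  have h5 : (diagGL fun a => Units.mk0 (t a) (ht a)).1.map (RingHom.id E) =
      Matrix.diagonal t := by
    ext a b
    rfl
  have h6 : Gr.act k (diagGL fun a => Units.mk0 (t a) (ht a)) (pt (RingHom.id E) M hM) =
      pt (RingHom.id E) (M * Matrix.diagonal t) (exists_minor_mul_diagonal_ne_zero ht hM) := by
    rw [Gr.act, map_pt (RingHom.id E) _ (RingHom.id E) M hM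
      (by rw [h5]; exact exists_minor_mul_diagonal_ne_zero ht hM)]
    refine pt_congr fun d F _ => ?_
    rw [h5]
    rfl
  rw [← h6]
  exact h

/-- A torus-invariant subscheme that has a point with `p_S ≠ 0` contains the coordinate subspace
`coord S`: scale the coordinates outside `S` by a variable, and let it tend to zero. -/
theorem TInvariant.coordPt_mem_support {X : (Gr K k n).IdealSheafData}
    (hX : TInvariant X) {L : Type u} [Field L] (φ : K →+* L) (M : Matrix (Fin k) (Fin n) L)
    (hM : ∃ (S : Finset (Fin n)) (hS : S.card = k), minor M S hS ≠ 0)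
    (h : pt φ M hM ∈ X.support) (S : Finset (Fin n)) (hS : S.card = k) (hne : minor M S hS ≠ 0) :
    coordPt K S hS ∈ X.support := by
  let ι : L[X] →+* FractionRing L[X] := algebraMap _ _
  have hι : Function.Injective ι := IsFractionRing.injective _ _
  let j : L →+* FractionRing L[X] := ι.comp Polynomial.C
  have hj : Function.Injective j := hι.comp Polynomial.C_injective
  let t : Fin n → L[X] := fun a => if a ∈ S then 1 else Polynomial.X
  have ht : ∀ a, ι (t a) ≠ 0 := fun a => by
    rw [Ne, map_eq_zero_iff _ hι]
    simp only [t]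
    split_ifs
    · exact one_ne_zero
    · exact Polynomial.X_ne_zero
  have h1 : pt (j.comp φ) (M.map j) (exists_minor_map_ne_zero hj hM) ∈ X.support := by
    rwa [pt_map φ M j hj hM]
  have h2 := hX.pt_mul_diagonal_mem_support _ _ _ ht h1
  refine mem_support_of_le ?_ h2
  rw [coordPt, rowspan_eq_pt]
  refine pt_le_pt_iff.mpr fun d F hF h3 => ?_
  have h4 : M.map j * Matrix.diagonal (fun a => ι (t a)) =
      (M.map Polynomial.C * Matrix.diagonal t).map ι := by
    rw [Matrix.map_mul, Matrix.map_map, Matrix.diagonal_map (map_zero ι)]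
    rfl
  rw [h4, show j.comp φ = ι.comp (Polynomial.C.comp φ) from rfl, ← map_ev,
    map_eq_zero_iff _ hι] at h3
  have h5 := congrArg (Polynomial.evalRingHom (0 : L)) h3
  rw [map_ev, map_zero, Matrix.map_mul, Matrix.map_map, Matrix.diagonal_map (map_zero _)] at h5
  have h6 : M.map (Polynomial.evalRingHom (0 : L) ∘ Polynomial.C) *
      Matrix.diagonal (fun a => Polynomial.evalRingHom (0 : L) (t a)) =
      M.submatrix id (S.orderEmbOfFin hS) *
        (((1 : Matrix (Fin n) (Fin n) K).submatrix (S.orderEmbOfFin hS) id).map φ) := by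
    ext a b
    rw [Matrix.mul_diagonal, Matrix.mul_apply]
    by_cases hb : b ∈ S
    · obtain ⟨c, rfl⟩ : b ∈ Set.range (S.orderEmbOfFin hS) := by simpa using hb
      rw [Finset.sum_eq_single c]
      · have h6 : (1 : Matrix (Fin n) (Fin n) K) (S.orderEmbOfFin hS c)
            (id (S.orderEmbOfFin hS c)) = 1 := Matrix.one_apply_eq _
        simp [t, h6]
      · intro e _ hec
        simp [hec]
      · simp
    · rw [Finset.sum_eq_zero]
      · simp [t, hb]
      · intro e _
        have : S.orderEmbOfFin hS e ≠ b := fun he => hb (he ▸ Finset.orderEmbOfFin_mem S hS e)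
        simp [this]
  have h7 : (Polynomial.evalRingHom (0 : L)).comp (Polynomial.C.comp φ) =
      φ.comp (RingHom.id K) := by
    ext; simp
  rw [h6, ev_mul_left _ _ _ hF, h7, ← map_ev] at h5
  have h8 := (mul_eq_zero.mp h5).resolve_left (pow_ne_zero _ hne)
  exact (map_eq_zero_iff _ φ.injective).mp h8

theorem minor_coord (S : Finset (Fin n)) (hS : S.card = k) :
    minor ((1 : Matrix (Fin n) (Fin n) K).submatrix (S.orderEmbOfFin hS) id) S hS = 1 := by
  rw [minor, Matrix.submatrix_submatrix, Function.id_comp, Function.comp_id,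
    Matrix.submatrix_one _ (S.orderEmbOfFin hS).injective, Matrix.det_one]

theorem plucker_notMem_coordPt (S : Finset (Fin n)) (hS : S.card = k) :
    plucker K S hS ∉ (coordPt K S hS).asHomogeneousIdeal := by
  rw [coordPt, rowspan_eq_pt, plucker_mem_pt_iff, minor_coord]
  exact one_ne_zero

/-- The coordinate subspaces in a torus-invariant subvariety are those whose Plücker coordinate does
not vanish at the generic point. -/
theorem mem_coordInv_closureIdeal_iff {L : Type u} [Field L] (φ : K →+* L)
    (M : Matrix (Fin k) (Fin n) L)
    (hM : ∃ (S : Finset (Fin n)) (hS : S.card = k), minor M S hS ≠ 0)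
    (hX : TInvariant (Proj.closureIdeal (pt φ M hM))) (S : Finset (Fin n)) (hS : S.card = k) :
    S ∈ coordInv (Proj.closureIdeal (pt φ M hM)) ↔ minor M S hS ≠ 0 := by
  constructor
  · rintro ⟨_, h⟩ h0
    rw [Proj.mem_support_closureIdeal] at h
    exact plucker_notMem_coordPt S hS (h ((plucker_mem_pt_iff φ M hM S hS).mpr h0))
  · exact fun h => ⟨hS, hX.coordPt_mem_support φ M hM
      (Proj.mem_support_closureIdeal.mpr le_rfl) S hS h⟩

/-- The torus-fixed points of the Grassmannian are the coordinate subspaces. -/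
theorem exists_eq_coordPt {X : (Gr K k n).IdealSheafData} {x : Gr K k n}
    (hx : x ∈ fixedPoints X) : ∃ (S : Finset (Fin n)) (hS : S.card = k), x = coordPt K S hS := by
  obtain ⟨-, hcl, hT⟩ := hx
  obtain ⟨L, _, _, M, Q, hQ, hQ1, rfl, -⟩ := exists_eq_pt x
  have h1 := TInvariant.coordPt_mem_support hT (algebraMap K L) M ⟨Q, hQ, hQ1 ▸ one_ne_zero⟩
    (Proj.mem_support_closureIdeal.mpr le_rfl) Q hQ (hQ1 ▸ one_ne_zero)
  have h2 : coordPt K Q hQ ∈ closure {pt (algebraMap K L) M ⟨Q, hQ, hQ1 ▸ one_ne_zero⟩} :=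
    Proj.mem_closure_singleton_iff.mpr (Proj.mem_support_closureIdeal.mp h1)
  rw [hcl.closure_eq] at h2
  exact ⟨Q, hQ, h2.symm⟩

end Torus

/-! ### Base change on standard charts -/

section ChartMap

open HomogeneousLocalization

variable {R R' : Type u} [CommRing R] [CommRing R'] {k n : ℕ}

/-- Base change of fractions on the chart `p_S ≠ 0`. -/
def chartMap (φ : R →+* R') (S : Finset (Fin n)) (hS : S.card = k) :
    Away (grading R k n) (plucker R S hS) →+* Away (grading R' k n) (plucker R' S hS) :=
  HomogeneousLocalization.map (coordMap k φ 1) <| by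
    rintro _ ⟨m, rfl⟩
    refine ⟨m, ?_⟩
    change _ = coordMap k φ 1 (plucker R S hS ^ m)
    rw [map_pow, coordMap_one_plucker]

theorem coordMap_mem (φ : R →+* R') (g : Matrix (Fin n) (Fin n) R') {d : ℕ} {F : CoordRing R k n}
    (hF : F ∈ grading R k n d) : coordMap k φ g F ∈ grading R' k n d :=
  (coordMap k φ g).2 hF

theorem chartMap_mk (φ : R →+* R') (S : Finset (Fin n)) (hS : S.card = k) (m : ℕ)
    (F : CoordRing R k n) (hF : F ∈ grading R k n (m • 1)) :
    chartMap φ S hS (Away.mk _ (plucker_mem R S hS) m F hF) =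
      Away.mk _ (plucker_mem R' S hS) m (coordMap k φ 1 F) (coordMap_mem φ 1 hF) := by
  apply HomogeneousLocalization.val_injective
  change Localization.mk _ _ = Localization.mk _ _
  congr 1
  apply Subtype.ext
  change coordMap k φ 1 (plucker R S hS ^ m) = plucker R' S hS ^ m
  rw [map_pow, coordMap_one_plucker]

theorem chartIdeal_comap_baseChange (X : (Gr R k n).IdealSheafData) (φ : R →+* R')
    (S : Finset (Fin n)) (hS : S.card = k) :
    Proj.chartIdeal (X.comap (Gr.baseChange k n φ)) (plucker_mem R' S hS) =
      (Proj.chartIdeal X (plucker_mem R S hS)).map (chartMap φ S hS) := by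
  have h : ∀ (s' : CoordRing R' k n) (hs' : s' ∈ grading R' k n 1)
      (e : coordMap k φ 1 (plucker R S hS) = s'),
      Proj.chartIdeal (X.comap (Gr.baseChange k n φ)) hs' =
        (Proj.chartIdeal X (plucker_mem R S hS)).map
          (HomogeneousLocalization.map (coordMap k φ 1) (Q := Submonoid.powers s') <| by
            rintro _ ⟨m, rfl⟩
            refine ⟨m, ?_⟩
            change _ = coordMap k φ 1 (plucker R S hS ^ m)
            rw [map_pow, e] :
              Away (grading R k n) (plucker R S hS) →+* Away (grading R' k n) s') := by
    rintro _ hs' rfl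
    exact Proj.chartIdeal_comap X (coordMap k φ (1 : GL (Fin n) R').1)
      (irrelevant_le_map k φ 1) (plucker_mem R S hS) hs'
  exact h _ (plucker_mem R' S hS) (coordMap_one_plucker φ S hS)

theorem val_mk_eq (S : Finset (Fin n)) (hS : S.card = k) (m : ℕ)
    (F : CoordRing R k n) (hF : F ∈ grading R k n (m • 1)) :
    (Away.mk _ (plucker_mem R S hS) m F hF).val =
      algebraMap _ (Localization.Away (plucker R S hS)) F *
        Localization.mk 1
          (⟨plucker R S hS ^ m, ⟨m, rfl⟩⟩ : Submonoid.powers (plucker R S hS)) := by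
  rw [Away.val_mk, ← Localization.mk_one_eq_algebraMap, Localization.mk_mul, mul_one, one_mul]

/-- The scalar `r` as a function on the chart `p_S ≠ 0`. -/
def scalar (S : Finset (Fin n)) (hS : S.card = k) (r : R) :
    Away (grading R k n) (plucker R S hS) :=
  Away.mk _ (plucker_mem R S hS) 0 (algebraMap R _ r)
    (by simpa using SetLike.algebraMap_mem_graded (grading R k n) r)

theorem val_scalar (S : Finset (Fin n)) (hS : S.card = k) (r : R) :
    (scalar S hS r).val = algebraMap _ (Localization.Away (plucker R S hS))
      (algebraMap R (CoordRing R k n) r) := by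
  rw [scalar, val_mk_eq]
  have : (⟨plucker R S hS ^ 0, ⟨0, rfl⟩⟩ : Submonoid.powers (plucker R S hS)) = 1 :=
    Subtype.ext (pow_zero _)
  rw [this, Localization.mk_one, mul_one]

theorem scalar_mul (S : Finset (Fin n)) (hS : S.card = k) (r r' : R) :
    scalar S hS (r * r') = scalar S hS r * scalar S hS r' := by
  apply HomogeneousLocalization.val_injective
  rw [val_mul, val_scalar, val_scalar, val_scalar, map_mul, map_mul]

theorem scalar_one (S : Finset (Fin n)) (hS : S.card = k) :
    scalar S hS (1 : R) = 1 := by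
  apply HomogeneousLocalization.val_injective
  rw [val_one, val_scalar, map_one, map_one]

theorem evAway_scalar {E : Type*} [Field E] (φ : R →+* E) (M : Matrix (Fin k) (Fin n) E)
    {S : Finset (Fin n)} {hS : S.card = k} (h : minor M S hS ≠ 0) (r : R) :
    evAway φ M h (scalar S hS r) = φ r := by
  rw [scalar, evAway_mk, pow_zero, div_one, evalCone_algebraMap]

end ChartMap

/-! ### The family defining the geometric shift -/

section Family

open HomogeneousLocalization

variable {K : Type u} [Field K] {k n : ℕ}

theorem eval₂_comp_algebraMap {E : Type*} [CommRing E] (φ : K →+* E) (u : Eˣ) :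
    (LaurentPolynomial.eval₂ φ u).comp (algebraMap K K[T;T⁻¹]) = φ := by
  ext r
  exact LaurentPolynomial.eval₂_C φ u r

theorem eval₂_comp_toLaurent {E : Type*} [CommRing E] (φ : K →+* E) (u : Eˣ) :
    (LaurentPolynomial.eval₂ φ u).comp Polynomial.toLaurent =
      Polynomial.eval₂RingHom φ (u : E) := by
  refine RingHom.ext fun p => ?_
  exact LaurentPolynomial.eval₂_toLaurent φ u p

theorem transvection_map {B B' : Type*} [CommRing B] [CommRing B'] (f : B →+* B') (i j : Fin n)
    (c : B) : (Matrix.transvection i j c).map f = Matrix.transvection i j (f c) := by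
  rw [Matrix.transvection, Matrix.transvection, Matrix.map_add _ (map_add f),
    Matrix.map_one _ (map_zero f) (map_one f), Matrix.map_single]

theorem ev_eq_sum {E : Type*} [CommRing E] (φ : K →+* E) (u : Eˣ) (M : Matrix (Fin k) (Fin n) E)
    {G : CoordRing K[T;T⁻¹] k n} {N m : ℕ} {f : ℕ → CoordRing K k n}
    (h : algebraMap K[T;T⁻¹] _ (LaurentPolynomial.T N) * G = ∑ i ∈ Finset.range m,
        algebraMap K[T;T⁻¹] _ (LaurentPolynomial.T i) *
          coordMap k (algebraMap K K[T;T⁻¹]) 1 (f i)) :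
    (u : E) ^ N * ev (LaurentPolynomial.eval₂ φ u) M G =
      ∑ i ∈ Finset.range m, (u : E) ^ i * ev φ M (f i) := by
  have h1 := congrArg (ev (LaurentPolynomial.eval₂ φ u) M) h
  rw [map_mul, evalCone_algebraMap, map_sum, LaurentPolynomial.eval₂_T_n] at h1
  rw [h1]
  refine Finset.sum_congr rfl fun i _ => ?_
  rw [map_mul, evalCone_algebraMap, LaurentPolynomial.eval₂_T_n, ev_coordMap,
    eval₂_comp_algebraMap, Matrix.map_one _ (map_zero _) (map_one _), Matrix.mul_one]

section Transfer

variable {L E E' : Type*} [Field L] [Field E] [Field E'] {φ : K →+* L}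
  {M : Matrix (Fin k) (Fin n) L} {ι : L →+* E} {u : Eˣ}

/-- If a form over `K[u, u⁻¹]` vanishes at `M` with `u` transcendental over the field of `M`, then
its coefficients vanish at `M`. -/
theorem ev_coeff_eq_zero
    (hu : ∀ p : L[X], p.eval₂ ι u = 0 → p = 0) {G : CoordRing K[T;T⁻¹] k n} {N m : ℕ}
    {f : ℕ → CoordRing K k n}
    (h : algebraMap K[T;T⁻¹] _ (LaurentPolynomial.T N) * G = ∑ i ∈ Finset.range m,
        algebraMap K[T;T⁻¹] _ (LaurentPolynomial.T i) *
          coordMap k (algebraMap K K[T;T⁻¹]) 1 (f i))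
    (hG : ev (LaurentPolynomial.eval₂ (ι.comp φ) u) (M.map ι) G = 0) {i : ℕ}
    (hi : i ∈ Finset.range m) : ev φ M (f i) = 0 := by
  have h1 := ev_eq_sum (ι.comp φ) u (M.map ι) h
  rw [hG, mul_zero] at h1
  have h2 := hu (∑ i ∈ Finset.range m, Polynomial.monomial i (ev φ M (f i))) (by
    rw [Polynomial.eval₂_finsetSum, h1]
    refine Finset.sum_congr rfl fun i _ => ?_
    rw [Polynomial.eval₂_monomial, map_ev, mul_comm])
  have h3 := congrArg (fun p => Polynomial.coeff p i) h2
  simpa [Polynomial.finsetSum_coeff, Polynomial.coeff_monomial, Finset.mem_range.mp hi] using h3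

/-- The pair `(M, u)`, with `u` transcendental over the field of `M`, specializes to `(M', u')` for
every specialization `M'` of `M` and every nonzero `u'`. -/
theorem ev_laurent_eq_zero_of_specialization
    (hu : ∀ p : L[X], p.eval₂ ι u = 0 → p = 0) {φ' : K →+* E'} {M' : Matrix (Fin k) (Fin n) E'}
    (hsp : ∀ d, ∀ F ∈ grading K k n d, ev φ M F = 0 → ev φ' M' F = 0) (u' : E'ˣ) {d : ℕ}
    {G : CoordRing K[T;T⁻¹] k n} (hGd : G ∈ grading K[T;T⁻¹] k n d)
    (hG : ev (LaurentPolynomial.eval₂ (ι.comp φ) u) (M.map ι) G = 0) :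
    ev (LaurentPolynomial.eval₂ φ' u') M' G = 0 := by
  obtain ⟨N, m, f, hf, h⟩ := exists_T_mul_eq_sum hGd
  have h1 := ev_eq_sum φ' u' M' h
  rw [Finset.sum_eq_zero fun i hi => by
    rw [hsp d _ (hf i) (ev_coeff_eq_zero hu h hG hi), mul_zero]] at h1
  exact (mul_eq_zero.mp h1).resolve_left (pow_ne_zero _ u'.ne_zero)

theorem ev_expGL {E : Type*} [Field E] (φ : K →+* E) (u : Eˣ) (M : Matrix (Fin k) (Fin n) E)
    {i j : Fin n} (hij : i ≠ j) (F : CoordRing K[X] k n) :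
    ev (LaurentPolynomial.eval₂ φ u) M
        (coordMap k Polynomial.toLaurent (expGL hij (LaurentPolynomial.T (-1) : K[T;T⁻¹])).1 F) =
      ev (Polynomial.eval₂RingHom φ (u : E)) (M * Matrix.transvection i j (u : E)⁻¹) F := by
  rw [ev_coordMap, eval₂_comp_toLaurent]
  congr 3
  have h1 : LaurentPolynomial.eval₂ φ u (LaurentPolynomial.T (-1)) = (u : E)⁻¹ := by
    rw [LaurentPolynomial.eval₂_T, zpow_neg_one, Units.val_inv_eq_inv_val]
  rw [← h1]
  exact transvection_map _ i j _

/-- Specialization in the family `M exp (u⁻¹ e_ij)`: a form over `K[u]` that vanishes at its generic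
point vanishes at `M' exp (u'⁻¹ e_ij)` for every specialization `M'` of `M` and every nonzero
`u'`. -/
theorem ev_transvection_eq_zero_of_specialization
    (hu : ∀ p : L[X], p.eval₂ ι u = 0 → p = 0) {φ' : K →+* E'} {M' : Matrix (Fin k) (Fin n) E'}
    (hsp : ∀ d, ∀ F ∈ grading K k n d, ev φ M F = 0 → ev φ' M' F = 0) (u' : E'ˣ)
    {i j : Fin n} (hij : i ≠ j) {d : ℕ}
    {F : CoordRing K[X] k n} (hF : F ∈ grading K[X] k n d)
    (h : ev (Polynomial.eval₂RingHom (ι.comp φ) (u : E))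
      (M.map ι * Matrix.transvection i j (u : E)⁻¹) F = 0) :
    ev (Polynomial.eval₂RingHom φ' (u' : E')) (M' * Matrix.transvection i j (u' : E')⁻¹) F = 0 := by
  rw [← ev_expGL _ _ _ hij] at h ⊢
  exact ev_laurent_eq_zero_of_specialization hu hsp u' (coordMap_mem _ _ hF) h

end Transfer

end Family

section GeomShift

open HomogeneousLocalization

theorem baseChange_pt {R R' : Type u} [CommRing R] [CommRing R'] {k n : ℕ} {E : Type*}
    [CommRing E] [IsDomain E] (φ : R →+* R') (ψ : R' →+* E) (M : Matrix (Fin k) (Fin n) E)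
    (hM : ∃ (S : Finset (Fin n)) (hS : S.card = k), minor M S hS ≠ 0) :
    Gr.baseChange k n φ (pt ψ M hM) = pt (ψ.comp φ) M hM := by
  have h : M * (1 : GL (Fin n) R').1.map ψ = M := by
    rw [Units.val_one, Matrix.map_one _ (map_zero _) (map_one _), Matrix.mul_one]
  rw [Gr.baseChange, map_pt φ 1 ψ M hM (by rwa [h])]
  exact pt_congr fun d F _ => by rw [h]

variable {K : Type u} [Field K] {k n : ℕ} {L E : Type*} [Field L] [Field E]

/-- The base change of a subvariety to `K[u, u⁻¹]` is integral, with generic point given by the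
generic matrix of the subvariety and a transcendental value of `u`. -/
theorem comap_baseChange_closureIdeal {φ : K →+* L} {M : Matrix (Fin k) (Fin n) L}
    {hM : ∃ (S : Finset (Fin n)) (hS : S.card = k), minor M S hS ≠ 0}
    {ι : L →+* E} {u : Eˣ} (hu : ∀ p : L[X], p.eval₂ ι u = 0 → p = 0) :
    (Proj.closureIdeal (pt φ M hM)).comap (Gr.baseChange k n (algebraMap K K[T;T⁻¹])) =
      Proj.closureIdeal (pt (LaurentPolynomial.eval₂ (ι.comp φ) u) (M.map ι)
        (exists_minor_map_ne_zero ι.injective hM)) := by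
  apply le_antisymm
  · rw [← Scheme.IdealSheafData.le_map_iff_comap_le, Proj.map_closureIdeal, baseChange_pt,
      Proj.closureIdeal_le_iff]
    refine pt_le_pt_iff.mpr fun d F _ hF => ?_
    rw [eval₂_comp_algebraMap, ← map_ev, hF, map_zero]
  · refine le_of_chartIdeal_plucker_le fun S hS => ?_
    rw [chartIdeal_comap_baseChange]
    by_cases hne : minor M S hS = 0
    · rw [chartIdeal_closureIdeal_of_mem ((plucker_mem_pt_iff φ M hM S hS).mpr hne),
        Ideal.map_top]
      exact le_top
    intro a ha
    obtain ⟨m, G, hGm, rfl⟩ := Away.mk_surjective _ (plucker_mem K[T;T⁻¹] S hS) a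
    rw [Proj.mk_mem_chartIdeal_closureIdeal, plucker_mem_pt_iff, minor_map,
      map_eq_zero_iff _ ι.injective, or_iff_right hne, mem_pt_iff _ _ _ hGm] at ha
    obtain ⟨N, l, f, hf, h⟩ := exists_T_mul_eq_sum hGm
    set J := ((Proj.chartIdeal (Proj.closureIdeal (pt φ M hM)) (plucker_mem K S hS)).map
      (chartMap (algebraMap K K[T;T⁻¹]) S hS)) with hJ
    have h1 : scalar S hS (LaurentPolynomial.T N) * Away.mk _ (plucker_mem K[T;T⁻¹] S hS) m G hGm =
        ∑ i ∈ Finset.range l, scalar S hS (LaurentPolynomial.T i) *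
          chartMap (algebraMap K K[T;T⁻¹]) S hS
            (Away.mk _ (plucker_mem K S hS) m (f i) (hf i)) := by
      apply HomogeneousLocalization.val_injective
      rw [val_mul, val_scalar, val_mk_eq, ← mul_assoc, ← map_mul, h, map_sum, Finset.sum_mul,
        ← HomogeneousLocalization.algebraMap_apply, map_sum]
      refine Finset.sum_congr rfl fun i _ => ?_
      rw [HomogeneousLocalization.algebraMap_apply, val_mul, val_scalar, chartMap_mk, val_mk_eq,
        map_mul, mul_assoc]
    have h2 : scalar S hS (LaurentPolynomial.T N) *
        Away.mk _ (plucker_mem K[T;T⁻¹] S hS) m G hGm ∈ J := by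
      rw [h1]
      refine J.sum_mem fun i hi => J.mul_mem_left _ (Ideal.mem_map_of_mem _ ?_)
      rw [Proj.mk_mem_chartIdeal_closureIdeal, mem_pt_iff _ _ _ (hf i)]
      exact Or.inr (ev_coeff_eq_zero hu h ha hi)
    have h3 := J.mul_mem_left (scalar S hS (LaurentPolynomial.T (-N : ℤ))) h2
    rwa [← mul_assoc, ← scalar_mul, ← LaurentPolynomial.T_add, neg_add_cancel,
      LaurentPolynomial.T_zero, scalar_one, one_mul] at h3

theorem exists_minor_transvection_ne_zero {M : Matrix (Fin k) (Fin n) E} {i j : Fin n}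
    (hij : i ≠ j) (c : E) (hM : ∃ (S : Finset (Fin n)) (hS : S.card = k), minor M S hS ≠ 0) :
    ∃ (S : Finset (Fin n)) (hS : S.card = k), minor (M * Matrix.transvection i j c) S hS ≠ 0 :=
  exists_minor_mul_ne_zero hM (expGL hij c)

/-- The closure of the family `exp (u⁻¹ e_ij) X` is integral, with generic point
`M exp (u⁻¹ e_ij)`, where `M` is the generic matrix of `X`. -/
theorem shiftClosure_closureIdeal {φ : K →+* L} {M : Matrix (Fin k) (Fin n) L}
    {hM : ∃ (S : Finset (Fin n)) (hS : S.card = k), minor M S hS ≠ 0}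
    {ι : L →+* E} {u : Eˣ} (hu : ∀ p : L[X], p.eval₂ ι u = 0 → p = 0) {i j : Fin n}
    (hij : i ≠ j) :
    shiftClosure hij (Proj.closureIdeal (pt φ M hM)) =
      Proj.closureIdeal (pt (Polynomial.eval₂RingHom (ι.comp φ) (u : E))
        (M.map ι * Matrix.transvection i j (u : E)⁻¹)
        (exists_minor_transvection_ne_zero hij _
          (exists_minor_map_ne_zero ι.injective hM))) := by
  have h1 : M.map ι * (expGL hij (LaurentPolynomial.T (-1) : K[T;T⁻¹])).1.map
      (LaurentPolynomial.eval₂ (ι.comp φ) u) =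
      M.map ι * Matrix.transvection i j (u : E)⁻¹ := by
    have h2 : LaurentPolynomial.eval₂ (ι.comp φ) u (LaurentPolynomial.T (-1)) = (u : E)⁻¹ := by
      rw [LaurentPolynomial.eval₂_T, zpow_neg_one, Units.val_inv_eq_inv_val]
    rw [← h2]
    exact congrArg _ (transvection_map _ i j _)
  have h3 := exists_minor_transvection_ne_zero hij (u : E)⁻¹
    (exists_minor_map_ne_zero ι.injective hM)
  rw [shiftClosure, shiftFamily, comap_baseChange_closureIdeal hu, Proj.map_closureIdeal,
    Proj.map_closureIdeal, Gr.act, map_pt _ _ _ _ _ (by rwa [h1]), baseChange_pt]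
  congr 1
  refine pt_congr fun d F _ => ?_
  rw [h1, RingHom.comp_id, eval₂_comp_toLaurent]

/-- A function on the chart over `K[u]` differs from the constant extension of its restriction to
`u = 0` by a multiple of `u`. -/
theorem exists_eq_chartMap_add_scalar_mul (S : Finset (Fin n)) (hS : S.card = k)
    (a : Away (grading K[X] k n) (plucker K[X] S hS)) :
    ∃ b, a = chartMap Polynomial.C S hS
      (chartMap (Polynomial.evalRingHom (0 : K)) S hS a) + scalar S hS Polynomial.X * b := by
  obtain ⟨m, F, hF, rfl⟩ := Away.mk_surjective _ (plucker_mem K[X] S hS) a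
  obtain ⟨G, hG, h⟩ := exists_eq_add_X_mul hF
  refine ⟨Away.mk _ (plucker_mem K[X] S hS) m G hG, ?_⟩
  apply HomogeneousLocalization.val_injective
  rw [chartMap_mk, chartMap_mk, val_add, val_mul, val_scalar, val_mk_eq, val_mk_eq, val_mk_eq,
    ← mul_assoc, ← map_mul, ← add_mul, ← map_add, ← h]

theorem chartMap_evalRingHom_surjective (S : Finset (Fin n)) (hS : S.card = k) :
    Function.Surjective (chartMap (k := k) (n := n) (Polynomial.evalRingHom (0 : K)) S hS) := by
  intro a
  obtain ⟨m, F, hF, rfl⟩ := Away.mk_surjective _ (plucker_mem K S hS) a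
  refine ⟨Away.mk _ (plucker_mem K[X] S hS) m (coordMap k Polynomial.C 1 F)
    (coordMap_mem _ _ hF), ?_⟩
  rw [chartMap_mk]
  congr 1
  have h : (coordMap k (Polynomial.evalRingHom (0 : K))
      (1 : Matrix (Fin n) (Fin n) K)).toRingHom.comp
        (coordMap k Polynomial.C (1 : Matrix (Fin n) (Fin n) K[X])).toRingHom = RingHom.id _ := by
    refine CoordRing.ringHom_ext (fun r => ?_) fun S hS => ?_
    · change coordMap k _ _ (coordMap k _ _ _) = _
      rw [coordMap_algebraMap, coordMap_algebraMap]
      simp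
    · change coordMap k _ _ (coordMap k _ _ _) = _
      rw [coordMap_one_plucker, coordMap_one_plucker]
      rfl
  exact RingHom.congr_fun h F

theorem chartMap_evalRingHom_scalar_X (S : Finset (Fin n)) (hS : S.card = k) :
    chartMap (k := k) (Polynomial.evalRingHom (0 : K)) S hS (scalar S hS Polynomial.X) = 0 := by
  apply HomogeneousLocalization.val_injective
  rw [scalar, chartMap_mk, val_mk_eq, coordMap_algebraMap]
  simp

/-- On standard charts, the fibre over `u = 0` is cut out by the function `u`. -/
theorem ker_chartMap_evalRingHom (S : Finset (Fin n)) (hS : S.card = k) :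
    RingHom.ker (chartMap (k := k) (Polynomial.evalRingHom (0 : K)) S hS) =
      Ideal.span {scalar S hS Polynomial.X} := by
  apply le_antisymm
  · intro a ha
    obtain ⟨b, hb⟩ := exists_eq_chartMap_add_scalar_mul S hS a
    rw [RingHom.mem_ker.mp ha, map_zero, zero_add] at hb
    rw [hb]
    exact Ideal.mul_mem_right _ _ (Ideal.mem_span_singleton_self _)
  · rw [Ideal.span_singleton_le_iff_mem]
    exact chartMap_evalRingHom_scalar_X S hS

end GeomShift

/-! ### The combinatorial shift -/

section Combinatorics

variable {n : ℕ} {i j : Fin n}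

theorem shiftSet_of_mem (hij : i ≠ j) {S : Finset (Fin n)} (hi : i ∈ S) (hj : j ∉ S) :
    shiftSet i j S = insert j (S.erase i) := by
  ext a
  simp only [shiftSet, shiftElt, Finset.mem_image, Finset.mem_insert, Finset.mem_erase]
  constructor
  · rintro ⟨m, hm, rfl⟩
    by_cases h : m = i
    · simp [h, hj]
    · simp [h, hm]
  · rintro (rfl | ⟨h1, h2⟩)
    · exact ⟨i, hi, by simp [hj]⟩
    · exact ⟨a, h2, by simp [h1, h2]⟩

theorem shiftSet_eq_self {S : Finset (Fin n)} (h : ¬(i ∈ S ∧ j ∉ S)) : shiftSet i j S = S := by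
  have h1 : ∀ m ∈ S, (if shiftElt i j m ∈ S then m else shiftElt i j m) = m := by
    intro m hm
    by_cases hmi : m = i
    · subst hmi
      have : j ∈ S := by
        by_contra hj
        exact h ⟨hm, hj⟩
      simp [shiftElt, this]
    · simp [shiftElt, hmi]
  rw [shiftSet, Finset.image_congr h1, Finset.image_id']

theorem mem_shiftColl_iff_of_mem (hij : i ≠ j) {C : Set (Finset (Fin n))} {T : Finset (Fin n)}
    (hi : i ∈ T) (hj : j ∉ T) : T ∈ shiftColl i j C ↔ T ∈ C ∧ insert j (T.erase i) ∈ C := by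
  classical
  constructor
  · rintro ⟨S, hS, rfl⟩
    dsimp only at hi hj ⊢
    split_ifs at hi hj ⊢ with h
    · rw [shiftSet_of_mem hij hi hj] at h
      exact ⟨hS, h⟩
    · by_cases h1 : i ∈ S ∧ j ∉ S
      · rw [shiftSet_of_mem hij h1.1 h1.2] at hj
        simp at hj
      · rw [shiftSet_eq_self h1] at h
        exact absurd hS h
  · rintro ⟨h1, h2⟩
    refine ⟨T, h1, ?_⟩
    dsimp only
    rw [if_pos (by rwa [shiftSet_of_mem hij hi hj])]

theorem mem_shiftColl_iff_of_notMem (hij : i ≠ j) {C : Set (Finset (Fin n))} {T : Finset (Fin n)}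
    (hj : j ∈ T) (hi : i ∉ T) : T ∈ shiftColl i j C ↔ T ∈ C ∨ insert i (T.erase j) ∈ C := by
  classical
  constructor
  · rintro ⟨S, hS, rfl⟩
    dsimp only at hi hj ⊢
    split_ifs at hi hj ⊢ with h
    · exact Or.inl hS
    · by_cases h1 : i ∈ S ∧ j ∉ S
      · right
        rw [shiftSet_of_mem hij h1.1 h1.2, Finset.erase_insert (by simp [h1.2]),
          Finset.insert_erase h1.1]
        exact hS
      · rw [shiftSet_eq_self h1] at h
        exact absurd hS h
  · intro h
    by_cases h1 : T ∈ C
    · refine ⟨T, h1, ?_⟩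
      dsimp only
      rw [shiftSet_eq_self (by simp [hi]), if_pos h1]
    · refine ⟨_, h.resolve_left h1, ?_⟩
      dsimp only
      rw [shiftSet_of_mem hij (Finset.mem_insert_self _ _) (by simp [hij.symm]),
        Finset.erase_insert (by simp [hi]), Finset.insert_erase hj, if_neg h1]

theorem mem_shiftColl_iff_of_iff (hij : i ≠ j) {C : Set (Finset (Fin n))} {T : Finset (Fin n)}
    (h : i ∈ T ↔ j ∈ T) : T ∈ shiftColl i j C ↔ T ∈ C := by
  classical
  have hT : ¬(i ∈ T ∧ j ∉ T) := fun h1 => h1.2 (h.mp h1.1)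
  constructor
  · rintro ⟨S, hS, rfl⟩
    dsimp only at h hT ⊢
    split_ifs at h hT ⊢ with h2
    · exact hS
    · by_cases h1 : i ∈ S ∧ j ∉ S
      · rw [shiftSet_of_mem hij h1.1 h1.2] at h
        simp [hij] at h
      · rw [shiftSet_eq_self h1]
        exact hS
  · intro h1
    refine ⟨T, h1, ?_⟩
    dsimp only
    rw [shiftSet_eq_self hT, if_pos h1]

end Combinatorics

/-! ### The Plücker coordinates that vanish on the geometric shift -/

section Vanishing

open HomogeneousLocalization

variable {K : Type u} [Field K] {k n : ℕ} {L E : Type u} [Field L] [Field E]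

theorem pluckerDivisor_le {T : Finset (Fin n)} {hT : T.card = k} {X : (Gr K k n).IdealSheafData}
    (h : ∀ (Q : Finset (Fin n)) (hQ : Q.card = k),
      Away.mk _ (plucker_mem K Q hQ) 1 (plucker K T hT) (by simpa using plucker_mem K T hT) ∈
        Proj.chartIdeal X (plucker_mem K Q hQ)) : pluckerDivisor K T hT ≤ X :=
  sInf_le h

variable {φ : K →+* L} {M : Matrix (Fin k) (Fin n) L}
  {hM : ∃ (S : Finset (Fin n)) (hS : S.card = k), minor M S hS ≠ 0}
  {ι : L →+* E} {u : Eˣ} {i j : Fin n}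

/-- On standard charts, the ideal of the geometric shift is the restriction to `u = 0` of the ideal
of functions that vanish at the generic point of the family. -/
theorem chartIdeal_geomShift (hu : ∀ p : L[X], p.eval₂ ι u = 0 → p = 0) (hij : i ≠ j)
    (S : Finset (Fin n)) (hS : S.card = k) :
    Proj.chartIdeal (geomShift hij (Proj.closureIdeal (pt φ M hM))) (plucker_mem K S hS) =
      (Proj.chartIdeal (Proj.closureIdeal (pt (Polynomial.eval₂RingHom (ι.comp φ) (u : E))
        (M.map ι * Matrix.transvection i j (u : E)⁻¹)
        (exists_minor_transvection_ne_zero hij _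
          (exists_minor_map_ne_zero ι.injective hM)))) (plucker_mem K[X] S hS)).map
        (chartMap (Polynomial.evalRingHom (0 : K)) S hS) := by
  rw [geomShift, shiftClosure_closureIdeal hu, chartIdeal_comap_baseChange]

/-- The linear form `p_T` vanishes on the geometric shift if it is the value at `u = 0` of a linear
form over `K[u]` that vanishes on the family. -/
theorem pluckerDivisor_le_geomShift_of_form (hu : ∀ p : L[X], p.eval₂ ι u = 0 → p = 0)
    (hij : i ≠ j) {T : Finset (Fin n)} {hT : T.card = k} {F : CoordRing K[X] k n}
    (hF : F ∈ grading K[X] k n 1)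
    (hF0 : ev (Polynomial.eval₂RingHom (ι.comp φ) (u : E))
      (M.map ι * Matrix.transvection i j (u : E)⁻¹) F = 0)
    (hFT : coordMap k (Polynomial.evalRingHom (0 : K)) 1 F = plucker K T hT) :
    pluckerDivisor K T hT ≤ geomShift hij (Proj.closureIdeal (pt φ M hM)) := by
  refine pluckerDivisor_le fun Q hQ => ?_
  rw [chartIdeal_geomShift hu]
  have h1 : Away.mk _ (plucker_mem K[X] Q hQ) 1 F (by simpa using hF) ∈
      Proj.chartIdeal (Proj.closureIdeal (pt (Polynomial.eval₂RingHom (ι.comp φ) (u : E))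
        (M.map ι * Matrix.transvection i j (u : E)⁻¹)
        (exists_minor_transvection_ne_zero hij _
          (exists_minor_map_ne_zero ι.injective hM)))) (plucker_mem K[X] Q hQ) :=
    (Proj.mk_mem_chartIdeal_closureIdeal _ _ _ _).mpr (Or.inr ((mem_pt_iff _ _ _ hF).mpr hF0))
  have h2 := Ideal.mem_map_of_mem (chartMap (Polynomial.evalRingHom (0 : K)) Q hQ) h1
  rw [chartMap_mk] at h2
  convert h2 using 1
  congr 1
  exact hFT.symm

/-- The geometric shift is contained in the coordinate subscheme of the shifted collection: for `T`
outside the shifted collection, some form over `K[u]` that vanishes on the family restricts to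
`p_T` at `u = 0`. -/
theorem coord_shiftColl_le_geomShift (hu : ∀ p : L[X], p.eval₂ ι u = 0 → p = 0)
    (hij : i ≠ j) {C : Set (Finset (Fin n))}
    (hC : ∀ (S : Finset (Fin n)) (hS : S.card = k), S ∈ C ↔ minor M S hS ≠ 0) :
    coord K k (shiftColl i j C) ≤ geomShift hij (Proj.closureIdeal (pt φ M hM)) := by
  refine iSup_le fun T => iSup_le fun hT => iSup_le fun hTC => ?_
  set N := M.map ι * Matrix.transvection i j (u : E)⁻¹ with hN
  have h0 : ∀ (S : Finset (Fin n)) (hS : S.card = k), S ∉ C → minor (M.map ι) S hS = 0 := by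
    intro S hS h
    rw [hC S hS, not_not] at h
    rw [minor_map, h, map_zero]
  have hmain : minor N T hT = 0 →
      pluckerDivisor K T hT ≤ geomShift hij (Proj.closureIdeal (pt φ M hM)) := fun h =>
    pluckerDivisor_le_geomShift_of_form hu hij (plucker_mem K[X] T hT)
      (by rw [ev_plucker]; exact h) (coordMap_one_plucker _ T hT)
  by_cases hi : i ∈ T
  · have h1 : minor N T hT = minor (M.map ι) T hT :=
      minor_mul_transvection_of_mem _ hij _ T hT hi
    by_cases hj : j ∈ T
    · rw [mem_shiftColl_iff_of_iff hij (by simp [hi, hj])] at hTC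
      exact hmain (h1.trans (h0 T hT hTC))
    · rw [mem_shiftColl_iff_of_mem hij hi hj] at hTC
      by_cases hT1 : T ∈ C
      · have hT2 : insert j (T.erase i) ∉ C := fun h => hTC ⟨hT1, h⟩
        have hcard := card_exchange (i := j) (j := i) hT hi hj
        have hi' : i ∉ insert j (T.erase i) := by simp [hij]
        have hback : insert i ((insert j (T.erase i)).erase j) = T := by
          rw [Finset.erase_insert (by simp [hj]), Finset.insert_erase hi]
        obtain ⟨ε, hε⟩ := exists_exchange_sign (i := i) (j := j) _ hcard
          (Finset.mem_insert_self _ _) hi'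
        have h2 := hε (M.map ι) (u : E)⁻¹
        rw [h0 _ hcard hT2, zero_add] at h2
        simp only [hback] at h2
        -- The coordinate of `T` with `i` exchanged for `j` vanishes at `M`, so at `N` it is
        -- `± u⁻¹ p_T`; clearing the denominator gives the form.
        refine pluckerDivisor_le_geomShift_of_form hu hij
          (F := plucker K[X] T hT - algebraMap K[X] _ (((ε : ℤ) : K[X]) * Polynomial.X) *
            plucker K[X] _ hcard) (sub_mem (plucker_mem _ _ _) ?_) ?_ ?_
        · rw [← Algebra.smul_def]
          exact Submodule.smul_mem _ _ (plucker_mem _ _ _)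
        · rw [map_sub, map_mul, ev_plucker, ev_plucker, evalCone_algebraMap, ← hN, h1, hN, h2]
          have h3 : ((ε : ℤ) : E) * ((ε : ℤ) : E) = 1 := by
            rcases Int.units_eq_one_or ε with h | h <;> simp [h]
          have h4 : (u : E) * (u : E)⁻¹ = 1 := mul_inv_cancel₀ u.ne_zero
          simp only [map_mul, map_intCast, Polynomial.coe_eval₂RingHom, Polynomial.eval₂_X]
          linear_combination (-((ε : ℤ) : E) * ((ε : ℤ) : E) * minor (M.map ι) T hT) * h4 -
            minor (M.map ι) T hT * h3
        · rw [map_sub, map_mul, coordMap_one_plucker, coordMap_algebraMap]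
          simp
      · exact hmain (h1.trans (h0 T hT hT1))
  · by_cases hj : j ∈ T
    · rw [mem_shiftColl_iff_of_notMem hij hj hi, not_or] at hTC
      obtain ⟨ε, hε⟩ := exists_exchange_sign (i := i) (j := j) T hT hj hi
      refine hmain ((hε (M.map ι) (u : E)⁻¹).trans ?_)
      rw [h0 T hT hTC.1, h0 _ _ hTC.2, mul_zero, mul_zero, add_zero]
    · rw [mem_shiftColl_iff_of_iff hij (by simp [hi, hj])] at hTC
      exact hmain ((minor_mul_transvection_of_notMem _ i j _ T hT hj).trans (h0 T hT hTC))

end Vanishing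

/-! ### The charts on which the geometric shift is nonempty -/

section Nonempty

open HomogeneousLocalization

variable {K : Type u} [Field K] {k n : ℕ} {L E : Type u} [Field L] [Field E]
  {φ : K →+* L} {M : Matrix (Fin k) (Fin n) L}
  {hM : ∃ (S : Finset (Fin n)) (hS : S.card = k), minor M S hS ≠ 0}
  {ι : L →+* E} {u : Eˣ} {i j : Fin n}

/-- If the geometric shift does not meet the chart `p_S ≠ 0`, then some form over `K[u]` that
vanishes on the family restricts to a power of `p_S` at `u = 0`. -/
theorem exists_form_of_chartIdeal_geomShift_eq_top
    (hu : ∀ p : L[X], p.eval₂ ι u = 0 → p = 0) (hij : i ≠ j)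
    (S : Finset (Fin n)) (hS : S.card = k)
    (h : Proj.chartIdeal (geomShift hij (Proj.closureIdeal (pt φ M hM))) (plucker_mem K S hS) =
      ⊤) :
    ∃ (d : ℕ), ∃ F ∈ grading K[X] k n d, ev (Polynomial.eval₂RingHom (ι.comp φ) (u : E))
      (M.map ι * Matrix.transvection i j (u : E)⁻¹) F = 0 ∧
      coordMap k (Polynomial.evalRingHom (0 : K)) 1 F = plucker K S hS ^ d := by
  rw [chartIdeal_geomShift hu, Ideal.eq_top_iff_one,
    Ideal.mem_map_iff_of_surjective _ (chartMap_evalRingHom_surjective S hS)] at h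
  obtain ⟨a, ha, ha1⟩ := h
  obtain ⟨m, F, hF, rfl⟩ := Away.mk_surjective _ (plucker_mem K[X] S hS) a
  rw [Proj.mk_mem_chartIdeal_closureIdeal, mem_pt_iff _ _ _ hF, plucker_mem_pt_iff] at ha
  rcases ha with ha | ha
  · exact ⟨1, plucker K[X] S hS, plucker_mem _ _ _, by rwa [ev_plucker],
      by rw [coordMap_one_plucker, pow_one]⟩
  · rw [chartMap_mk] at ha1
    replace ha1 := congrArg HomogeneousLocalization.val ha1
    rw [Away.val_mk, val_one, ← Localization.mk_one, Localization.mk_eq_mk_iff,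
      Localization.r_iff_exists] at ha1
    obtain ⟨⟨_, e, rfl⟩, hc⟩ := ha1
    refine ⟨e + m, plucker K[X] S hS ^ e * F, ?_, ?_, ?_⟩
    · have h1 := SetLike.pow_mem_graded e (plucker_mem K[X] S hS)
      rw [smul_eq_mul, mul_one] at h1
      have h2 := SetLike.mul_mem_graded h1 hF
      rwa [smul_eq_mul, mul_one] at h2
    · rw [map_mul, ha, mul_zero]
    · rw [map_mul, map_pow, coordMap_one_plucker, pow_add]
      simpa using hc

/-- A criterion for the geometric shift to meet the chart `p_S ≠ 0`: an arc `s ↦ (M(s), u(s))` in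
the closure of the family, with `u(0) = 0`, whose limit satisfies `p_S ≠ 0`. The arc consists of
the torus translates `M(s) = M diag (s ^ w)`, and `c` is a rescaling of the Plücker coordinates that
makes them regular at `s = 0`. -/
theorem chartIdeal_geomShift_ne_top_of_arc (hu : ∀ p : L[X], p.eval₂ ι u = 0 → p = 0)
    (hij : i ≠ j) (hX : TInvariant (Proj.closureIdeal (pt φ M hM)))
    {E' : Type u} [Field E'] {ι' : L[X] →+* E'} (hinj : Function.Injective ι')
    (S : Finset (Fin n)) (hS : S.card = k) (w : Fin n → ℕ) (u' : E'ˣ) (c : E') (v p : L[X])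
    (hu' : (u' : E') = ι' (Polynomial.X * v))
    (hc : ∀ (T : Finset (Fin n)) (hT : T.card = k),
      c * minor (M.map (ι'.comp Polynomial.C) *
        Matrix.diagonal (fun a => ι' Polynomial.X ^ w a) *
        Matrix.transvection i j (u' : E')⁻¹) T hT ∈ ι'.range)
    (hp : c * minor (M.map (ι'.comp Polynomial.C) *
        Matrix.diagonal (fun a => ι' Polynomial.X ^ w a) *
        Matrix.transvection i j (u' : E')⁻¹) S hS = ι' p)
    (hp0 : p.eval 0 ≠ 0) :
    Proj.chartIdeal (geomShift hij (Proj.closureIdeal (pt φ M hM))) (plucker_mem K S hS) ≠ ⊤ := by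
  intro htop
  obtain ⟨d, F, hF, hF0, hFS⟩ := exists_form_of_chartIdeal_geomShift_eq_top hu hij S hS htop
  have hjinj : Function.Injective (ι'.comp Polynomial.C) := hinj.comp Polynomial.C_injective
  set M' := M.map (ι'.comp Polynomial.C) * Matrix.diagonal (fun a => ι' Polynomial.X ^ w a)
    with hM'
  have ht : ∀ a, ι' Polynomial.X ^ w a ≠ 0 := fun a =>
    pow_ne_zero _ (by rw [Ne, map_eq_zero_iff _ hinj]; exact Polynomial.X_ne_zero)
  have hsp : ∀ d, ∀ F ∈ grading K k n d, ev φ M F = 0 →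
      ev ((ι'.comp Polynomial.C).comp φ) M' F = 0 := by
    have h1 := hX.pt_mul_diagonal_mem_support ((ι'.comp Polynomial.C).comp φ) _
      (exists_minor_map_ne_zero hjinj hM) ht (by
        rw [pt_map φ M _ hjinj hM]
        exact Proj.mem_support_closureIdeal.mpr le_rfl)
    rw [Proj.mem_support_closureIdeal] at h1
    exact pt_le_pt_iff.mp h1
  have h2 := ev_transvection_eq_zero_of_specialization hu hsp u' hij hF hF0
  obtain ⟨G, hG, hFG⟩ := exists_eq_add_X_mul hF
  rw [hFS, map_pow, coordMap_one_plucker] at hFG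
  obtain ⟨g, hg⟩ := ev_mem_subring (Polynomial.eval₂RingHom ((ι'.comp Polynomial.C).comp φ)
    (u' : E')) (M' * Matrix.transvection i j (u' : E')⁻¹) c ι'.range (fun r => by
      refine ⟨r.eval₂ (Polynomial.C.comp φ) (Polynomial.X * v), ?_⟩
      rw [Polynomial.hom_eval₂, ← hu']
      rfl) hc hG
  have h3 : (p ^ d + Polynomial.X * v * g) = 0 := by
    apply hinj
    rw [map_add, map_mul, map_pow, hg, ← hp, ← hu', map_zero, mul_pow]
    rw [hFG, map_add, map_pow, map_mul, ev_plucker, evalCone_algebraMap,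
      Polynomial.coe_eval₂RingHom, Polynomial.eval₂_X] at h2
    linear_combination c ^ d * h2
  have h4 := congrArg (Polynomial.eval (0 : L)) h3
  simp only [Polynomial.eval_add, Polynomial.eval_pow, Polynomial.eval_mul, Polynomial.eval_X,
    zero_mul, add_zero, Polynomial.eval_zero] at h4
  exact pow_ne_zero d hp0 h4

theorem minor_mul_diagonal_pow (s : E) (w : Fin n → ℕ) (T : Finset (Fin n)) (hT : T.card = k)
    (M : Matrix (Fin k) (Fin n) E) :
    minor (M * Matrix.diagonal fun a => s ^ w a) T hT = s ^ (∑ a ∈ T, w a) * minor M T hT := by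
  rw [minor_mul_diagonal, Finset.prod_pow_eq_pow_sum]

/-- The geometric shift meets the chart `p_S ≠ 0` for every `S` in the shifted collection. -/
theorem chartIdeal_geomShift_ne_top (hu : ∀ p : L[X], p.eval₂ ι u = 0 → p = 0)
    (hij : i ≠ j) (hX : TInvariant (Proj.closureIdeal (pt φ M hM))) {C : Set (Finset (Fin n))}
    (hC : ∀ (S : Finset (Fin n)) (hS : S.card = k), S ∈ C ↔ minor M S hS ≠ 0)
    {S : Finset (Fin n)} (hS : S.card = k) (hSC : S ∈ shiftColl i j C) :
    Proj.chartIdeal (geomShift hij (Proj.closureIdeal (pt φ M hM))) (plucker_mem K S hS) ≠ ⊤ := by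
  let ι' : L[X] →+* FractionRing L[X] := algebraMap _ _
  have hinj : Function.Injective ι' := IsFractionRing.injective _ _
  set s : FractionRing L[X] := ι' Polynomial.X with hs
  have hs0 : s ≠ 0 := by
    rw [hs, Ne, map_eq_zero_iff _ hinj]
    exact Polynomial.X_ne_zero
  let κ : L →+* FractionRing L[X] := ι'.comp Polynomial.C
  have hminor : ∀ (w : Fin n → ℕ) (T : Finset (Fin n)) (hT : T.card = k),
      minor (M.map κ * Matrix.diagonal fun a => s ^ w a) T hT =
        ι' (Polynomial.X ^ (∑ a ∈ T, w a) * Polynomial.C (minor M T hT)) := by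
    intro w T hT
    rw [minor_mul_diagonal_pow, minor_map, map_mul, map_pow]
    rfl
  by_cases hcase : i ∈ S ∧ j ∉ S
  · -- The weights are `1` at `j`, `0` on `S \ {i}` and `2` elsewhere, and `u(s)` is the multiple of
    -- `s` for which the one remaining pole, of `p_T` with `T = S \ {i} ∪ {j}`, cancels.
    obtain ⟨hi, hj⟩ := hcase
    rw [mem_shiftColl_iff_of_mem hij hi hj] at hSC
    have hcard := card_exchange (i := j) (j := i) hS hi hj
    have ha : minor M S hS ≠ 0 := (hC S hS).mp hSC.1
    have hb : minor M _ hcard ≠ 0 := (hC _ hcard).mp hSC.2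
    have hback : insert i ((insert j (S.erase i)).erase j) = S := by
      rw [Finset.erase_insert (by simp [hj]), Finset.insert_erase hi]
    obtain ⟨ε, hε⟩ := exists_exchange_sign (i := i) (j := j) _ hcard
      (Finset.mem_insert_self _ _) (by simp [hij])
    have hε2 : ((ε : ℤ) : L) * ((ε : ℤ) : L) = 1 := by
      rcases Int.units_eq_one_or ε with h | h <;> simp [h]
    have hε0 : ((ε : ℤ) : L) ≠ 0 := fun h => by simp [h] at hε2
    set q : L := -((ε : ℤ) : L) * minor M _ hcard / minor M S hS with hq
    have hq0 : q ≠ 0 := div_ne_zero (mul_ne_zero (neg_ne_zero.mpr hε0) hb) ha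
    have hqa : q * (((ε : ℤ) : L) * minor M S hS) = -minor M _ hcard := by
      rw [hq, div_mul_eq_mul_div, div_eq_iff ha]
      linear_combination (-minor M _ hcard * minor M S hS) * hε2
    let u' : (FractionRing L[X])ˣ := Units.mk0 (s * ι' (Polynomial.C q⁻¹))
      (mul_ne_zero hs0 (by
        rw [Ne, map_eq_zero_iff _ hinj, Polynomial.C_eq_zero]
        exact inv_ne_zero hq0))
    have hu'inv : (u' : FractionRing L[X])⁻¹ = s⁻¹ * ι' (Polynomial.C q) := by
      change (s * ι' (Polynomial.C q⁻¹))⁻¹ = _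
      have h1 : ι' (Polynomial.C q⁻¹) * ι' (Polynomial.C q) = 1 := by
        rw [← map_mul, ← Polynomial.C_mul, inv_mul_cancel₀ hq0, Polynomial.C_1, map_one]
      rw [mul_inv, eq_inv_of_mul_eq_one_left h1, inv_inv]
    let w : Fin n → ℕ := fun a => if a ∈ S.erase i then 0 else if a = j then 1 else 2
    have hwi : w i = 2 := by simp [w, hij]
    have hwj : w j = 1 := by simp [w, hj]
    have hw0 : ∑ a ∈ S.erase i, w a = 0 := Finset.sum_eq_zero fun a ha => if_pos ha
    have hwS : ∑ a ∈ S, w a = 2 := by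
      rw [← Finset.add_sum_erase S w hi, hw0, hwi]
    have hw2 : ∀ T : Finset (Fin n), T.card = k → T ≠ insert j (S.erase i) →
        ∃ l, ∑ a ∈ T, w a = l + 2 := by
      intro T hT hne
      obtain ⟨a, haT, ha⟩ : ∃ a ∈ T, a ∉ insert j (S.erase i) := by
        by_contra! hsub
        exact hne (Finset.eq_of_subset_of_card_le hsub (by rw [hcard, hT]))
      have hwa : w a = 2 := by
        rw [Finset.mem_insert, not_or] at ha
        simp only [w]
        rw [if_neg ha.2, if_neg ha.1]
      have h1 := Finset.single_le_sum (f := w) (fun _ _ => Nat.zero_le _) haT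
      exact ⟨∑ a ∈ T, w a - 2, by omega⟩
    have hsimple : ∀ (T : Finset (Fin n)) (hT : T.card = k), T ≠ insert j (S.erase i) →
        (s ^ 2)⁻¹ * ι' (Polynomial.X ^ (∑ a ∈ T, w a) * Polynomial.C (minor M T hT)) ∈
          ι'.range := by
      intro T hT hne
      obtain ⟨l, hl⟩ := hw2 T hT hne
      refine ⟨Polynomial.X ^ l * Polynomial.C (minor M T hT), ?_⟩
      rw [hl, map_mul, map_mul, map_pow, map_pow, ← hs]
      field_simp
      ring
    refine chartIdeal_geomShift_ne_top_of_arc hu hij hX hinj S hS w u' (s ^ 2)⁻¹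
      (Polynomial.C q⁻¹) (Polynomial.C (minor M S hS)) (by rw [map_mul]; rfl) ?_ ?_
      (by rwa [Polynomial.eval_C])
    · intro T hT
      change (s ^ 2)⁻¹ * minor (M.map κ * (Matrix.diagonal fun a => s ^ w a) *
        Matrix.transvection i j (u' : FractionRing L[X])⁻¹) T hT ∈ _
      by_cases hiT : i ∈ T
      · rw [minor_mul_transvection_of_mem _ hij _ T hT hiT, hminor]
        exact hsimple T hT fun h => by simp [h, hij] at hiT
      by_cases hjT : j ∈ T
      · by_cases hTS : T = insert j (S.erase i)
        · subst hTS
          have h1 := hε (M.map κ * Matrix.diagonal fun a => s ^ w a) (u' : FractionRing L[X])⁻¹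
          simp only [hback] at h1
          rw [h1, hminor, hminor, hwS, Finset.sum_insert (by simp [hj]), hw0, hwj, hu'inv]
          refine ⟨0, ?_⟩
          have h2 := congrArg (fun x => ι' (Polynomial.C x)) hqa
          simp only [map_mul, map_neg, map_intCast] at h2
          simp only [map_mul, map_pow, map_zero, ← hs]
          have h3 : s⁻¹ * s = 1 := inv_mul_cancel₀ hs0
          linear_combination (-(s ^ 2)⁻¹ * s * (s⁻¹ * s)) * h2 +
            (s ^ 2)⁻¹ * s * ι' (Polynomial.C (minor M _ hcard)) * h3
        · obtain ⟨ε', hε'⟩ := exists_exchange_sign (i := i) (j := j) T hT hjT hiT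
          obtain ⟨l, hl⟩ := hw2 T hT hTS
          have hl' : ∑ a ∈ insert i (T.erase j), w a = l + 3 := by
            have h1 := Finset.add_sum_erase T w hjT
            rw [hwj, hl] at h1
            rw [Finset.sum_insert (fun h => hiT (Finset.mem_of_mem_erase h)), hwi]
            omega
          rw [hε', hminor, hminor, hl, hl', hu'inv]
          refine ⟨Polynomial.X ^ l * Polynomial.C (minor M T hT) + Polynomial.C q *
            (((ε' : ℤ) : L[X]) * (Polynomial.X ^ l * Polynomial.C (minor M _
            (card_exchange hT hjT hiT)))), ?_⟩
          simp only [map_add, map_mul, map_pow, map_intCast, ← hs]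
          field_simp
          ring
      · rw [minor_mul_transvection_of_notMem _ i j _ T hT hjT, hminor]
        exact hsimple T hT fun h => by simp [h] at hjT
    · change (s ^ 2)⁻¹ * minor (M.map κ * (Matrix.diagonal fun a => s ^ w a) *
        Matrix.transvection i j (u' : FractionRing L[X])⁻¹) S hS = _
      rw [minor_mul_transvection_of_mem _ hij _ S hS hi, hminor, hwS, map_mul, map_pow, ← hs]
      field_simp
  · -- The coordinates outside `S` get the positive weight `e`, and `u(s) = s`.
    have key : ∀ e : ℕ, 0 < e → ∀ p : L[X],
        minor (M.map κ * (Matrix.diagonal fun a => s ^ (if a ∈ S then 0 else e)) *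
          Matrix.transvection i j s⁻¹) S hS = ι' p → p.eval 0 ≠ 0 →
        Proj.chartIdeal (geomShift hij (Proj.closureIdeal (pt φ M hM))) (plucker_mem K S hS) ≠
          ⊤ := by
      intro e he p hp hp0
      refine chartIdeal_geomShift_ne_top_of_arc hu hij hX hinj S hS
        (fun a => if a ∈ S then 0 else e) (Units.mk0 s hs0) 1 1 p (by simp [hs]) ?_
        (by rw [one_mul]; exact hp) hp0
      intro T hT
      rw [one_mul]
      change minor (M.map κ * (Matrix.diagonal fun a => s ^ (if a ∈ S then 0 else e)) *
          Matrix.transvection i j s⁻¹) T hT ∈ _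
      by_cases hiT : i ∈ T
      · rw [minor_mul_transvection_of_mem _ hij _ T hT hiT, hminor]
        exact ⟨_, rfl⟩
      by_cases hjT : j ∈ T
      · obtain ⟨ε, hε⟩ := exists_exchange_sign (i := i) (j := j) T hT hjT hiT
        rw [hε, hminor, hminor]
        have hpos : 0 < ∑ a ∈ insert i (T.erase j), if a ∈ S then 0 else e := by
          obtain ⟨a, ha, haS⟩ : ∃ a ∈ insert i (T.erase j), a ∉ S := by
            by_contra! hsub
            have heq : insert i (T.erase j) = S := Finset.eq_of_subset_of_card_le hsub
              (by rw [card_exchange hT hjT hiT, hS])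
            exact hcase ⟨heq ▸ Finset.mem_insert_self _ _, by
              rw [← heq]; simp [hij.symm]⟩
          refine Finset.sum_pos' (fun _ _ => Nat.zero_le _) ⟨a, ha, ?_⟩
          rwa [if_neg haS]
        obtain ⟨l, hl⟩ : ∃ l, (∑ a ∈ insert i (T.erase j), if a ∈ S then 0 else e) = l + 1 :=
          ⟨_, (Nat.succ_pred_eq_of_pos hpos).symm⟩
        rw [hl]
        refine ⟨Polynomial.X ^ (∑ a ∈ T, if a ∈ S then 0 else e) * Polynomial.C (minor M T hT) +
          ((ε : ℤ) : L[X]) * (Polynomial.X ^ l * Polynomial.C (minor M _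
            (card_exchange hT hjT hiT))), ?_⟩
        simp only [map_add, map_mul, map_pow, map_intCast, ← hs]
        field_simp
        ring
      · rw [minor_mul_transvection_of_notMem _ i j _ T hT hjT, hminor]
        exact ⟨_, rfl⟩
    have hwS' : ∀ e : ℕ, (∑ a ∈ S, if a ∈ S then 0 else e) = 0 := fun e =>
      Finset.sum_eq_zero fun a ha => if_pos ha
    by_cases hiS : i ∈ S
    · have hjS : j ∈ S := by
        by_contra hjS
        exact hcase ⟨hiS, hjS⟩
      rw [mem_shiftColl_iff_of_iff hij (by simp [hiS, hjS]), hC S hS] at hSC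
      refine key 1 one_pos _ ((minor_mul_transvection_of_mem _ hij _ S hS hiS).trans
        (hminor _ S hS)) ?_
      rw [hwS']
      simpa using hSC
    by_cases hjS : j ∈ S
    · rw [mem_shiftColl_iff_of_notMem hij hjS hiS] at hSC
      obtain ⟨ε, hε⟩ := exists_exchange_sign (i := i) (j := j) S hS hjS hiS
      have hw : ∀ e : ℕ, (∑ a ∈ insert i (S.erase j), if a ∈ S then 0 else e) = e := by
        intro e
        rw [Finset.sum_insert (by simp [hiS]), if_neg hiS, Finset.sum_eq_zero, add_zero]
        exact fun a ha => if_pos (Finset.mem_of_mem_erase ha)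
      have hval : ∀ l : ℕ, minor (M.map κ * (Matrix.diagonal fun a =>
          s ^ (if a ∈ S then 0 else l + 1)) * Matrix.transvection i j s⁻¹) S hS =
          ι' (Polynomial.C (minor M S hS) + ((ε : ℤ) : L[X]) * (Polynomial.X ^ l *
            Polynomial.C (minor M _ (card_exchange hS hjS hiS)))) := by
        intro l
        rw [hε, hminor, hminor, hw, hwS']
        simp only [map_add, map_mul, map_pow, map_intCast, ← hs]
        field_simp
        ring
      by_cases h1 : S ∈ C
      · refine key 2 two_pos _ (hval 1) ?_
        simpa using (hC S hS).mp h1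
      · refine key 1 one_pos _ (hval 0) ?_
        have h2 := (hC _ (card_exchange hS hjS hiS)).mp (hSC.resolve_left h1)
        rw [hC S hS, not_not] at h1
        rcases Int.units_eq_one_or ε with h | h <;> simpa [h, h1] using h2
    · rw [mem_shiftColl_iff_of_iff hij (by simp [hiS, hjS]), hC S hS] at hSC
      refine key 1 one_pos _ ((minor_mul_transvection_of_notMem _ i j _ S hS hjS).trans
        (hminor _ S hS)) ?_
      rw [hwS']
      simpa using hSC

end Nonempty

/-! ### The divisors `{p_S = 0}` -/

open HomogeneousLocalization TopologicalSpace

instance CoordRing.finiteType (R : Type u) [CommRing R] (k n : ℕ) :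
    Algebra.FiniteType R (CoordRing R k n) := by
  have hfin : {F : CoordRing R k n | ∃ (S : Finset (Fin n)) (hS : S.card = k),
      F = plucker R S hS}.Finite := by
    refine (Set.finite_range fun S : {S : Finset (Fin n) // S.card = k} =>
      plucker R S.1 S.2).subset ?_
    rintro _ ⟨S, hS, rfl⟩
    exact ⟨⟨S, hS⟩, rfl⟩
  exact ⟨⟨hfin.toFinset, by rw [hfin.coe_toFinset, adjoin_plucker]⟩⟩

variable {K : Type u} [Field K] {k n : ℕ}

theorem isNoetherianRing_away {F : CoordRing K k n} (hF : F ∈ grading K k n 1) :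
    IsNoetherianRing (Away (grading K k n) F) := by
  have h1 : IsNoetherianRing (CoordRing K k n) := Algebra.FiniteType.isNoetherianRing K _
  have h2 : IsNoetherianRing (grading K k n 0) :=
    GradedRing.GradeZero.isNoetherianRing (grading K k n)
  have : IsScalarTower K (grading K k n 0) (CoordRing K k n) :=
    ⟨fun r a b => smul_mul_assoc r (a : CoordRing K k n) b⟩
  have h3 : Algebra.FiniteType (grading K k n 0) (CoordRing K k n) :=
    .of_restrictScalars_finiteType K _ _
  have h4 := Away.finiteType F 1 hF
  exact Algebra.FiniteType.isNoetherianRing (grading K k n 0) _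

theorem _root_.AlgebraicGeometry.Scheme.IdealSheafData.vanishingIdeal_ideal_le_radical
    {X : Scheme.{u}} (Z : Closeds X) (U : X.affineOpens) (g : Γ(X, U))
    (h : ∀ x ∈ U.1, x ∉ X.basicOpen g → x ∈ Z) :
    (Scheme.IdealSheafData.vanishingIdeal Z).ideal U ≤ (Ideal.span {g}).radical := by
  intro f hf
  rw [Scheme.IdealSheafData.mem_vanishingIdeal_iff] at hf
  rw [Ideal.radical_eq_sInf, Submodule.mem_sInf]
  rintro P ⟨hP, hPp⟩
  have h1 : ∀ a : Γ(X, U), U.2.fromSpec ⟨P, hPp⟩ ∈ X.basicOpen a ↔ a ∉ P := by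
    intro a
    change (⟨P, hPp⟩ : Spec Γ(X, U)) ∈ U.2.fromSpec ⁻¹ᵁ X.basicOpen a ↔ _
    rw [U.2.fromSpec_preimage_basicOpen a]
    rfl
  have hU : U.2.fromSpec ⟨P, hPp⟩ ∈ U.1 := by
    have : U.2.fromSpec ⟨P, hPp⟩ ∈ Set.range U.2.fromSpec := ⟨_, rfl⟩
    rwa [U.2.range_fromSpec] at this
  have hg : g ∈ P := hP (Ideal.mem_span_singleton_self g)
  exact not_not.mp fun hn => hf _ (h _ hU fun hn' => (h1 g).mp hn' hg) hU ((h1 f).mpr hn)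

/-- The scheme `{p_S = 0}` has no points outside the set of zeros of `p_S`: since the
Grassmannian is noetherian, a power of the ideal sheaf of that set is contained in every ideal sheaf
that contains `p_S`. -/
theorem plucker_mem_of_mem_support_pluckerDivisor {S : Finset (Fin n)} {hS : S.card = k}
    {x : Gr K k n} (hx : x ∈ (pluckerDivisor K S hS).support) :
    plucker K S hS ∈ x.asHomogeneousIdeal := by
  let Z : Closeds (Gr K k n) := ⟨(Proj.basicOpen (grading K k n) (plucker K S hS) : Set _)ᶜ,
    (Proj.basicOpen (grading K k n) (plucker K S hS)).isOpen.isClosed_compl⟩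
  have hZ : ∀ x : Gr K k n, x ∈ Z ↔ plucker K S hS ∈ x.asHomogeneousIdeal := fun x => not_not
  let V := Scheme.IdealSheafData.vanishingIdeal Z
  have h1 : ∀ Q : {Q : Finset (Fin n) // Q.card = k}, ∃ N : ℕ, ∀ Y, PluckerVanishes S hS Y →
      V.ideal (Proj.chart (plucker_mem K Q.1 Q.2)) ^ N ≤
        Y.ideal (Proj.chart (plucker_mem K Q.1 Q.2)) := by
    rintro ⟨Q, hQ⟩
    have := isNoetherianRing_away (plucker_mem K Q hQ)
    have : IsNoetherianRing Γ(Gr K k n, Proj.chart (plucker_mem K Q hQ)) :=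
      isNoetherianRing_of_surjective _ _ _ (Proj.awayToSection_bijective (plucker_mem K Q hQ)).2
    obtain ⟨N, hN⟩ := Ideal.exists_pow_le_of_le_radical_of_fg
      (Scheme.IdealSheafData.vanishingIdeal_ideal_le_radical Z
        (Proj.chart (plucker_mem K Q hQ)) (Proj.awayToSection (grading K k n) (plucker K Q hQ)
        (Away.mk (grading K k n) (plucker_mem K Q hQ) 1 (plucker K S hS)
          (by simpa using plucker_mem K S hS))) fun y hy hy' => (hZ y).mpr <| by
            by_contra hn
            exact hy' ((Proj.mem_basicOpen_awayToSection _ (plucker_mem K Q hQ) 1 _ _ hy).mpr hn))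
      (IsNoetherian.noetherian _)
    exact ⟨N, fun Y hY => hN.trans ((Ideal.span_singleton_le_iff_mem _).mpr (hY Q hQ))⟩
  choose N hN using h1
  -- One more than needed, so that the power of `V` has the support of `V`.
  let N' := (∑ Q, N Q) + 1
  have h2 : V ^ N' ≤ pluckerDivisor K S hS := by
    refine le_sInf fun Y hY => le_of_chartIdeal_plucker_le fun Q hQ => ?_
    rw [Proj.chartIdeal_le_iff, Scheme.IdealSheafData.ideal_pow, Pi.pow_apply]
    refine (Ideal.pow_le_pow_right ?_).trans (hN ⟨Q, hQ⟩ Y hY)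
    exact (Finset.single_le_sum (f := N) (fun _ _ => Nat.zero_le _) (Finset.mem_univ _)).trans
      (Nat.le_succ _)
  have h3 : x ∈ V.support := by
    rw [← Scheme.IdealSheafData.support_pow (n := N') V (Nat.succ_ne_zero _)]
    exact Scheme.IdealSheafData.support_antitone h2 hx
  rw [← SetLike.mem_coe, Scheme.IdealSheafData.coe_support_vanishingIdeal] at h3
  exact (hZ x).mp h3

/-- The scheme `coord C` contains no coordinate subspaces other than those of the sets in `C`. -/
theorem mem_of_coordPt_mem_support_coord {C : Set (Finset (Fin n))} {S : Finset (Fin n)}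
    {hS : S.card = k} (h : coordPt K S hS ∈ (coord K k C).support) : S ∈ C := by
  by_contra hn
  refine plucker_notMem_coordPt (K := K) S hS (plucker_mem_of_mem_support_pluckerDivisor
    (Scheme.IdealSheafData.support_antitone ?_ h))
  exact le_iSup_of_le S (le_iSup_of_le hS (le_iSup_of_le hn le_rfl))

end

end GrShift

/-! ### Dimension on an open cover -/

open TopologicalSpace in
/-- The dimension is local: a chain of irreducible closed sets survives in any member of an open
cover that meets its smallest set. -/
theorem topologicalKrullDim_le_of_isOpenEmbedding {X : Type*} [TopologicalSpace X] {ι : Type*}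
    {U : ι → Type*} [∀ i, TopologicalSpace (U i)] {f : ∀ i, U i → X}
    (hf : ∀ i, Topology.IsOpenEmbedding (f i)) (hcov : ∀ x, ∃ i, x ∈ Set.range (f i))
    {d : WithBot ℕ∞} (h : ∀ i, topologicalKrullDim (U i) ≤ d) : topologicalKrullDim X ≤ d := by
  rw [topologicalKrullDim, Order.krullDim_eq_iSup_coheight]
  refine iSup_le fun Z => ?_
  obtain ⟨z, hz⟩ := Z.isIrreducible.nonempty
  obtain ⟨i, y, rfl⟩ := hcov z
  let W := (IrreducibleCloseds.orderIsoOfIsOpenEmbedding (f i) (hf i)).symm ⟨Z, ⟨y, hz⟩⟩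
  have hW : IrreducibleCloseds.map (f i) (hf i).continuous W = Z :=
    congrArg Subtype.val ((IrreducibleCloseds.orderIsoOfIsOpenEmbedding (f i)
      (hf i)).apply_symm_apply ⟨Z, ⟨y, hz⟩⟩)
  rw [← hW, (hf i).coheight_map]
  exact (Order.coheight_le_krullDim W).trans (h i)

namespace AlgebraicGeometry.Proj

open HomogeneousLocalization TopologicalSpace

variable {σ : Type*} {A : Type u} [CommRing A] [SetLike σ A] [AddSubgroupClass σ A]
  {𝒜 : ℕ → σ} [GradedRing 𝒜]

theorem topologicalKrullDim_subschemeCover (X : (Proj 𝒜).IdealSheafData) {s : A} (hs : s ∈ 𝒜 1) :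
    topologicalKrullDim (Spec (X.subschemeCover.X (chart hs))) =
      ringKrullDim (Away 𝒜 s ⧸ chartIdeal X hs) := by
  refine (PrimeSpectrum.topologicalKrullDim_eq_ringKrullDim _).trans ?_
  let e := RingEquiv.ofBijective (awayToSection 𝒜 s).hom (awayToSection_bijective hs)
  refine (ringKrullDim_eq_of_ringEquiv (Ideal.quotientEquiv (chartIdeal X hs)
    (X.ideal (chart hs)) e ?_)).symm
  exact (Ideal.map_comap_of_surjective _ (awayToSection_bijective hs).2 _).symm

theorem ringKrullDim_chart_le (X : (Proj 𝒜).IdealSheafData) {s : A} (hs : s ∈ 𝒜 1) :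
    ringKrullDim (Away 𝒜 s ⧸ chartIdeal X hs) ≤ topologicalKrullDim X.subscheme := by
  rw [← topologicalKrullDim_subschemeCover]
  have := X.subschemeCover.map_prop (chart hs)
  exact ((X.subschemeCover.f (chart hs)).isOpenEmbedding).isInducing.topologicalKrullDim_le

theorem topologicalKrullDim_le_of_chart (X : (Proj 𝒜).IdealSheafData) {ι : Type*} {s : ι → A}
    (hs : ∀ i, s i ∈ 𝒜 1)
    (hspan : (HomogeneousIdeal.irrelevant 𝒜).toIdeal ≤ Ideal.span (Set.range s))
    {d : WithBot ℕ∞} (h : ∀ i, ringKrullDim (Away 𝒜 (s i) ⧸ chartIdeal X (hs i)) ≤ d) :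
    topologicalKrullDim X.subscheme ≤ d := by
  have := fun i => X.subschemeCover.map_prop (chart (hs i))
  refine topologicalKrullDim_le_of_isOpenEmbedding
    (U := fun i => Spec (X.subschemeCover.X (chart (hs i))))
    (f := fun i => X.subschemeCover.f (chart (hs i)))
    (fun i => (X.subschemeCover.f (chart (hs i))).isOpenEmbedding) ?_
    fun i => (topologicalKrullDim_subschemeCover X (hs i)).trans_le (h i)
  intro x
  have h1 : X.subschemeι x ∈ (⨆ i, basicOpen 𝒜 (s i) : (Proj 𝒜).Opens) := by
    rw [iSup_basicOpen_eq_top 𝒜 s hspan]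
    trivial
  obtain ⟨i, hi⟩ := Opens.mem_iSup.mp h1
  refine ⟨i, ?_⟩
  have h2 := X.opensRange_subschemeCover_map (chart (hs i))
  exact h2.ge hi

end AlgebraicGeometry.Proj

namespace GrShift

noncomputable section

/-! ### Dimensions of the charts -/

section Dimension

open HomogeneousLocalization

section Range

variable {R E : Type u} [CommRing R] [Field E] {k n : ℕ} (φ : R →+* E)
  (M : Matrix (Fin k) (Fin n) E) {S : Finset (Fin n)} {hS : S.card = k} (h : minor M S hS ≠ 0)

/-- The affine coordinates of `rowspan M` on the chart `p_S ≠ 0`. -/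
def ratios (M : Matrix (Fin k) (Fin n) E) (S : Finset (Fin n)) (hS : S.card = k) : Set E :=
  {a | ∃ (T : Finset (Fin n)) (hT : T.card = k), a = minor M T hT / minor M S hS}

theorem finite_ratios (M : Matrix (Fin k) (Fin n) E) (S : Finset (Fin n)) (hS : S.card = k) :
    (ratios M S hS).Finite := by
  refine (Set.finite_range fun T : {T : Finset (Fin n) // T.card = k} =>
    minor M T.1 T.2 / minor M S hS).subset ?_
  rintro _ ⟨T, hT, rfl⟩
  exact ⟨⟨T, hT⟩, rfl⟩

/-- The image of the coordinate ring of the chart `p_S ≠ 0` is generated by scalars and ratios. -/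
theorem evAway_mem (O : Subring E) (hφ : ∀ r, φ r ∈ O) (hO : ratios M S hS ⊆ O)
    (a : Away (grading R k n) (plucker R S hS)) : evAway φ M h a ∈ O := by
  obtain ⟨m, F, hF, rfl⟩ := Away.mk_surjective (grading R k n) (plucker_mem R S hS) a
  rw [evAway_mk, div_eq_mul_inv, mul_comm, ← inv_pow]
  have := ev_mem_subring φ M (minor M S hS)⁻¹ O hφ (fun T hT => by
    rw [mul_comm, ← div_eq_mul_inv]
    exact hO ⟨T, hT, rfl⟩) hF
  rwa [smul_eq_mul, mul_one] at this

theorem ratios_subset_range : ratios M S hS ⊆ (evAway φ M h).range := by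
  rintro _ ⟨T, hT, rfl⟩
  refine ⟨Away.mk _ (plucker_mem R S hS) 1 (plucker R T hT) (by simpa using plucker_mem R T hT), ?_⟩
  rw [evAway_mk, ev_plucker, pow_one]

theorem algebraMap_mem_range (r : R) : φ r ∈ (evAway φ M h).range :=
  ⟨scalar S hS r, evAway_scalar φ M h r⟩

end Range

/-- A subalgebra that generates the field `L` has the same transcendence degree as `L`. -/
theorem trdeg_adjoin_eq {K L : Type u} [Field K] [Field L] [Algebra K L] {G : Set L}
    (hG : IntermediateField.adjoin K G = ⊤) :
    Algebra.trdeg K (Algebra.adjoin K G) = Algebra.trdeg K L := by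
  have halg : Algebra.IsAlgebraic (Algebra.adjoin K G) L := by
    refine ⟨fun x => ?_⟩
    have hx : x ∈ IntermediateField.adjoin K G := hG ▸ IntermediateField.mem_top
    rw [IntermediateField.mem_adjoin_iff_div] at hx
    obtain ⟨r, hr, s, hs, rfl⟩ := hx
    have h1 : ∀ y : Algebra.adjoin K G, IsAlgebraic (Algebra.adjoin K G) (y : L) :=
      fun y => isAlgebraic_algebraMap y
    rw [div_eq_mul_inv]
    exact (h1 ⟨r, hr⟩).mul (h1 ⟨s, hs⟩).inv
  have h := _root_.trdeg_add_eq K (Algebra.adjoin K G) (A := L)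
  rwa [_root_.trdeg_eq_zero (R := Algebra.adjoin K G), add_zero] at h

theorem finiteType_adjoin {K L : Type u} [Field K] [Field L] [Algebra K L] {G : Set L}
    (hG : G.Finite) : Algebra.FiniteType K (Algebra.adjoin K G) :=
  .adjoin_of_finite hG

variable {K : Type u} [Field K] {k n : ℕ} {L E : Type u} [Field L] [Field E] [Algebra K L]
  {M : Matrix (Fin k) (Fin n) L}
  {hM : ∃ (S : Finset (Fin n)) (hS : S.card = k), minor M S hS ≠ 0}

/-- The dimension of a standard chart of a subvariety is at most the transcendence degree of any
field over which its generic point is defined. -/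
theorem ringKrullDim_chart_le_trdeg {d : ℕ} (hd : Algebra.trdeg K L ≤ d) (S : Finset (Fin n))
    (hS : S.card = k) :
    ringKrullDim (Away (grading K k n) (plucker K S hS) ⧸
      Proj.chartIdeal (Proj.closureIdeal (pt (algebraMap K L) M hM)) (plucker_mem K S hS)) ≤ d := by
  by_cases h : minor M S hS = 0
  · rw [chartIdeal_closureIdeal_of_mem ((plucker_mem_pt_iff _ _ _ _ _).mpr h)]
    have : Subsingleton (Away (grading K k n) (plucker K S hS) ⧸
      (⊤ : Ideal (Away (grading K k n) (plucker K S hS)))) :=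
      Ideal.Quotient.subsingleton_iff.mpr rfl
    rw [ringKrullDim_eq_bot_of_subsingleton]
    exact bot_le
  rw [chartIdeal_closureIdeal_pt _ _ _ h]
  let B := Algebra.adjoin K (ratios M S hS)
  have hB : ∀ a, evAway (algebraMap K L) M h a ∈ B.toSubring :=
    evAway_mem _ _ h B.toSubring (fun r => B.algebraMap_mem r) Algebra.subset_adjoin
  let f := (evAway (algebraMap K L) M h).codRestrict B.toSubring hB
  have hker : RingHom.ker f = RingHom.ker (evAway (algebraMap K L) M h) := by
    ext a
    exact Subtype.ext_iff
  have hsurj : Function.Surjective f := by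
    rintro ⟨b, hb⟩
    have : B ≤ { (evAway (algebraMap K L) M h).range with
        algebraMap_mem' := fun r => algebraMap_mem_range _ M h r } :=
      Algebra.adjoin_le (ratios_subset_range _ M h)
    obtain ⟨a, ha⟩ := this hb
    exact ⟨a, Subtype.ext ha⟩
  rw [← hker, ringKrullDim_eq_of_ringEquiv (RingHom.quotientKerEquivOfSurjective hsurj)]
  have : Algebra.FiniteType K B := finiteType_adjoin (finite_ratios M S hS)
  obtain ⟨s, hs, hdim, -⟩ := Algebra.FiniteType.exists_trdeg_eq K B
  refine hdim.trans ?_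
  have h1 : Algebra.trdeg K B ≤ Algebra.trdeg K L :=
    _root_.trdeg_le_of_injective B.val Subtype.val_injective
  rw [hs] at h1
  exact_mod_cast h1.trans hd

variable [Algebra K E] [Algebra L E] [IsScalarTower K L E] {u : Eˣ} {i j : Fin n}

/-- The affine coordinates of the family `rowspan M * exp (u⁻¹ e_ij)`, together with `u`, generate
the function field of the family. -/
theorem adjoin_ratios_transvection_eq_top (hij : i ≠ j) {Q : Finset (Fin n)} {hQ : Q.card = k}
    (hMQ : minor M Q hQ = 1)
    (hgen : IntermediateField.adjoin K {a | ∃ (T : Finset (Fin n)) (hT : T.card = k),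
      a = minor M T hT} = ⊤)
    (hE : ∀ F : IntermediateField K E, (∀ a : L, algebraMap L E a ∈ F) → (u : E) ∈ F → F = ⊤)
    {S : Finset (Fin n)} {hS : S.card = k}
    (hne : minor (M.map (algebraMap L E) * Matrix.transvection i j (u : E)⁻¹) S hS ≠ 0) :
    IntermediateField.adjoin K (insert (u : E)
      (ratios (M.map (algebraMap L E) * Matrix.transvection i j (u : E)⁻¹) S hS)) = ⊤ := by
  set N := M.map (algebraMap L E) * Matrix.transvection i j (u : E)⁻¹ with hN
  set F := IntermediateField.adjoin K (insert (u : E) (ratios N S hS)) with hF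
  have hu : (u : E) ∈ F := IntermediateField.subset_adjoin _ _ (Set.mem_insert _ _)
  have hr : ∀ (T : Finset (Fin n)) (hT : T.card = k), minor N T hT / minor N S hS ∈ F :=
    fun T hT => IntermediateField.subset_adjoin _ _ (Set.mem_insert_of_mem _ ⟨T, hT, rfl⟩)
  have hNM : N * (Matrix.transvection i j (-(⟨u, hu⟩ : F)⁻¹)).map (algebraMap F E) =
      M.map (algebraMap L E) := by
    have hval : algebraMap F E ⟨u, hu⟩ = u := rfl
    rw [transvection_map, map_neg, map_inv₀, hval, hN, Matrix.mul_assoc,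
      Matrix.transvection_mul_transvection_same _ _ hij, add_neg_cancel,
      Matrix.transvection_zero, Matrix.mul_one]
  have h1 : ∀ (T : Finset (Fin n)) (hT : T.card = k),
      minor (M.map (algebraMap L E)) T hT / minor N S hS ∈ F := by
    intro T hT
    have h := minor_mul_mem N (Matrix.transvection i j (-(⟨u, hu⟩ : F)⁻¹)) T hT
    rw [hNM] at h
    generalize minor (M.map (algebraMap L E)) T hT = a at h ⊢
    induction h using Submodule.span_induction with
    | mem x hx =>
      obtain ⟨T', hT', rfl⟩ := hx
      exact hr T' hT'
    | zero => rw [zero_div]; exact F.zero_mem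
    | add x y _ _ hx hy => rw [add_div]; exact F.add_mem hx hy
    | smul a x _ hx =>
      rw [Algebra.smul_def, mul_div_assoc]
      exact F.mul_mem a.2 hx
  have h2 : (minor N S hS)⁻¹ ∈ F := by
    have h := h1 Q hQ
    rwa [minor_map, hMQ, map_one, one_div] at h
  refine hE F ?_ hu
  have h3 : (⊤ : IntermediateField K L) ≤ F.comap (IsScalarTower.toAlgHom K L E) := by
    rw [← hgen, IntermediateField.adjoin_le_iff]
    rintro _ ⟨T, hT, rfl⟩
    change algebraMap L E (minor M T hT) ∈ F
    have h := F.mul_mem (h1 T hT) (F.inv_mem h2)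
    rwa [inv_inv, div_mul_cancel₀ _ hne, minor_map] at h
  exact fun a => h3 (x := a) trivial

/-- Every nonempty standard chart of the geometric shift has at least the dimension of the
subvariety: it is the divisor `u = 0` in a chart of the family, whose dimension is one more. -/
theorem le_ringKrullDim_chart_geomShift
    (hu : ∀ p : L[X], p.eval₂ (algebraMap L E) (u : E) = 0 → p = 0) (hij : i ≠ j)
    {Q : Finset (Fin n)} {hQ : Q.card = k} (hMQ : minor M Q hQ = 1)
    (hgen : IntermediateField.adjoin K {a | ∃ (T : Finset (Fin n)) (hT : T.card = k),
      a = minor M T hT} = ⊤)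
    (hE : ∀ F : IntermediateField K E, (∀ a : L, algebraMap L E a ∈ F) → (u : E) ∈ F → F = ⊤)
    {d : ℕ} (hd : Algebra.trdeg K E = d + 1) {S : Finset (Fin n)} (hS : S.card = k)
    (hne : Proj.chartIdeal (geomShift hij (Proj.closureIdeal (pt (algebraMap K L) M hM)))
      (plucker_mem K S hS) ≠ ⊤) :
    (d : WithBot ℕ∞) ≤ ringKrullDim (Away (grading K k n) (plucker K S hS) ⧸
      Proj.chartIdeal (geomShift hij (Proj.closureIdeal (pt (algebraMap K L) M hM)))
        (plucker_mem K S hS)) := by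
  rw [chartIdeal_geomShift hu hij S hS] at hne ⊢
  set N := M.map (algebraMap L E) * Matrix.transvection i j (u : E)⁻¹ with hN
  set ψ₀ := Polynomial.eval₂RingHom ((algebraMap L E).comp (algebraMap K L)) (u : E) with hψ₀
  have h : minor N S hS ≠ 0 := by
    intro h
    refine hne ?_
    rw [chartIdeal_closureIdeal_of_mem ((plucker_mem_pt_iff _ _ _ _ _).mpr h), Ideal.map_top]
  rw [chartIdeal_closureIdeal_pt _ _ _ h] at hne ⊢
  set π := chartMap (k := k) (n := n) (Polynomial.evalRingHom (0 : K)) S hS with hπ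
  have hπs : Function.Surjective π := chartMap_evalRingHom_surjective S hS
  let C := Algebra.adjoin K (insert (u : E) (ratios N S hS))
  have huC : (u : E) ∈ C := Algebra.subset_adjoin (Set.mem_insert _ _)
  have hψ₀C : ∀ p, ψ₀ p ∈ C := by
    intro p
    have : ψ₀ p = Polynomial.aeval (u : E) p := by
      rw [hψ₀, ← IsScalarTower.algebraMap_eq]
      rfl
    rw [this]
    exact Algebra.adjoin_mono (Set.singleton_subset_iff.mpr (Set.mem_insert _ _))
      (Polynomial.aeval_mem_adjoin_singleton K (u : E))
  let ψ := (evAway ψ₀ N h).codRestrict C.toSubring (evAway_mem _ _ h C.toSubring hψ₀C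
    ((Set.subset_insert _ _).trans Algebra.subset_adjoin))
  have hψ : ∀ a, (ψ a : E) = evAway ψ₀ N h a := fun _ => rfl
  have hψX : ψ (scalar S hS Polynomial.X) = ⟨u, huC⟩ := by
    apply Subtype.ext
    rw [hψ, evAway_scalar, hψ₀, Polynomial.coe_eval₂RingHom, Polynomial.eval₂_X]
  have hψs : Function.Surjective ψ := by
    rintro ⟨b, hb⟩
    have : C ≤ { (evAway ψ₀ N h).range with
        algebraMap_mem' := fun r => by
          have hr : ψ₀ (Polynomial.C r) = algebraMap K E r := by
            rw [hψ₀, Polynomial.coe_eval₂RingHom, Polynomial.eval₂_C,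
              ← IsScalarTower.algebraMap_eq]
          exact hr ▸ algebraMap_mem_range ψ₀ N h (Polynomial.C r) } := by
      refine Algebra.adjoin_le (Set.insert_subset ?_ (ratios_subset_range _ N h))
      exact ⟨_, congrArg Subtype.val hψX⟩
    obtain ⟨a, ha⟩ := this hb
    exact ⟨a, Subtype.ext ha⟩
  have hunit : ¬IsUnit (⟨u, huC⟩ : C) := by
    intro hun
    obtain ⟨v, hv⟩ := hun.exists_right_inv
    obtain ⟨w, rfl⟩ := hψs v
    refine hne ((Ideal.eq_top_iff_one _).mpr ?_)
    have h1 : 1 - scalar S hS Polynomial.X * w ∈ RingHom.ker (evAway ψ₀ N h) := by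
      rw [RingHom.mem_ker, ← hψ, map_sub, map_one, map_mul, hψX]
      have : (⟨u, huC⟩ : C) * ψ w = 1 := hv
      exact congrArg Subtype.val (sub_eq_zero.mpr this.symm)
    have h2 := Ideal.mem_map_of_mem π h1
    rwa [map_sub, map_one, map_mul, hπ, chartMap_evalRingHom_scalar_X, zero_mul, sub_zero] at h2
  have hft : Algebra.FiniteType K C := finiteType_adjoin ((finite_ratios N S hS).insert _)
  have htr : Algebra.trdeg K C = d + 1 := by
    rw [← hd]
    exact trdeg_adjoin_eq (adjoin_ratios_transvection_eq_top hij hMQ hgen hE h)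
  refine (Algebra.FiniteType.le_ringKrullDim_quotient_span_singleton K C htr hunit).trans ?_
  let q : C.toSubring →+* C ⧸ Ideal.span {(⟨u, huC⟩ : C)} := Ideal.Quotient.mk _
  have hq : Function.Surjective q := Ideal.Quotient.mk_surjective
  have hker : RingHom.ker π ≤ RingHom.ker (q.comp ψ) := by
    rw [hπ, ker_chartMap_evalRingHom, Ideal.span_singleton_le_iff_mem, RingHom.mem_ker,
      RingHom.comp_apply, hψX]
    exact Ideal.Quotient.eq_zero_iff_mem.mpr (Ideal.mem_span_singleton_self _)
  let θ := RingHom.liftOfSurjective π hπs ⟨q.comp ψ, hker⟩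
  have hθ : ∀ a, θ (π a) = q (ψ a) := fun a =>
    RingHom.liftOfRightInverse_comp_apply _ _ _ ⟨q.comp ψ, hker⟩ a
  have hker' : ∀ a ∈ (RingHom.ker (evAway ψ₀ N h)).map π, θ a = 0 := by
    have : (RingHom.ker (evAway ψ₀ N h)).map π ≤ RingHom.ker θ := by
      rw [Ideal.map_le_iff_le_comap]
      intro a ha
      rw [Ideal.mem_comap, RingHom.mem_ker, hθ]
      have : ψ a = 0 := Subtype.ext ha
      rw [this, map_zero]
    exact fun a ha => this ha
  refine ringKrullDim_le_of_surjective (Ideal.Quotient.lift _ θ hker')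
    (Ideal.Quotient.lift_surjective_of_surjective _ hker' fun b => ?_)
  obtain ⟨c, rfl⟩ := hq b
  obtain ⟨a, rfl⟩ := hψs c
  exact ⟨π a, hθ a⟩

end Dimension

end

end GrShift

/-! ### The geometric shift as a union -/

/-- An inclusion of an integral closed subscheme in a closed subscheme may be tested on one chart
that contains the generic point. -/
theorem AlgebraicGeometry.Proj.le_closureIdeal_of_chartIdeal_le {σ : Type*} {A : Type u}
    [CommRing A] [SetLike σ A] [AddSubgroupClass σ A] {𝒜 : ℕ → σ} [GradedRing 𝒜]
    {X : (Proj 𝒜).IdealSheafData} {x : Proj 𝒜} {s : A} (hs : s ∈ 𝒜 1)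
    (hx : s ∉ x.asHomogeneousIdeal) (h : chartIdeal X hs ≤ chartIdeal (closureIdeal x) hs) :
    X ≤ closureIdeal x := by
  have hxU : x ∈ (chart hs).1 := hx
  have h1 : x ∈ (closureIdeal x).support := mem_support_closureIdeal.mpr le_rfl
  rw [le_closureIdeal_iff]
  rw [Scheme.IdealSheafData.mem_support_iff_of_mem hxU] at h1 ⊢
  exact Scheme.zeroLocus_mono _ ((chartIdeal_le_iff hs).mp h) h1

namespace GrShift

noncomputable section

section Union

open HomogeneousLocalization

theorem _root_.Ideal.eq_of_ringKrullDim_quotient_le {R : Type*} [CommRing R] {I J : Ideal R}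
    [I.IsPrime] (hIJ : I ≤ J) {d : ℕ} (hI : ringKrullDim (R ⧸ I) ≤ d)
    (hJ : (d : WithBot ℕ∞) ≤ ringKrullDim (R ⧸ J)) : I = J := by
  refine le_antisymm hIJ ?_
  rw [← ringKrullDim_eq_of_ringEquiv (DoubleQuot.quotQuotEquivQuotOfLE hIJ)] at hJ
  have h := Ideal.eq_bot_of_le_ringKrullDim_quotient hI hJ
  rwa [Ideal.map_eq_bot_iff_le_ker, Ideal.mk_ker] at h

variable {K : Type u} [Field K] {k n : ℕ}

/-- Every subvariety is the closure of the row span of a matrix with a minor `1` over an extension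
field that is generated by the minors. -/
theorem exists_eq_closureIdeal_pt {X : (Gr K k n).IdealSheafData} (hX : IsSubvariety X) :
    ∃ (L : Type u) (_ : Field L) (_ : Algebra K L) (M : Matrix (Fin k) (Fin n) L)
      (Q : Finset (Fin n)) (hQ : Q.card = k) (hM : minor M Q hQ = 1),
      X = Proj.closureIdeal (pt (algebraMap K L) M ⟨Q, hQ, hM ▸ one_ne_zero⟩) ∧
      IntermediateField.adjoin K {a | ∃ (S : Finset (Fin n)) (hS : S.card = k), a = minor M S hS} =
        ⊤ := by
  have : IsIntegral X.subscheme := hX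
  obtain ⟨x, rfl⟩ := Proj.exists_eq_closureIdeal X
  obtain ⟨L, hL, hKL, M, Q, hQ, hM, rfl, hgen⟩ := exists_eq_pt x
  exact ⟨L, hL, hKL, M, Q, hQ, hM, rfl, hgen⟩

/-- A `T`-invariant subvariety that does not contain `coord S` does not meet the chart `p_S ≠ 0`. -/
theorem chartIdeal_eq_top_of_coordPt_notMem {X : (Gr K k n).IdealSheafData} (hX : IsSubvariety X)
    (hXT : TInvariant X) {S : Finset (Fin n)} {hS : S.card = k}
    (h : coordPt K S hS ∉ X.support) : Proj.chartIdeal X (plucker_mem K S hS) = ⊤ := by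
  obtain ⟨L, _, _, M, Q, hQ, hM, rfl, -⟩ := exists_eq_closureIdeal_pt hX
  refine chartIdeal_closureIdeal_of_mem ((plucker_mem_pt_iff _ _ _ _ _).mpr ?_)
  by_contra hne
  exact h (hXT.coordPt_mem_support _ M _ (Proj.mem_support_closureIdeal.mpr le_rfl) S hS hne)

section FunctionField

variable (L : Type u) [Field L]

/-- The parameter `u` of the family `rowspan M * exp (u⁻¹ e_ij)`, as an element of the field of
rational functions. -/
def param : (FractionRing L[X])ˣ :=
  Units.mk0 (algebraMap L[X] _ Polynomial.X)
    ((map_ne_zero_iff _ (IsFractionRing.injective _ _)).mpr Polynomial.X_ne_zero)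

theorem eval₂_param (p : L[X]) :
    p.eval₂ (algebraMap L (FractionRing L[X])) (param L : FractionRing L[X]) =
      algebraMap L[X] _ p := by
  rw [IsScalarTower.algebraMap_eq L L[X] (FractionRing L[X]), Polynomial.algebraMap_eq, param,
    Units.val_mk0, ← Polynomial.hom_eval₂, Polynomial.eval₂_C_X]

theorem eq_zero_of_eval₂_param (p : L[X])
    (h : p.eval₂ (algebraMap L (FractionRing L[X])) (param L : FractionRing L[X]) = 0) :
    p = 0 := by
  rwa [eval₂_param, map_eq_zero_iff _ (IsFractionRing.injective _ _)] at h

/-- The field of rational functions is generated by `L` and `u`. -/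
theorem eq_top_of_param_mem [Algebra K L] (F : IntermediateField K (FractionRing L[X]))
    (hL : ∀ a : L, algebraMap L (FractionRing L[X]) a ∈ F)
    (hu : (param L : FractionRing L[X]) ∈ F) : F = ⊤ := by
  have h : ∀ p : L[X], algebraMap L[X] (FractionRing L[X]) p ∈ F := by
    intro p
    rw [← eval₂_param, Polynomial.eval₂_eq_sum]
    exact F.sum_mem fun e _ => F.mul_mem (hL _) (pow_mem hu _)
  refine eq_top_iff.mpr fun x _ => ?_
  obtain ⟨p, q, -, rfl⟩ := IsFractionRing.div_surjective (A := L[X]) x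
  exact F.div_mem (h p) (h q)

theorem trdeg_fractionRing_polynomial [Algebra K L] :
    Algebra.trdeg K (FractionRing L[X]) = Algebra.trdeg K L + 1 := by
  have : Algebra.IsAlgebraic L[X] (FractionRing L[X]) :=
    IsLocalization.isAlgebraic _ (nonZeroDivisors L[X])
  have h := trdeg_add_eq L L[X] (A := FractionRing L[X])
  rw [Polynomial.trdeg_of_isDomain, _root_.trdeg_eq_zero (R := L[X]), add_zero] at h
  rw [← trdeg_add_eq K L (A := FractionRing L[X]), ← h]

end FunctionField

/-- Let `S` be in the shifted collection of `X`. A subvariety `Y` that has the dimension of `X`,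
contains `coord S`, and contains the geometric shift on the chart `p_S ≠ 0` is contained in the
geometric shift: the shift fills the chart for reasons of dimension. -/
theorem geomShift_le_of_chartIdeal_le {i j : Fin n} (hij : i ≠ j) {X Y : (Gr K k n).IdealSheafData}
    (hX : IsSubvariety X) (hXT : TInvariant X) (hY : IsSubvariety Y)
    (hdim : topologicalKrullDim Y.subscheme = topologicalKrullDim X.subscheme)
    {S : Finset (Fin n)} {hS : S.card = k} (hSY : coordPt K S hS ∈ Y.support)
    (hSX : S ∈ shiftColl i j (coordInv X))
    (hle : Proj.chartIdeal Y (plucker_mem K S hS) ≤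
      Proj.chartIdeal (geomShift hij X) (plucker_mem K S hS)) : geomShift hij X ≤ Y := by
  obtain ⟨L, _, _, M, Q, hQ, hMQ, rfl, hgen⟩ := exists_eq_closureIdeal_pt hX
  obtain ⟨d, hd⟩ : ∃ d : ℕ, Algebra.trdeg K L = d := by
    have hfin : {a | ∃ (S : Finset (Fin n)) (hS : S.card = k), a = minor M S hS}.Finite := by
      have := finite_ratios M Q hQ
      simpa only [ratios, hMQ, div_one] using this
    have := finiteType_adjoin (K := K) hfin
    obtain ⟨d, hd, -⟩ := Algebra.FiniteType.exists_trdeg_eq K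
      (Algebra.adjoin K {a | ∃ (S : Finset (Fin n)) (hS : S.card = k), a = minor M S hS})
    exact ⟨d, (trdeg_adjoin_eq hgen).symm.trans hd⟩
  have hge := le_ringKrullDim_chart_geomShift (eq_zero_of_eval₂_param L) hij hMQ hgen
    (eq_top_of_param_mem L) (by rw [trdeg_fractionRing_polynomial, hd]) hS
    (chartIdeal_geomShift_ne_top (eq_zero_of_eval₂_param L) hij hXT
      (mem_coordInv_closureIdeal_iff _ M _ hXT) hS hSX)
  have hXd : topologicalKrullDim (Proj.closureIdeal
      (pt (algebraMap K L) M ⟨Q, hQ, hMQ ▸ one_ne_zero⟩)).subscheme ≤ d :=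
    Proj.topologicalKrullDim_le_of_chart _
      (fun S : {S : Finset (Fin n) // S.card = k} => plucker_mem K S.1 S.2)
      (irrelevant_le_span_plucker K k n) fun S => ringKrullDim_chart_le_trdeg hd.le S.1 S.2
  have hYd := (Proj.ringKrullDim_chart_le Y (plucker_mem K S hS)).trans (hdim.trans_le hXd)
  obtain ⟨L', _, _, M', Q', hQ', hM', rfl, -⟩ := exists_eq_closureIdeal_pt hY
  have hSM : plucker K S hS ∉
      (pt (algebraMap K L') M' ⟨Q', hQ', hM' ▸ one_ne_zero⟩).asHomogeneousIdeal := fun h =>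
    plucker_notMem_coordPt S hS (Proj.mem_support_closureIdeal.mp hSY h)
  have hne : minor M' S hS ≠ 0 := fun h => hSM ((plucker_mem_pt_iff _ _ _ _ _).mpr h)
  have hprime : (Proj.chartIdeal (Proj.closureIdeal (pt (algebraMap K L') M'
      ⟨Q', hQ', hM' ▸ one_ne_zero⟩)) (plucker_mem K S hS)).IsPrime := by
    rw [chartIdeal_closureIdeal_pt _ _ _ hne]
    exact RingHom.ker_isPrime _
  exact Proj.le_closureIdeal_of_chartIdeal_le (plucker_mem K S hS) hSM
    (Ideal.eq_of_ringKrullDim_quotient_le hle hYd hge).ge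

/-- The geometric shift is contained in the coordinate subscheme of the shifted collection. -/
theorem coord_shiftColl_coordInv_le_geomShift {i j : Fin n} (hij : i ≠ j)
    {X : (Gr K k n).IdealSheafData} (hX : IsSubvariety X) (hXT : TInvariant X) :
    coord K k (shiftColl i j (coordInv X)) ≤ geomShift hij X := by
  obtain ⟨L, _, _, M, Q, hQ, hMQ, rfl, -⟩ := exists_eq_closureIdeal_pt hX
  exact coord_shiftColl_le_geomShift (eq_zero_of_eval₂_param L) hij
    (mem_coordInv_closureIdeal_iff _ M _ hXT)

end Union

end

end GrShift

theorem mainTheorem10 {K : Type u} [Field K] {k n m : ℕ} {i j : Fin n} (hij : i ≠ j)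
    (X : (GrShift.Gr K k n).IdealSheafData)
    (X' : Fin m → (GrShift.Gr K k n).IdealSheafData)
    (hX : GrShift.IsSubvariety X) (hXT : GrShift.TInvariant X)
    (hX' : ∀ l, GrShift.IsSubvariety (X' l)) (hXT' : ∀ l, GrShift.TInvariant (X' l))
    (hdim : ∀ l, topologicalKrullDim (X' l).subscheme = topologicalKrullDim X.subscheme)
    (hcoord : GrShift.coord K k (GrShift.shiftColl i j (GrShift.coordInv X)) = ⨅ l, X' l)
    (hfix : ∀ l, (GrShift.fixedPoints (X' l) \
      ⋃ l' ∈ {l' : Fin m | l' ≠ l}, GrShift.fixedPoints (X' l')).Nonempty) :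
    GrShift.geomShift hij X = ⨅ l, X' l := by
  have hsub := GrShift.coord_shiftColl_coordInv_le_geomShift hij hX hXT
  refine le_antisymm (le_iInf fun l => ?_) (hcoord ▸ hsub)
  obtain ⟨x, hx, hx'⟩ := hfix l
  obtain ⟨S, hS, rfl⟩ := GrShift.exists_eq_coordPt hx
  have hother : ∀ l', l' ≠ l → GrShift.coordPt K S hS ∉ (X' l').support := fun l' hl' h =>
    hx' (Set.mem_biUnion (x := l') hl' ⟨h, hx.2⟩)
  refine GrShift.geomShift_le_of_chartIdeal_le hij hX hXT (hX' l) (hdim l) hx.1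
    (GrShift.mem_of_coordPt_mem_support_coord (K := K) (hS := hS) ?_) ?_
  · rw [hcoord]
    exact Scheme.IdealSheafData.support_antitone (iInf_le X' l) hx.1
  · refine le_trans ?_ ((Proj.chartIdeal_le_iff _).mpr
      (Scheme.IdealSheafData.ideal_mono (hcoord ▸ hsub) _))
    rw [Proj.chartIdeal_le_iff, Scheme.IdealSheafData.ideal_iInf, iInf_apply]
    refine le_iInf fun l' => ?_
    rcases eq_or_ne l' l with rfl | hl'
    · exact le_rfl
    · rw [← Proj.chartIdeal_le_iff,
        GrShift.chartIdeal_eq_top_of_coordPt_notMem (hX' l') (hXT' l') (hother l' hl')]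
      exact le_top
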